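/- Let $\nu>-1$ be a real number and let $J_\nu$ be the Bessel function of the first kind. Let $b:[0,\infty)\to\mathbb C$ belong to $L^\infty(\mathbb R_+)\cap L^1(\mathbb R_+)$. Assume that $b$ is continuous and piecewise $C^1$ on $[0,\infty)$, i.e. there are $0=t_0<t_1<\dots<t_N<\infty$, $N\ge 0$, such that $b$ is continuously differentiable on each of the intervals $[t_0,t_1],\dots,[t_{N-1},t_N],[t_N,\infty)$ (with one-sided derivatives at the end points), and that $(1+t)^{-1}b'(t)\in L^1(\mathbb R_+)$. Then for all $x,y>0$ the integral $$K(x,y)=\int_0^\infty t\sqrt{xy}\,J_\nu(xt)J_\nu(yt)\,b(t)\,dt$$ converges absolutely; for every $\tau>0$ the truncated Bessel operator $B_\tau(b)$, i.e. the integral operator on $L^2[0,\tau]$ with kernel $K(x,y)$, is a well-defined bounded operator of trace class; and $$\operatorname{trace} B_\tau(b)=\frac{\tau}{\pi}\int_0^\infty b(t)\,dt-\frac{\nu}{2}\,b(0)+o(1)\qquad\text{as }\tau\to\infty .$$ -/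

import Mathlib

open MeasureTheory Set Filter Asymptotics
open scoped InnerProductSpace ENNReal

noncomputable section

/-- The Bessel function of the first kind `J_ν(x) = ∑ₖ (-1)ᵏ / (k! Γ(k+ν+1)) (x/2)^(2k+ν)`,
for a real order `ν` and an argument `x > 0`. -/
def besselJ (ν x : ℝ) : ℝ :=
  ∑' k : ℕ, (-1 : ℝ) ^ k / ((k.factorial : ℝ) * Real.Gamma (k + ν + 1)) *
    (x / 2) ^ (2 * (k : ℝ) + ν)

/-- The integrand `t √(xy) J_ν(xt) J_ν(yt) a(t)` of the Bessel kernel. -/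
def besselIntegrand (ν : ℝ) (a : ℝ → ℂ) (x y t : ℝ) : ℂ :=
  ((t * √(x * y) * besselJ ν (x * t) * besselJ ν (y * t) : ℝ) : ℂ) * a t

/-- The Bessel kernel `K(x,y) = ∫₀^∞ t √(xy) J_ν(xt) J_ν(yt) a(t) dt`. -/
def besselKernel (ν : ℝ) (a : ℝ → ℂ) (x y : ℝ) : ℂ :=
  ∫ t in Ioi (0 : ℝ), besselIntegrand ν a x y t

section IntegralOperators

variable {X : Type*} [MeasurableSpace X]

/-- The bounded operator `T` on `L²(μ)` is the integral operator with kernel `K`: for every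
`f ∈ L²(μ)` and almost every `x`, the function `K(x,·) f` is integrable and
`(T f)(x) = ∫ K(x,y) f(y) dμ(y)`. -/
def HasIntegralKernel (μ : Measure X) (K : X → X → ℂ)
    (T : Lp ℂ 2 μ →L[ℂ] Lp ℂ 2 μ) : Prop :=
  ∀ f : Lp ℂ 2 μ, ∀ᵐ x ∂μ,
    Integrable (fun y => K x y * f y) μ ∧ T f x = ∫ y, K x y * f y ∂μ

/-- A kernel determines its integral operator. -/
theorem HasIntegralKernel.unique {μ : Measure X} {K : X → X → ℂ}
    {S T : Lp ℂ 2 μ →L[ℂ] Lp ℂ 2 μ} (hS : HasIntegralKernel μ K S)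
    (hT : HasIntegralKernel μ K T) : S = T := by
  ext1 f
  apply Lp.ext
  filter_upwards [hS f, hT f] with x h1 h2
  rw [h1.2, h2.2]

open Classical in
/-- The bounded integral operator on `L²(μ)` with kernel `K` (and `0` if `K` is not the kernel
of a bounded integral operator on `L²(μ)`). -/
def integralOperator (μ : Measure X) (K : X → X → ℂ) : Lp ℂ 2 μ →L[ℂ] Lp ℂ 2 μ :=
  if h : ∃ T, HasIntegralKernel μ K T then h.choose else 0

theorem HasIntegralKernel.integralOperator_eq {μ : Measure X} {K : X → X → ℂ}
    {T : Lp ℂ 2 μ →L[ℂ] Lp ℂ 2 μ} (hT : HasIntegralKernel μ K T) :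
    integralOperator μ K = T := by
  have h : ∃ T, HasIntegralKernel μ K T := ⟨T, hT⟩
  rw [integralOperator, dif_pos h]
  exact h.choose_spec.unique hT

end IntegralOperators

/-- The truncated Bessel operator `B_τ(a)`: the integral operator on `L²[0,τ]` whose kernel is
the Bessel kernel. -/
def truncatedBessel (ν : ℝ) (a : ℝ → ℂ) (τ : ℝ) :
    Lp ℂ 2 (volume.restrict (Icc 0 τ)) →L[ℂ] Lp ℂ 2 (volume.restrict (Icc 0 τ)) :=
  integralOperator (volume.restrict (Icc 0 τ)) (besselKernel ν a)

section Trace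

universe u

variable {H : Type u} [NormedAddCommGroup H] [InnerProductSpace ℂ H] [CompleteSpace H]

/-- `T` is of trace class: for every orthonormal basis `(eᵢ)` the series `∑ᵢ ⟨eᵢ, |T| eᵢ⟩`
converges, where `|T| = (T* T)^(1/2)`. -/
def IsTraceClass (T : H →L[ℂ] H) : Prop :=
  ∀ (ι : Type u) (e : HilbertBasis ι ℂ H), Summable fun i => ⟪e i, CFC.abs T (e i)⟫_ℂ

/-- The trace `∑ᵢ ⟨eᵢ, T eᵢ⟩` of an operator of trace class, computed in some orthonormal basis
(for operators of trace class the sum does not depend on the basis). -/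
def operatorTrace (T : H →L[ℂ] H) : ℂ :=
  ∑' i, ⟪(exists_hilbertBasis ℂ H).choose_spec.choose i,
    T ((exists_hilbertBasis ℂ H).choose_spec.choose i)⟫_ℂ

end Trace

/-- `f` is piecewise `C¹` on `[0,∞)`: there are `0 = t₀ < t₁ < ⋯ < t_N`, `N ≥ 0`, such that `f` is
continuously differentiable (one-sidedly at the end points) on each of the intervals
`[t₀,t₁], …, [t_{N-1},t_N], [t_N,∞)`. -/
def PiecewiseC1 (f : ℝ → ℂ) : Prop :=
  ∃ (N : ℕ) (t : Fin (N + 1) → ℝ), t 0 = 0 ∧ StrictMono t ∧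
    (∀ i : Fin N, ContDiffOn ℝ 1 f (Icc (t i.castSucc) (t i.succ))) ∧
    ContDiffOn ℝ 1 f (Ici (t (Fin.last N)))

end

open scoped Topology

/-!
The operator `B_τ(b)` is the integral `∫ b(t) ⟨φ_t, ·⟩ φ_t dt` of rank one operators on `L²[0,τ]`,
where `φ_t(x) = √(xt) J_ν(xt)`. This integral converges absolutely
(`exists_isFactorization`), hence `B_τ(b)` is of trace class
(`IsRankOneIntegral.isTraceClass`) and its trace is
`∫ b(t) ‖φ_t‖² dt = ∫₀^∞ b(t) τ M(τt) dt` (`operatorTrace_truncatedBessel`), where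
`M(s) = s⁻¹ ∫₀ˢ u J_ν(u)² du` is `besselMean`.

The functions `√s J_ν(s)` and `√s J_{ν+1}(s)` satisfy a first order linear system whose energy `E`
(`besselEnergy`) converges at infinity at the rate `s⁻²`, and `M - 1/π` has the explicit primitive
`R(s) = ν (1/2 - ∫₀ˢ J_ν J_{ν+1}) + s (E(s) - 1/π)` (`besselRemainder`). Since `E → 1/π`
(`tendsto_besselEnergy`) and `∫₀^∞ J_ν J_{ν+1} = 1/2` (`tendsto_besselProdInt`), one has
`R(s) = O(1/(1+s))` (`exists_abs_besselRemainder_le`), while `R(0) = ν/2`. Integration by parts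
gives
`∫₀^∞ b(t) τ M(τt) dt = (τ/π) ∫₀^∞ b - (ν/2) b(0) - ∫₀^∞ b'(t) R(τt) dt`
(`integral_mul_besselMean_sub`), and the last integral tends to `0` by dominated convergence, the
majorant being a multiple of `|b'(t)|/(1+t)`.

The limits `1/π` and `1/2` exist by the rates just mentioned, and the recurrence shows that they
are the same for `ν` and `ν + 1`, so that `ν ≥ 1/2` may be assumed. They are then identified with
Gaussian means (`tendsto_gaussian_mean`), which are evaluated exactly: the product series of two
Bessel functions, whose coefficients come from the Chu–Vandermonde identity, is integrated term by
term against `exp(-u²/z)` and summed as a beta integral (`integral_sqrtBessel_sq_mul_gaussian`,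
`integral_sqrtBessel_mul_mul_gaussian`).
-/

/-! ### The power series of the Bessel function -/

/-- The entire function `∑ₖ (-1)ᵏ / (k! Γ(k+ν+1)) yᵏ`; the Bessel function is
`J_ν(x) = (x/2)^ν` times its value at `x²/4`. -/
noncomputable def besselSeries (ν y : ℝ) : ℝ :=
  ∑' k : ℕ, (-1 : ℝ) ^ k / ((k.factorial : ℝ) * Real.Gamma (k + ν + 1)) * y ^ k

/-- A bound for `1 / Γ(k+ν+1)`, uniform in `k`. -/
noncomputable def invGammaBound (ν : ℝ) : ℝ := (Real.Gamma (ν + 1))⁻¹ + (Real.Gamma (ν + 2))⁻¹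

lemma Gamma_nat_add_pos {ν : ℝ} (hν : -1 < ν) (k : ℕ) : 0 < Real.Gamma (k + ν + 1) := by
  apply Real.Gamma_pos_of_pos
  have : (0 : ℝ) ≤ k := k.cast_nonneg
  linarith

lemma inv_Gamma_nat_add_le {ν : ℝ} (hν : -1 < ν) (k : ℕ) :
    (Real.Gamma (k + ν + 1))⁻¹ ≤ invGammaBound ν := by
  have h1 : 0 < Real.Gamma (ν + 1) := Real.Gamma_pos_of_pos (by linarith)
  have h2 : 0 < Real.Gamma (ν + 2) := Real.Gamma_pos_of_pos (by linarith)
  rcases k with _ | k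
  · simp only [Nat.cast_zero, zero_add, invGammaBound]
    have := inv_pos.2 h2
    linarith
  · have key : Real.Gamma (ν + 2) ≤ Real.Gamma ((k + 1 : ℕ) + ν + 1) := by
      induction k with
      | zero => apply le_of_eq; congr 1; push_cast; ring
      | succ k ih =>
        refine ih.trans ?_
        have e : (((k + 1 + 1 : ℕ) : ℝ) + ν + 1) = (((k + 1 : ℕ) : ℝ) + ν + 1) + 1 := by
          push_cast; ring
        have hpos : (1 : ℝ) ≤ ((k + 1 : ℕ) : ℝ) + ν + 1 := by
          push_cast
          have : (0 : ℝ) ≤ k := k.cast_nonneg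
          linarith
        rw [e, Real.Gamma_add_one (s := ((k + 1 : ℕ) : ℝ) + ν + 1) (by linarith)]
        exact le_mul_of_one_le_left (Gamma_nat_add_pos hν _).le hpos
    have := inv_anti₀ h2 key
    have := inv_pos.2 h1
    unfold invGammaBound
    linarith

lemma norm_besselSeries_term_le {ν : ℝ} (hν : -1 < ν) (y : ℝ) (k : ℕ) :
    ‖(-1 : ℝ) ^ k / ((k.factorial : ℝ) * Real.Gamma (k + ν + 1)) * y ^ k‖ ≤
      invGammaBound ν * (|y| ^ k / (k.factorial : ℝ)) := by
  have hf : (0 : ℝ) < k.factorial := by exact_mod_cast k.factorial_pos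
  rw [norm_mul, norm_div, norm_pow, norm_neg, norm_one, one_pow, norm_pow, Real.norm_eq_abs y,
    Real.norm_of_nonneg (mul_pos hf (Gamma_nat_add_pos hν k)).le]
  have := inv_Gamma_nat_add_le hν k
  calc 1 / ((k.factorial : ℝ) * Real.Gamma (k + ν + 1)) * |y| ^ k
      = (Real.Gamma (k + ν + 1))⁻¹ * (|y| ^ k / (k.factorial : ℝ)) := by
        rw [one_div, mul_inv]; ring
    _ ≤ _ := by gcongr

lemma summable_norm_besselSeries {ν : ℝ} (hν : -1 < ν) (y : ℝ) :
    Summable fun k : ℕ => ‖(-1 : ℝ) ^ k / ((k.factorial : ℝ) * Real.Gamma (k + ν + 1)) * y ^ k‖ :=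
  Summable.of_nonneg_of_le (fun _ => norm_nonneg _) (norm_besselSeries_term_le hν y)
    ((Real.summable_pow_div_factorial |y|).mul_left _)

lemma abs_besselSeries_le {ν : ℝ} (hν : -1 < ν) (y : ℝ) :
    |besselSeries ν y| ≤ invGammaBound ν * Real.exp |y| := by
  have h := ((Real.summable_pow_div_factorial |y|).mul_left (invGammaBound ν)).hasSum
  rw [tsum_mul_left] at h
  have e : ∑' k : ℕ, |y| ^ k / (k.factorial : ℝ) = Real.exp |y| := by
    rw [Real.exp_eq_exp_ℝ, NormedSpace.exp_eq_tsum_div]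
  rw [e] at h
  exact tsum_of_norm_bounded h (norm_besselSeries_term_le hν y)

lemma hasDerivAt_besselSeries {ν : ℝ} (hν : -1 < ν) (y : ℝ) :
    HasDerivAt (besselSeries ν) (-besselSeries (ν + 1) y) y := by
  set R : ℝ := |y| + 1
  have hR : 0 < R := by positivity
  set g : ℕ → ℝ → ℝ := fun k z =>
    (-1 : ℝ) ^ k / ((k.factorial : ℝ) * Real.Gamma (k + ν + 1)) * z ^ k
  set g' : ℕ → ℝ → ℝ := fun k z =>
    (-1 : ℝ) ^ k / ((k.factorial : ℝ) * Real.Gamma (k + ν + 1)) * (k * z ^ (k - 1))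
  have hν' : -1 < ν + 1 := by linarith
  have shift : ∀ (k : ℕ) (z : ℝ), g' (k + 1) z =
      -((-1 : ℝ) ^ k / ((k.factorial : ℝ) * Real.Gamma (k + (ν + 1) + 1)) * z ^ k) := by
    intro k z
    have hf : (k.factorial : ℝ) ≠ 0 := by exact_mod_cast k.factorial_ne_zero
    have hk : (k : ℝ) + 1 ≠ 0 := by positivity
    have hG := (Gamma_nat_add_pos hν' k).ne'
    have e : (((k + 1 : ℕ) : ℝ) + ν + 1) = k + (ν + 1) + 1 := by push_cast; ring
    simp only [g']
    rw [e, Nat.factorial_succ]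
    push_cast
    field_simp
    ring
  have hsum : Summable (fun k => invGammaBound (ν + 1) * (R ^ k / (k.factorial : ℝ))) :=
    (Real.summable_pow_div_factorial R).mul_left _
  let u : ℕ → ℝ := fun k => Nat.casesOn k 0
    (fun k => invGammaBound (ν + 1) * (R ^ k / (k.factorial : ℝ)))
  have hu : Summable u := (summable_nat_add_iff 1).1 hsum
  have hbound : ∀ n z, z ∈ Metric.ball (0 : ℝ) R → ‖g' n z‖ ≤ u n := by
    intro n z hz
    rcases n with _ | k
    · simp [g', u]
    · rw [shift, norm_neg]
      refine (norm_besselSeries_term_le hν' z k).trans ?_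
      have : |z| ≤ R := by simpa using (mem_ball_zero_iff.1 hz).le
      have h0 : 0 ≤ invGammaBound (ν + 1) :=
        (inv_nonneg.2 (Gamma_nat_add_pos hν' 0).le).trans (inv_Gamma_nat_add_le hν' 0)
      show _ ≤ invGammaBound (ν + 1) * (R ^ k / (k.factorial : ℝ))
      gcongr
  have hy : y ∈ Metric.ball (0 : ℝ) R := by simp [R]
  have main := hasDerivAt_tsum_of_isPreconnected (g := g) (g' := g') hu Metric.isOpen_ball
    (convex_ball (0 : ℝ) R).isPreconnected
    (fun n z _ => (hasDerivAt_pow n z).const_mul _) hbound hy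
    (summable_norm_besselSeries hν y).of_norm hy
  convert! main using 1
  have hg's : Summable fun n => g' n y := Summable.of_norm_bounded hu fun n => hbound n y hy
  rw [hg's.tsum_eq_zero_add]
  have : g' 0 y = 0 := by simp [g']
  rw [this, zero_add, besselSeries, ← tsum_neg]
  exact tsum_congr fun k => (shift k y).symm

lemma besselSeries_recurrence {ν : ℝ} (hν : -1 < ν) (y : ℝ) :
    y * besselSeries (ν + 2) y = (ν + 1) * besselSeries (ν + 1) y - besselSeries ν y := by
  have hν1 : -1 < ν + 1 := by linarith
  have hν2 : -1 < ν + 2 := by linarith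
  have s0 := (summable_norm_besselSeries hν y).of_norm
  have s1 := (summable_norm_besselSeries hν1 y).of_norm
  have s2 := (summable_norm_besselSeries hν2 y).of_norm
  set f : ℕ → ℝ := fun k =>
    (ν + 1) * ((-1 : ℝ) ^ k / ((k.factorial : ℝ) * Real.Gamma (k + (ν + 1) + 1)) * y ^ k) -
    (-1 : ℝ) ^ k / ((k.factorial : ℝ) * Real.Gamma (k + ν + 1)) * y ^ k with hf
  have hfs : Summable f := (s1.mul_left _).sub s0
  have e : (ν + 1) * besselSeries (ν + 1) y - besselSeries ν y = ∑' k, f k := by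
    rw [besselSeries, besselSeries, ← tsum_mul_left, ← (s1.mul_left _).tsum_sub s0]
  rw [e, hfs.tsum_eq_zero_add]
  have f0 : f 0 = 0 := by
    have hG := (Real.Gamma_pos_of_pos (show 0 < ν + 1 by linarith)).ne'
    have hn : ν + 1 ≠ 0 := by linarith
    simp only [hf, Nat.cast_zero, zero_add, pow_zero, Nat.factorial_zero, Nat.cast_one, one_mul,
      mul_one, Real.Gamma_add_one hn]
    field_simp
    ring
  rw [f0, zero_add, besselSeries, ← tsum_mul_left]
  refine tsum_congr fun k => ?_
  have hk0 : (0 : ℝ) ≤ k := k.cast_nonneg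
  have hfac : (k.factorial : ℝ) ≠ 0 := by exact_mod_cast k.factorial_ne_zero
  have hk1 : (k : ℝ) + 1 ≠ 0 := by positivity
  have hk2 : (k : ℝ) + (ν + 1) + 1 ≠ 0 := by linarith
  have hG := (Gamma_nat_add_pos hν1 k).ne'
  have e1 : (((k + 1 : ℕ) : ℝ) + ν + 1) = k + (ν + 1) + 1 := by push_cast; ring
  have e2 : (((k + 1 : ℕ) : ℝ) + (ν + 1) + 1) = k + (ν + 1) + 1 + 1 := by push_cast; ring
  have e3 : (k : ℝ) + (ν + 2) + 1 = k + (ν + 1) + 1 + 1 := by ring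
  simp only [hf]
  rw [e1, e2, e3, Real.Gamma_add_one hk2, Nat.factorial_succ]
  push_cast
  field_simp
  ring

/-! ### The Bessel function as a solution of a first order system -/

lemma besselJ_eq {x : ℝ} (hx : 0 < x) (ν : ℝ) :
    besselJ ν x = (x / 2) ^ ν * besselSeries ν (x ^ 2 / 4) := by
  rw [besselJ, besselSeries, ← tsum_mul_left]
  refine tsum_congr fun k => ?_
  rw [Real.rpow_add (by positivity), Real.rpow_mul (by positivity), Real.rpow_natCast]
  have : (x / 2) ^ (2 : ℝ) = x ^ 2 / 4 := by
    rw [Real.rpow_two]; ring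
  rw [this]
  ring

lemma besselJ_recurrence {ν x : ℝ} (hν : -1 < ν) (hx : 0 < x) :
    besselJ (ν + 2) x = 2 * (ν + 1) / x * besselJ (ν + 1) x - besselJ ν x := by
  have h := besselSeries_recurrence hν (x ^ 2 / 4)
  have h2 : 0 < x / 2 := by positivity
  rw [besselJ_eq hx, besselJ_eq hx, besselJ_eq hx, Real.rpow_add h2, Real.rpow_add h2,
    Real.rpow_one, Real.rpow_two]
  have : (x / 2) ^ ν * (x / 2) ^ 2 * besselSeries (ν + 2) (x ^ 2 / 4) =
    (x / 2) ^ ν * (x ^ 2 / 4 * besselSeries (ν + 2) (x ^ 2 / 4)) := by ring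
  rw [this, h]
  field_simp

lemma hasDerivAt_besselJ {ν x : ℝ} (hν : -1 < ν) (hx : 0 < x) :
    HasDerivAt (besselJ ν) (ν / x * besselJ ν x - besselJ (ν + 1) x) x := by
  have h2 : 0 < x / 2 := by positivity
  have hd : HasDerivAt (fun x : ℝ => (x / 2) ^ ν * besselSeries ν (x ^ 2 / 4))
      (1 / 2 * ν * (x / 2) ^ (ν - 1) * besselSeries ν (x ^ 2 / 4) +
        (x / 2) ^ ν * (-besselSeries (ν + 1) (x ^ 2 / 4) * (2 * x / 4))) x := by
    have h1 : HasDerivAt (fun x : ℝ => x / 2) (1 / 2) x := (hasDerivAt_id x).div_const 2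
    have h3 : HasDerivAt (fun x : ℝ => x ^ 2 / 4) (2 * x / 4) x := by
      simpa using (hasDerivAt_pow 2 x).div_const 4
    exact (h1.rpow_const (Or.inl h2.ne')).mul ((hasDerivAt_besselSeries hν _).comp x h3)
  have hd' := hd.congr_of_eventuallyEq
    (f₁ := besselJ ν) (by
      filter_upwards [lt_mem_nhds hx] with z hz using besselJ_eq hz ν)
  convert! hd' using 1
  rw [besselJ_eq hx, besselJ_eq hx, Real.rpow_add h2, Real.rpow_sub h2, Real.rpow_one]
  field_simp
  ring

lemma hasDerivAt_besselJ_add_one {ν x : ℝ} (hν : -1 < ν) (hx : 0 < x) :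
    HasDerivAt (besselJ (ν + 1)) (besselJ ν x - (ν + 1) / x * besselJ (ν + 1) x) x := by
  have h := hasDerivAt_besselJ (show -1 < ν + 1 by linarith) hx
  convert! h using 1
  rw [show ν + 1 + 1 = ν + 2 by ring, besselJ_recurrence hν hx]
  ring

/-- The function `√s J_ν(s)` for `s > 0`, extended by `0`. -/
noncomputable def sqrtBessel (ν s : ℝ) : ℝ := if 0 < s then √s * besselJ ν s else 0

lemma sqrtBessel_of_pos {ν s : ℝ} (hs : 0 < s) : sqrtBessel ν s = √s * besselJ ν s := if_pos hs

lemma sqrtBessel_zero (ν : ℝ) : sqrtBessel ν 0 = 0 := if_neg (lt_irrefl _)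

lemma hasDerivAt_sqrt_mul {f : ℝ → ℝ} {f' s : ℝ} (hs : 0 < s) (hf : HasDerivAt f f' s) :
    HasDerivAt (fun s => √s * f s) (√s * (f s / (2 * s) + f')) s := by
  convert! (Real.hasDerivAt_sqrt hs.ne').mul hf using 1
  have h := Real.sqrt_pos.2 hs
  have h2 : √s * √s = s := Real.mul_self_sqrt hs.le
  have : 1 / (2 * √s) = √s / (2 * s) := by
    rw [div_eq_div_iff (by positivity) (by positivity)]
    linear_combination -2 * h2
  rw [this]
  ring

lemma hasDerivAt_sqrtBessel {ν s : ℝ} (hν : -1 < ν) (hs : 0 < s) :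
    HasDerivAt (sqrtBessel ν)
      ((ν + 1 / 2) / s * sqrtBessel ν s - sqrtBessel (ν + 1) s) s := by
  have h := (hasDerivAt_sqrt_mul hs (hasDerivAt_besselJ hν hs)).congr_of_eventuallyEq
    (f₁ := sqrtBessel ν) (by
      filter_upwards [lt_mem_nhds hs] with z hz using sqrtBessel_of_pos hz)
  convert! h using 1
  rw [sqrtBessel_of_pos hs, sqrtBessel_of_pos hs]
  field_simp
  ring

lemma hasDerivAt_sqrtBessel_add_one {ν s : ℝ} (hν : -1 < ν) (hs : 0 < s) :
    HasDerivAt (sqrtBessel (ν + 1))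
      (sqrtBessel ν s - (ν + 1 / 2) / s * sqrtBessel (ν + 1) s) s := by
  have h := (hasDerivAt_sqrt_mul hs (hasDerivAt_besselJ_add_one hν hs)).congr_of_eventuallyEq
    (f₁ := sqrtBessel (ν + 1)) (by
      filter_upwards [lt_mem_nhds hs] with z hz using sqrtBessel_of_pos hz)
  convert! h using 1
  rw [sqrtBessel_of_pos hs, sqrtBessel_of_pos hs]
  field_simp
  ring

lemma sqrtBessel_recurrence {ν s : ℝ} (hν : -1 < ν) (hs : 0 < s) :
    sqrtBessel (ν + 2) s = 2 * (ν + 1) / s * sqrtBessel (ν + 1) s - sqrtBessel ν s := by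
  rw [sqrtBessel_of_pos hs, sqrtBessel_of_pos hs, sqrtBessel_of_pos hs, besselJ_recurrence hν hs]
  ring

lemma continuousOn_sqrtBessel {ν : ℝ} (hν : -1 < ν) : ContinuousOn (sqrtBessel ν) (Ioi 0) :=
  fun _ hs => (hasDerivAt_sqrtBessel hν hs).continuousAt.continuousWithinAt

lemma measurable_sqrtBessel {ν : ℝ} (hν : -1 < ν) : Measurable (sqrtBessel ν) := by
  classical
  have h : sqrtBessel ν = (Ioi (0 : ℝ)).piecewise (sqrtBessel ν) (fun _ => 0) := by
    funext s
    by_cases hs : 0 < s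
    · simp [piecewise, hs]
    · simp [piecewise, hs, sqrtBessel]
  rw [h]
  exact (continuousOn_sqrtBessel hν).measurable_piecewise continuousOn_const measurableSet_Ioi

/-- The size of `√s J_ν(s)` near the origin. -/
lemma exists_abs_sqrtBessel_le_rpow {ν : ℝ} (hν : -1 < ν) :
    ∃ C, 0 ≤ C ∧ ∀ s, 0 < s → s ≤ 1 → |sqrtBessel ν s| ≤ C * s ^ (ν + 1 / 2) := by
  have h0 : 0 ≤ invGammaBound ν :=
    (inv_nonneg.2 (Gamma_nat_add_pos hν 0).le).trans (inv_Gamma_nat_add_le hν 0)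
  refine ⟨(1 / 2) ^ ν * (invGammaBound ν * Real.exp 1), by positivity, fun s hs hs1 => ?_⟩
  rw [sqrtBessel_of_pos hs, besselJ_eq hs, abs_mul, abs_mul, abs_of_nonneg (Real.sqrt_nonneg s),
    abs_of_nonneg (by positivity : (0 : ℝ) ≤ (s / 2) ^ ν), Real.sqrt_eq_rpow, Real.rpow_add hs,
    div_eq_mul_one_div s 2, Real.mul_rpow hs.le (by norm_num)]
  have hb : |besselSeries ν (s ^ 2 / 4)| ≤ invGammaBound ν * Real.exp 1 := by
    refine (abs_besselSeries_le hν _).trans ?_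
    gcongr
    rw [abs_of_nonneg (by positivity)]
    nlinarith
  calc s ^ (1 / 2 : ℝ) * (s ^ ν * (1 / 2) ^ ν * |besselSeries ν (s ^ 2 / 4)|)
      ≤ s ^ (1 / 2 : ℝ) * (s ^ ν * (1 / 2) ^ ν * (invGammaBound ν * Real.exp 1)) := by gcongr
    _ = _ := by ring

/-! ### Asymptotics of the first order system -/

/-- An almost conserved energy of the system satisfied by `√s J_ν`, `√s J_{ν+1}`. -/
noncomputable def besselEnergy (ν s : ℝ) : ℝ :=
  (sqrtBessel ν s ^ 2 + sqrtBessel (ν + 1) s ^ 2) / 2 -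
    (ν + 1 / 2) / s * (sqrtBessel ν s * sqrtBessel (ν + 1) s)

/-- The mean value `s⁻¹ ∫₀ˢ u J_ν(u)² du` in closed form, see `integral_sqrtBessel_sq`. -/
noncomputable def besselMean (ν s : ℝ) : ℝ :=
  (sqrtBessel ν s ^ 2 + sqrtBessel (ν + 1) s ^ 2) / 2 -
    ν / s * (sqrtBessel ν s * sqrtBessel (ν + 1) s)

/-- The integral `∫₀ˢ J_ν(u) J_{ν+1}(u) du`. -/
noncomputable def besselProdInt (ν S : ℝ) : ℝ :=
  ∫ s in (0 : ℝ)..S, sqrtBessel ν s * sqrtBessel (ν + 1) s / s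

lemma hasDerivAt_besselEnergy {ν s : ℝ} (hν : -1 < ν) (hs : 0 < s) :
    HasDerivAt (besselEnergy ν)
      ((ν + 1 / 2) * (sqrtBessel ν s * sqrtBessel (ν + 1) s) / s ^ 2) s := by
  have ha := hasDerivAt_sqrtBessel hν hs
  have hb := hasDerivAt_sqrtBessel_add_one hν hs
  have h := (((ha.pow 2).add (hb.pow 2)).div_const 2).sub
    (((hasDerivAt_inv hs.ne').const_mul (ν + 1 / 2)).mul (ha.mul hb))
  convert! h using 1
  simp only [Nat.cast_ofNat, Pi.mul_apply]
  field_simp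
  ring

lemma hasDerivAt_mul_besselMean {ν s : ℝ} (hν : -1 < ν) (hs : 0 < s) :
    HasDerivAt (fun s => s * besselMean ν s) (sqrtBessel ν s ^ 2) s := by
  have ha := hasDerivAt_sqrtBessel hν hs
  have hb := hasDerivAt_sqrtBessel_add_one hν hs
  have h := (hasDerivAt_id s).mul ((((ha.pow 2).add (hb.pow 2)).div_const 2).sub
    (((hasDerivAt_inv hs.ne').const_mul ν).mul (ha.mul hb)))
  convert! h using 1
  simp only [Nat.cast_ofNat, Pi.pow_apply, Pi.mul_apply, Pi.add_apply, Pi.sub_apply, id]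
  field_simp
  ring

/-- `√s J_ν` and `√s J_{ν+1}` are bounded on `[1,∞)`: `besselEnergy ν s * exp (2|ν+1/2|/s)` is
eventually decreasing, and `besselEnergy ν s` eventually dominates a quarter of the sum of
squares. -/
lemma exists_sqrtBessel_sq_le_of_one_le {ν : ℝ} (hν : -1 < ν) :
    ∃ C, 0 ≤ C ∧ ∀ s, 1 ≤ s → sqrtBessel ν s ^ 2 ≤ C ∧ sqrtBessel (ν + 1) s ^ 2 ≤ C := by
  set m := ν + 1 / 2 with hm
  -- for `s ≥ 2|m|` the mixed term of the energy is at most half of the sum of squares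
  set s₀ : ℝ := 2 * |m| + 1
  have hs₀ : 1 ≤ s₀ := by simp [s₀]
  have hq : ∀ s, s₀ ≤ s →
      (sqrtBessel ν s ^ 2 + sqrtBessel (ν + 1) s ^ 2) / 4 ≤ besselEnergy ν s := by
    intro s hs
    have hspos : 0 < s := by linarith
    have h1 : |m / s * (sqrtBessel ν s * sqrtBessel (ν + 1) s)| ≤
        (sqrtBessel ν s ^ 2 + sqrtBessel (ν + 1) s ^ 2) / 4 := by
      rw [abs_mul, abs_div, abs_of_pos hspos]
      have h2 : |m| / s ≤ 1 / 2 := by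
        rw [div_le_div_iff₀ hspos (by norm_num)]
        simp only [s₀] at hs
        linarith
      have h3 : |sqrtBessel ν s * sqrtBessel (ν + 1) s| ≤
          (sqrtBessel ν s ^ 2 + sqrtBessel (ν + 1) s ^ 2) / 2 := by
        rw [abs_le]
        constructor <;> nlinarith [sq_nonneg (sqrtBessel ν s + sqrtBessel (ν + 1) s),
          sq_nonneg (sqrtBessel ν s - sqrtBessel (ν + 1) s)]
      calc _ ≤ 1 / 2 * ((sqrtBessel ν s ^ 2 + sqrtBessel (ν + 1) s ^ 2) / 2) := by gcongr
        _ = _ := by ring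
    have := (abs_le.1 h1).2
    unfold besselEnergy
    linarith
  have hanti : AntitoneOn (fun s => besselEnergy ν s * Real.exp (2 * |m| / s)) (Ici s₀) := by
    have hd : ∀ s, s₀ ≤ s → HasDerivAt (fun s => besselEnergy ν s * Real.exp (2 * |m| / s))
        ((m * (sqrtBessel ν s * sqrtBessel (ν + 1) s) / s ^ 2 -
          2 * |m| / s ^ 2 * besselEnergy ν s) * Real.exp (2 * |m| / s)) s := by
      intro s hs
      have hspos : 0 < s := by linarith
      have h1 := ((hasDerivAt_inv hspos.ne').const_mul (2 * |m|)).exp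
      convert! (hasDerivAt_besselEnergy hν hspos).mul h1 using 1
      simp only [← hm, ← div_eq_mul_inv]
      ring
    refine antitoneOn_of_deriv_nonpos (convex_Ici _)
      (fun s hs => (hd s hs).continuousAt.continuousWithinAt)
      (fun s hs => (hd s (interior_subset hs)).differentiableAt.differentiableWithinAt) ?_
    intro s hs
    have hs' : s₀ ≤ s := interior_subset hs
    have hspos : 0 < s := by linarith
    rw [(hd s hs').deriv]
    refine mul_nonpos_of_nonpos_of_nonneg ?_ (Real.exp_nonneg _)
    have h3 : m * (sqrtBessel ν s * sqrtBessel (ν + 1) s) ≤ |m| *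
        ((sqrtBessel ν s ^ 2 + sqrtBessel (ν + 1) s ^ 2) / 2) := by
      refine (le_abs_self _).trans ?_
      rw [abs_mul]
      gcongr
      rw [abs_le]
      constructor <;> nlinarith [sq_nonneg (sqrtBessel ν s + sqrtBessel (ν + 1) s),
        sq_nonneg (sqrtBessel ν s - sqrtBessel (ν + 1) s)]
    have h4 := mul_le_mul_of_nonneg_left (hq s hs') (abs_nonneg m)
    have : m * (sqrtBessel ν s * sqrtBessel (ν + 1) s) / s ^ 2 -
        2 * |m| / s ^ 2 * besselEnergy ν s =
        (m * (sqrtBessel ν s * sqrtBessel (ν + 1) s) - 2 * (|m| * besselEnergy ν s)) / s ^ 2 := by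
      ring
    rw [this]
    exact div_nonpos_of_nonpos_of_nonneg (by nlinarith) (by positivity)
  set B := besselEnergy ν s₀ * Real.exp (2 * |m| / s₀)
  have hfar : ∀ s, s₀ ≤ s → sqrtBessel ν s ^ 2 + sqrtBessel (ν + 1) s ^ 2 ≤ 4 * B := by
    intro s hs
    have hspos : 0 < s := by linarith
    have h1 : besselEnergy ν s * Real.exp (2 * |m| / s) ≤ B := hanti self_mem_Ici hs hs
    have h2 := hq s hs
    have h3 : 0 ≤ besselEnergy ν s := le_trans (by positivity) h2
    have h4 : 1 ≤ Real.exp (2 * |m| / s) := Real.one_le_exp (by positivity)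
    nlinarith [mul_le_mul_of_nonneg_left h4 h3]
  have hcont : ContinuousOn (fun s => sqrtBessel ν s ^ 2 + sqrtBessel (ν + 1) s ^ 2)
      (Icc 1 s₀) := by
    have hsub : Icc 1 s₀ ⊆ Ioi 0 := fun s hs => lt_of_lt_of_le one_pos hs.1
    exact ((continuousOn_sqrtBessel hν).mono hsub |>.pow 2).add
      ((continuousOn_sqrtBessel (show -1 < ν + 1 by linarith)).mono hsub |>.pow 2)
  obtain ⟨D, hD⟩ := isCompact_Icc.bddAbove_image hcont
  have hall : ∀ s, 1 ≤ s → sqrtBessel ν s ^ 2 + sqrtBessel (ν + 1) s ^ 2 ≤ max D (4 * B) := by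
    intro s hs
    rcases le_total s s₀ with h | h
    · exact (hD ⟨s, ⟨hs, h⟩, rfl⟩).trans (le_max_left _ _)
    · exact (hfar s h).trans (le_max_right _ _)
  refine ⟨max D (4 * B), le_trans (by positivity) (hall 1 le_rfl), fun s hs => ?_⟩
  have := hall s hs
  constructor <;> nlinarith [sq_nonneg (sqrtBessel ν s), sq_nonneg (sqrtBessel (ν + 1) s)]

/-- A function whose derivative is `O(s^{-n-1})`, `n ≥ 1`, converges at infinity with rate
`s^{-n}`: `f - C s^{-n}` increases, `f + C s^{-n}` decreases, and the two meet at infinity. -/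
lemma exists_limit_of_deriv_le {f f' : ℝ → ℝ} {C : ℝ} {n : ℕ} (hn : 0 < n) (hC : 0 ≤ C)
    (hf : ∀ s, 1 ≤ s → HasDerivAt f (f' s) s)
    (hf' : ∀ s, 1 ≤ s → |f' s| ≤ n * C / s ^ (n + 1)) :
    ∃ l, ∀ s, 1 ≤ s → |f s - l| ≤ C / s ^ n := by
  have hpow : ∀ s : ℝ, 1 ≤ s → HasDerivAt (fun s : ℝ => C / s ^ n) (-(n * C / s ^ (n + 1))) s := by
    intro s hs
    have hspos : 0 < s := by linarith
    have h := ((hasDerivAt_pow n s).inv (pow_ne_zero n hspos.ne')).const_mul C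
    convert! h using 1
    obtain ⟨k, rfl⟩ := Nat.exists_eq_succ_of_ne_zero hn.ne'
    simp only [Nat.succ_eq_add_one, Nat.add_sub_cancel]
    field_simp
    ring
  have hu : MonotoneOn (fun s => f s - C / s ^ n) (Ici 1) := by
    have hd : ∀ s, 1 ≤ s → HasDerivAt (fun s => f s - C / s ^ n) _ s :=
      fun s hs => (hf s hs).sub (hpow s hs)
    refine monotoneOn_of_deriv_nonneg (convex_Ici _)
      (fun s hs => (hd s hs).continuousAt.continuousWithinAt)
      (fun s hs => (hd s (interior_subset hs)).differentiableAt.differentiableWithinAt) ?_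
    intro s hs
    have hs' : 1 ≤ s := interior_subset hs
    rw [(hd s hs').deriv]
    linarith [(abs_le.1 (hf' s hs')).1]
  have hv : AntitoneOn (fun s => f s + C / s ^ n) (Ici 1) := by
    have hd : ∀ s, 1 ≤ s → HasDerivAt (fun s => f s + C / s ^ n) _ s :=
      fun s hs => (hf s hs).add (hpow s hs)
    refine antitoneOn_of_deriv_nonpos (convex_Ici _)
      (fun s hs => (hd s hs).continuousAt.continuousWithinAt)
      (fun s hs => (hd s (interior_subset hs)).differentiableAt.differentiableWithinAt) ?_
    intro s hs
    have hs' : 1 ≤ s := interior_subset hs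
    rw [(hd s hs').deriv]
    linarith [(abs_le.1 (hf' s hs')).2]
  have huv : ∀ s : ℝ, 1 ≤ s → f s - C / s ^ n ≤ f s + C / s ^ n := by
    intro s hs
    have : 0 ≤ C / s ^ n := by positivity
    linarith
  have key : ∀ s t, 1 ≤ s → 1 ≤ t → f s - C / s ^ n ≤ f t + C / t ^ n := by
    intro s t hs ht
    rcases le_total s t with h | h
    · exact (hu hs ht h).trans (huv t ht)
    · exact (huv s hs).trans (hv ht hs h)
  set A := (fun s => f s - C / s ^ n) '' Ici 1
  have hAbdd : BddAbove A := ⟨f 1 + C / 1 ^ n, by rintro _ ⟨s, hs, rfl⟩; exact key s 1 hs le_rfl⟩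
  refine ⟨sSup A, fun s hs => ?_⟩
  have h1 : f s - C / s ^ n ≤ sSup A := le_csSup hAbdd ⟨s, hs, rfl⟩
  have h2 : sSup A ≤ f s + C / s ^ n := csSup_le ⟨_, ⟨1, self_mem_Ici, rfl⟩⟩ (by
    rintro _ ⟨t, ht, rfl⟩; exact key t s ht hs)
  rw [abs_le]; constructor <;> linarith

/-- The energy converges at infinity, with rate `s⁻²`: the derivative of
`besselEnergy ν s + (ν+1/2) s J_ν(s)² / (2 s²)` is `O(s⁻³)`. -/
lemma exists_besselEnergy_limit {ν : ℝ} (hν : -1 < ν) :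
    ∃ l C, 0 ≤ C ∧ ∀ s, 1 ≤ s → |besselEnergy ν s - l| ≤ C / s ^ 2 := by
  obtain ⟨C, hC, hb⟩ := exists_sqrtBessel_sq_le_of_one_le hν
  set m := ν + 1 / 2 with hm
  have hd : ∀ s : ℝ, 1 ≤ s → HasDerivAt
      (fun s => besselEnergy ν s + m / 2 * (sqrtBessel ν s ^ 2 * (s ^ 2)⁻¹))
      ((m ^ 2 - m) * sqrtBessel ν s ^ 2 / s ^ 3) s := by
    intro s hs
    have hs0 : 0 < s := by linarith
    have h := (hasDerivAt_besselEnergy hν hs0).add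
      ((((hasDerivAt_sqrtBessel hν hs0).pow 2).mul
        ((hasDerivAt_pow 2 s).inv (pow_ne_zero 2 hs0.ne'))).const_mul (m / 2))
    convert! h using 1
    simp only [Nat.cast_ofNat, Pi.pow_apply, ← hm, Pi.inv_apply]
    field_simp
    ring
  obtain ⟨l, hl⟩ := exists_limit_of_deriv_le (n := 2) (C := |m ^ 2 - m| * C / 2) two_pos
    (by positivity) hd (by
      intro s hs
      have hs0 : 0 < s := by linarith
      rw [abs_div, abs_mul, abs_of_nonneg (sq_nonneg (sqrtBessel ν s)),
        abs_of_pos (by positivity : 0 < s ^ 3)]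
      push_cast
      rw [mul_div_cancel₀ _ (two_ne_zero)]
      gcongr
      exact (hb s hs).1)
  refine ⟨l, |m ^ 2 - m| * C / 2 + |m| / 2 * C, by positivity, fun s hs => ?_⟩
  have hs0 : 0 < s := by linarith
  have h1 := hl s hs
  have h2 : |m / 2 * (sqrtBessel ν s ^ 2 * (s ^ 2)⁻¹)| ≤ |m| / 2 * C / s ^ 2 := by
    rw [abs_mul, abs_div, abs_two, abs_of_nonneg (by positivity :
      0 ≤ sqrtBessel ν s ^ 2 * (s ^ 2)⁻¹), mul_div_assoc, div_eq_mul_inv C]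
    gcongr
    exact (hb s hs).1
  have e : besselEnergy ν s - l =
    (besselEnergy ν s + m / 2 * (sqrtBessel ν s ^ 2 * (s ^ 2)⁻¹) - l) -
      m / 2 * (sqrtBessel ν s ^ 2 * (s ^ 2)⁻¹) := by ring
  rw [e, add_div (|m ^ 2 - m| * C / 2)]
  exact (abs_sub _ _).trans (add_le_add h1 h2)

/-- Bounds near the origin. -/
lemma exists_sqrtBessel_mul_le_rpow {ν : ℝ} (hν : -1 < ν) :
    ∃ C, 0 ≤ C ∧ ∀ s, 0 < s → s ≤ 1 → sqrtBessel ν s ^ 2 ≤ C * s ^ (2 * ν + 1) ∧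
      sqrtBessel (ν + 1) s ^ 2 ≤ C * s ^ (2 * ν + 1) ∧
      |sqrtBessel ν s * sqrtBessel (ν + 1) s| ≤ C * s ^ (2 * ν + 2) := by
  obtain ⟨A, hA, ha⟩ := exists_abs_sqrtBessel_le_rpow hν
  obtain ⟨B, hB, hb⟩ := exists_abs_sqrtBessel_le_rpow (show -1 < ν + 1 by linarith)
  refine ⟨(A + B) ^ 2, by positivity, fun s hs hs1 => ?_⟩
  have h1 := ha s hs hs1
  have h2 := hb s hs hs1
  have e1 : s ^ (2 * ν + 1) = s ^ (ν + 1 / 2) * s ^ (ν + 1 / 2) := by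
    rw [← Real.rpow_add hs]; congr 1; ring
  have e2 : s ^ (2 * ν + 2) = s ^ (ν + 1 / 2) * s ^ (ν + 1 + 1 / 2) := by
    rw [← Real.rpow_add hs]; congr 1; ring
  have h3 : s ^ (ν + 1 + 1 / 2) ≤ s ^ (ν + 1 / 2) :=
    Real.rpow_le_rpow_of_exponent_ge hs hs1 (by linarith)
  have p1 : 0 < s ^ (ν + 1 / 2) := Real.rpow_pos_of_pos hs _
  have p2 : 0 < s ^ (ν + 1 + 1 / 2) := Real.rpow_pos_of_pos hs _
  have h1' : |sqrtBessel ν s| ≤ (A + B) * s ^ (ν + 1 / 2) := h1.trans (by gcongr; linarith)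
  have h2' : |sqrtBessel (ν + 1) s| ≤ (A + B) * s ^ (ν + 1 + 1 / 2) :=
    h2.trans (by gcongr; linarith)
  have h2'' : |sqrtBessel (ν + 1) s| ≤ (A + B) * s ^ (ν + 1 / 2) := h2'.trans (by gcongr)
  refine ⟨?_, ?_, ?_⟩
  · rw [← sq_abs, e1]
    calc _ ≤ ((A + B) * s ^ (ν + 1 / 2)) ^ 2 := by gcongr
      _ = _ := by ring
  · rw [← sq_abs, e1]
    calc _ ≤ ((A + B) * s ^ (ν + 1 / 2)) ^ 2 := by gcongr
      _ = _ := by ring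
  · rw [abs_mul, e2]
    calc _ ≤ ((A + B) * s ^ (ν + 1 / 2)) * ((A + B) * s ^ (ν + 1 + 1 / 2)) := by gcongr
      _ = _ := by ring

/-- A function continuous on `(0,∞)` and dominated by an integrable power at the origin is
integrable on bounded intervals. -/
lemma intervalIntegrable_of_abs_le_rpow {f : ℝ → ℝ} {C r : ℝ} (hr : -1 < r)
    (hf : ContinuousOn f (Ioi 0)) (hb : ∀ s, 0 < s → s ≤ 1 → |f s| ≤ C * s ^ r) {S T : ℝ}
    (hS : 0 ≤ S) (hT : 0 ≤ T) : IntervalIntegrable f volume S T := by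
  have h1 : IntervalIntegrable f volume 0 1 := by
    refine ((intervalIntegral.intervalIntegrable_rpow' hr (a := 0) (b := 1)).const_mul C).mono_fun'
      ?_ ?_
    · rw [uIoc_of_le zero_le_one]
      exact (hf.mono fun s hs => hs.1).aestronglyMeasurable measurableSet_Ioc
    · rw [uIoc_of_le zero_le_one]
      exact (ae_restrict_iff' measurableSet_Ioc).2 (ae_of_all _ fun s hs => hb s hs.1 hs.2)
  have h2 : ∀ S, 0 ≤ S → IntervalIntegrable f volume 0 S := by
    intro S hS
    rcases le_total S 1 with h | h
    · exact h1.mono_set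
        (by rw [uIcc_of_le hS, uIcc_of_le zero_le_one]; exact Icc_subset_Icc_right h)
    · refine h1.trans (ContinuousOn.intervalIntegrable (hf.mono ?_))
      rw [uIcc_of_le h]
      exact fun s hs => lt_of_lt_of_le one_pos hs.1
  exact (h2 S hS).symm.trans (h2 T hT)

lemma intervalIntegrable_sqrtBessel_sq {ν S T : ℝ} (hν : -1 < ν) (hS : 0 ≤ S) (hT : 0 ≤ T) :
    IntervalIntegrable (fun s => sqrtBessel ν s ^ 2) volume S T := by
  obtain ⟨C, -, hC⟩ := exists_sqrtBessel_mul_le_rpow hν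
  refine intervalIntegrable_of_abs_le_rpow (r := 2 * ν + 1) (by linarith)
    ((continuousOn_sqrtBessel hν).pow 2) (C := C) ?_ hS hT
  intro s hs hs1
  rw [abs_of_nonneg (sq_nonneg _)]
  exact (hC s hs hs1).1

lemma continuousOn_sqrtBessel_mul_div {ν : ℝ} (hν : -1 < ν) :
    ContinuousOn (fun s => sqrtBessel ν s * sqrtBessel (ν + 1) s / s) (Ioi 0) :=
  ((continuousOn_sqrtBessel hν).mul (continuousOn_sqrtBessel (by linarith))).div continuousOn_id
    fun _ hs => (ne_of_gt hs)

lemma abs_sqrtBessel_mul_div_le {ν : ℝ} (hν : -1 < ν) :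
    ∃ C, 0 ≤ C ∧ ∀ s, 0 < s → s ≤ 1 →
      |sqrtBessel ν s * sqrtBessel (ν + 1) s / s| ≤ C * s ^ (2 * ν + 1) := by
  obtain ⟨C, hC0, hC⟩ := exists_sqrtBessel_mul_le_rpow hν
  refine ⟨C, hC0, fun s hs hs1 => ?_⟩
  rw [abs_div, abs_of_pos hs, div_le_iff₀ hs]
  refine (hC s hs hs1).2.2.trans_eq ?_
  rw [mul_assoc, ← Real.rpow_add_one hs.ne']
  congr 2
  ring

lemma intervalIntegrable_sqrtBessel_mul_div {ν S T : ℝ} (hν : -1 < ν) (hS : 0 ≤ S) (hT : 0 ≤ T) :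
    IntervalIntegrable (fun s => sqrtBessel ν s * sqrtBessel (ν + 1) s / s) volume S T := by
  obtain ⟨C, -, hC⟩ := abs_sqrtBessel_mul_div_le hν
  exact intervalIntegrable_of_abs_le_rpow (by linarith) (continuousOn_sqrtBessel_mul_div hν)
    hC hS hT

lemma hasDerivAt_besselProdInt {ν S : ℝ} (hν : -1 < ν) (hS : 0 < S) :
    HasDerivAt (besselProdInt ν) (sqrtBessel ν S * sqrtBessel (ν + 1) S / S) S := by
  have hc := continuousOn_sqrtBessel_mul_div hν
  exact intervalIntegral.integral_hasDerivAt_right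
    (intervalIntegrable_sqrtBessel_mul_div hν le_rfl hS.le)
    (hc.stronglyMeasurableAtFilter isOpen_Ioi S hS) (hc.continuousAt (Ioi_mem_nhds hS))

lemma tendsto_besselProdInt_zero {ν : ℝ} (hν : -1 < ν) :
    Tendsto (besselProdInt ν) (𝓝[>] 0) (𝓝 0) := by
  have h : ContinuousOn (besselProdInt ν) (uIcc 0 1) :=
    intervalIntegral.continuousOn_primitive_interval
      ((intervalIntegrable_iff' ).1
        (intervalIntegrable_sqrtBessel_mul_div hν le_rfl zero_le_one))
  have h0 := h 0 left_mem_uIcc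
  rw [ContinuousWithinAt, besselProdInt, intervalIntegral.integral_same, uIcc_of_le zero_le_one]
    at h0
  refine h0.mono_left ?_
  rw [← nhdsWithin_Ioo_eq_nhdsGT (zero_lt_one (α := ℝ))]
  exact nhdsWithin_mono _ Ioo_subset_Icc_self

/-- The integral `∫₀^∞ J_ν J_{ν+1}` converges conditionally, with rate `S⁻¹`: its primitive plus
`J_ν(S)²/2` has derivative `ν J_ν(S)²/S = O(S⁻²)`. -/
lemma exists_besselProdInt_limit {ν : ℝ} (hν : -1 < ν) :
    ∃ l C, 0 ≤ C ∧ ∀ s, 1 ≤ s → |besselProdInt ν s - l| ≤ C / s := by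
  obtain ⟨C, hC, hb⟩ := exists_sqrtBessel_sq_le_of_one_le hν
  have hd : ∀ s : ℝ, 1 ≤ s → HasDerivAt
      (fun s => besselProdInt ν s + 1 / 2 * (sqrtBessel ν s ^ 2 * s⁻¹))
      (ν * sqrtBessel ν s ^ 2 / s ^ 2) s := by
    intro s hs
    have hs0 : 0 < s := by linarith
    have h := (hasDerivAt_besselProdInt hν hs0).add
      ((((hasDerivAt_sqrtBessel hν hs0).pow 2).mul
        (hasDerivAt_inv hs0.ne')).const_mul (1 / 2))
    convert! h using 1
    simp only [Nat.cast_ofNat, Pi.pow_apply]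
    field_simp
    ring
  obtain ⟨l, hl⟩ := exists_limit_of_deriv_le (n := 1) (C := |ν| * C) one_pos
    (by positivity) hd (by
      intro s hs
      have hs0 : 0 < s := by linarith
      rw [abs_div, abs_mul, abs_of_nonneg (sq_nonneg (sqrtBessel ν s)),
        abs_of_pos (by positivity : 0 < s ^ 2)]
      push_cast
      rw [one_mul]
      gcongr
      exact (hb s hs).1)
  refine ⟨l, |ν| * C + 1 / 2 * C, by positivity, fun s hs => ?_⟩
  have hs0 : 0 < s := by linarith
  have h1 := hl s hs
  rw [pow_one] at h1
  have h2 : |1 / 2 * (sqrtBessel ν s ^ 2 * s⁻¹)| ≤ 1 / 2 * C / s := by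
    rw [abs_of_nonneg (by positivity), mul_div_assoc, div_eq_mul_inv C]
    gcongr
    exact (hb s hs).1
  have e : besselProdInt ν s - l =
    (besselProdInt ν s + 1 / 2 * (sqrtBessel ν s ^ 2 * s⁻¹) - l) -
      1 / 2 * (sqrtBessel ν s ^ 2 * s⁻¹) := by ring
  rw [e, add_div]
  exact (abs_sub _ _).trans (add_le_add h1 h2)

lemma tendsto_rpow_nhdsGT_zero {r : ℝ} (hr : 0 < r) (C : ℝ) :
    Tendsto (fun s : ℝ => C * s ^ r) (𝓝[>] 0) (𝓝 0) := by
  have h := ((Real.continuousAt_rpow_const 0 r (Or.inr hr.le)).tendsto.const_mul C)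
  rw [Real.zero_rpow hr.ne', mul_zero] at h
  exact h.mono_left nhdsWithin_le_nhds

/-- `s` times a quadratic form in `√s J_ν`, `√s J_{ν+1}` of the relevant type vanishes at the
origin. -/
lemma tendsto_mul_quadratic_zero {ν : ℝ} (hν : -1 < ν) (c : ℝ) :
    Tendsto (fun s => s * ((sqrtBessel ν s ^ 2 + sqrtBessel (ν + 1) s ^ 2) / 2 -
      c / s * (sqrtBessel ν s * sqrtBessel (ν + 1) s))) (𝓝[>] 0) (𝓝 0) := by
  obtain ⟨C, hC0, hC⟩ := exists_sqrtBessel_mul_le_rpow hν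
  refine squeeze_zero_norm' (a := fun s => (C + |c| * C) * s ^ (2 * ν + 2)) ?_
    (tendsto_rpow_nhdsGT_zero (by linarith) _)
  filter_upwards [Ioo_mem_nhdsGT (zero_lt_one (α := ℝ))] with s hs
  obtain ⟨h1, h2, h3⟩ := hC s hs.1 hs.2.le
  have hs0 := hs.1
  have e1 : s ^ (2 * ν + 2) = s * s ^ (2 * ν + 1) := by
    rw [mul_comm s, ← Real.rpow_add_one hs0.ne']; congr 1; ring
  have e : s * ((sqrtBessel ν s ^ 2 + sqrtBessel (ν + 1) s ^ 2) / 2 -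
      c / s * (sqrtBessel ν s * sqrtBessel (ν + 1) s)) =
      s * ((sqrtBessel ν s ^ 2 + sqrtBessel (ν + 1) s ^ 2) / 2) -
      c * (sqrtBessel ν s * sqrtBessel (ν + 1) s) := by
    field_simp
  rw [e, Real.norm_eq_abs, add_mul]
  refine (abs_sub _ _).trans (add_le_add ?_ ?_)
  · rw [abs_of_nonneg (by positivity), e1]
    calc _ ≤ s * ((C * s ^ (2 * ν + 1) + C * s ^ (2 * ν + 1)) / 2) := by gcongr
      _ = _ := by ring
  · rw [abs_mul, mul_assoc]
    gcongr

/-- The mean value of `u J_ν(u)²` over `[0,S]`. -/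
lemma integral_sqrtBessel_sq {ν S : ℝ} (hν : -1 < ν) (hS : 0 < S) :
    ∫ s in (0 : ℝ)..S, sqrtBessel ν s ^ 2 = S * besselMean ν S := by
  rw [intervalIntegral.integral_eq_sub_of_hasDerivAt_of_tendsto hS
    (fun s hs => hasDerivAt_mul_besselMean hν hs.1)
    (intervalIntegrable_sqrtBessel_sq hν le_rfl hS.le)
    (tendsto_mul_quadratic_zero hν ν)
    ((hasDerivAt_mul_besselMean hν hS).continuousAt.tendsto.mono_left nhdsWithin_le_nhds), sub_zero]

/-! ### Products of two Bessel functions and their Gaussian means -/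

/-- The binomial coefficient with real upper entry as a quotient of gamma values, away from their
poles. -/
lemma Ring.choose_eq_Gamma_div {r : ℝ} (k : ℕ) (h : 0 < r - k + 1) :
    Ring.choose r k = Real.Gamma (r + 1) / (k.factorial * Real.Gamma (r - k + 1)) := by
  have key : ∀ k : ℕ, 0 < r - k + 1 →
      (descPochhammer ℤ k).smeval r * Real.Gamma (r - k + 1) = Real.Gamma (r + 1) := by
    intro k
    induction k with
    | zero => simp
    | succ k ih =>
      intro h
      push_cast at h
      have e : r - (k : ℝ) + 1 = (r - ((k + 1 : ℕ) : ℝ) + 1) + 1 := by push_cast; ring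
      rw [← ih (by linarith), descPochhammer_succ_right, Polynomial.smeval_mul, e,
        Real.Gamma_add_one (s := r - ((k + 1 : ℕ) : ℝ) + 1) (by push_cast; linarith)]
      have : (Polynomial.X - (k : Polynomial ℤ)).smeval r = r - k := by
        rw [Polynomial.smeval_sub, Polynomial.smeval_X, Polynomial.smeval_natCast]
        simp
      rw [this]
      push_cast
      ring
  have hG := (Real.Gamma_pos_of_pos h).ne'
  have hf : (k.factorial : ℝ) ≠ 0 := by exact_mod_cast k.factorial_ne_zero
  rw [eq_div_iff (mul_ne_zero hf hG), ← key k h, Ring.descPochhammer_eq_factorial_smul_choose,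
    nsmul_eq_mul]
  ring

/-- The coefficients of the product of two Bessel functions, by the Chu–Vandermonde identity. -/
lemma sum_antidiagonal_inv_Gamma {μ ν : ℝ} (hμ : -1 < μ) (hν : -1 < ν) (h : -1 < μ + ν) (k : ℕ) :
    ∑ ij ∈ Finset.HasAntidiagonal.antidiagonal k,
      (1 / ((ij.1.factorial : ℝ) * Real.Gamma (ij.1 + μ + 1))) *
        (1 / ((ij.2.factorial : ℝ) * Real.Gamma (ij.2 + ν + 1))) =
    Real.Gamma (2 * k + μ + ν + 1) / ((k.factorial : ℝ) * Real.Gamma (k + μ + 1) *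
      Real.Gamma (k + ν + 1) * Real.Gamma (k + μ + ν + 1)) := by
  have hk : (0 : ℝ) ≤ k := k.cast_nonneg
  have h1 := (Gamma_nat_add_pos hμ k).ne'
  have h2 := (Gamma_nat_add_pos hν k).ne'
  have h3 := (Gamma_nat_add_pos h k).ne'
  have hf : (k.factorial : ℝ) ≠ 0 := by exact_mod_cast k.factorial_ne_zero
  have hV := Ring.add_choose_eq (R := ℝ) (r := k + ν) (s := k + μ) k (Commute.all _ _)
  rw [Ring.choose_eq_Gamma_div k (by linarith)] at hV
  have e1 : (k : ℝ) + ν + (k + μ) + 1 = 2 * k + μ + ν + 1 := by ring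
  have e2 : (k : ℝ) + ν + (k + μ) - k + 1 = k + (μ + ν) + 1 := by ring
  have e3 : (k : ℝ) + μ + ν + 1 = k + (μ + ν) + 1 := by ring
  rw [e1, e2] at hV
  rw [e3]
  have : Real.Gamma (2 * k + μ + ν + 1) / ((k.factorial : ℝ) * Real.Gamma (k + μ + 1) *
      Real.Gamma (k + ν + 1) * Real.Gamma (k + (μ + ν) + 1)) =
      Real.Gamma (2 * k + μ + ν + 1) / ((k.factorial : ℝ) * Real.Gamma (k + (μ + ν) + 1)) /
      (Real.Gamma (k + μ + 1) * Real.Gamma (k + ν + 1)) := by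
    field_simp
  rw [this, hV, Finset.sum_div]
  refine Finset.sum_congr rfl fun ij hij => ?_
  obtain ⟨i, j⟩ := ij
  rw [Finset.HasAntidiagonal.mem_antidiagonal] at hij
  simp only at hij ⊢
  have hij' : (k : ℝ) = i + j := by exact_mod_cast hij.symm
  have e4 : (k : ℝ) + ν - i + 1 = j + ν + 1 := by rw [hij']; ring
  have e5 : (k : ℝ) + μ - j + 1 = i + μ + 1 := by rw [hij']; ring
  have hi : (0 : ℝ) ≤ i := i.cast_nonneg
  have hj : (0 : ℝ) ≤ j := j.cast_nonneg
  rw [Ring.choose_eq_Gamma_div i (by rw [e4]; linarith),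
    Ring.choose_eq_Gamma_div j (by rw [e5]; linarith),
    e4, e5]
  have h4 := (Gamma_nat_add_pos hμ i).ne'
  have h5 := (Gamma_nat_add_pos hν j).ne'
  have hfi : (i.factorial : ℝ) ≠ 0 := by exact_mod_cast i.factorial_ne_zero
  have hfj : (j.factorial : ℝ) ≠ 0 := by exact_mod_cast j.factorial_ne_zero
  field_simp

/-- The absolute value of the coefficient of `(x/2)^(2k+μ+ν)` in `J_μ(x) J_ν(x)`. -/
noncomputable def besselProdCoeff (μ ν : ℝ) (k : ℕ) : ℝ :=
  Real.Gamma (2 * k + μ + ν + 1) / ((k.factorial : ℝ) * Real.Gamma (k + μ + 1) *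
      Real.Gamma (k + ν + 1) * Real.Gamma (k + μ + ν + 1))

lemma besselJ_mul_besselJ {μ ν x : ℝ} (hμ : -1 < μ) (hν : -1 < ν) (h : -1 < μ + ν) (hx : 0 < x) :
    besselJ μ x * besselJ ν x =
      ∑' k : ℕ, (-1 : ℝ) ^ k * besselProdCoeff μ ν k * (x / 2) ^ (2 * (k : ℝ) + μ + ν) := by
  have hx2 : 0 < x / 2 := by positivity
  rw [besselJ_eq hx, besselJ_eq hx]
  have e : (x / 2) ^ μ * besselSeries μ (x ^ 2 / 4) * ((x / 2) ^ ν * besselSeries ν (x ^ 2 / 4)) =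
      (x / 2) ^ (μ + ν) * (besselSeries μ (x ^ 2 / 4) * besselSeries ν (x ^ 2 / 4)) := by
    rw [Real.rpow_add hx2]; ring
  rw [e, besselSeries, besselSeries, tsum_mul_tsum_eq_tsum_sum_antidiagonal_of_summable_norm
    (summable_norm_besselSeries hμ _) (summable_norm_besselSeries hν _), ← tsum_mul_left]
  refine tsum_congr fun k => ?_
  rw [besselProdCoeff, ← sum_antidiagonal_inv_Gamma hμ hν h]
  have e2 : (x / 2) ^ (2 * (k : ℝ) + μ + ν) = (x / 2) ^ (μ + ν) * (x ^ 2 / 4) ^ k := by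
    rw [add_assoc, add_comm, Real.rpow_add hx2, Real.rpow_mul hx2.le, Real.rpow_two,
      Real.rpow_natCast]
    congr 2; ring
  rw [e2, Finset.mul_sum, Finset.mul_sum, Finset.sum_mul]
  refine Finset.sum_congr rfl fun ij hij => ?_
  rw [Finset.HasAntidiagonal.mem_antidiagonal] at hij
  rw [← hij, pow_add, pow_add]
  ring

/-- Termwise integration of a power series against a Gaussian. The bound on the coefficients makes
the sum of the integrals of the absolute values converge, as a series for `exp (1/p)`. -/
lemma integral_tsum_rpow_mul_gaussian {ν p D : ℝ} {c : ℕ → ℝ} (hν : -1 < ν) (hp : 0 < p)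
    (hc : ∀ k, |c k| * Real.Gamma (k + ν + 1) ≤ D / (k.factorial : ℝ)) :
    ∫ u in Ioi (0 : ℝ), (∑' k : ℕ, c k * u ^ (2 * (k : ℝ) + 2 * ν + 1)) * Real.exp (-p * u ^ 2) =
      ∑' k : ℕ, c k * (Real.Gamma (k + ν + 1) / 2 * p ^ (-(k + ν + 1))) := by
  have hq : ∀ k : ℕ, -1 < 2 * (k : ℝ) + 2 * ν + 1 := fun k => by
    have : (0 : ℝ) ≤ k := k.cast_nonneg
    linarith
  have hint : ∀ k : ℕ, IntegrableOn (fun u : ℝ => u ^ (2 * (k : ℝ) + 2 * ν + 1) *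
      Real.exp (-p * u ^ 2)) (Ioi 0) := fun k => integrableOn_rpow_mul_exp_neg_mul_sq hp (hq k)
  have hval : ∀ k : ℕ, ∫ u in Ioi (0 : ℝ), u ^ (2 * (k : ℝ) + 2 * ν + 1) * Real.exp (-p * u ^ 2) =
      Real.Gamma (k + ν + 1) / 2 * p ^ (-(k + ν + 1)) := by
    intro k
    have h := integral_rpow_mul_exp_neg_mul_rpow (p := 2) (b := p) two_pos (hq k) hp
    simp only [Real.rpow_two] at h
    rw [h]
    have e1 : -(2 * (k : ℝ) + 2 * ν + 1 + 1) / 2 = -(k + ν + 1) := by ring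
    have e2 : (2 * (k : ℝ) + 2 * ν + 1 + 1) / 2 = k + ν + 1 := by ring
    rw [e1, e2]
    ring
  have hF : ∀ k : ℕ, Integrable (fun u : ℝ => c k * (u ^ (2 * (k : ℝ) + 2 * ν + 1) *
      Real.exp (-p * u ^ 2))) (volume.restrict (Ioi 0)) := fun k => (hint k).const_mul _
  have hnorm : ∀ k : ℕ, ∫ u in Ioi (0 : ℝ), ‖c k * (u ^ (2 * (k : ℝ) + 2 * ν + 1) *
      Real.exp (-p * u ^ 2))‖ = |c k| * (Real.Gamma (k + ν + 1) / 2 * p ^ (-(k + ν + 1))) := by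
    intro k
    rw [← hval k, ← integral_const_mul]
    refine setIntegral_congr_fun measurableSet_Ioi fun u hu => ?_
    have : 0 < u := hu
    simp only [norm_mul, Real.norm_eq_abs, Real.abs_exp]
    rw [abs_of_pos (Real.rpow_pos_of_pos this _)]
  have hsum : Summable fun k : ℕ => ∫ u in Ioi (0 : ℝ), ‖c k * (u ^ (2 * (k : ℝ) + 2 * ν + 1) *
      Real.exp (-p * u ^ 2))‖ := by
    refine Summable.of_nonneg_of_le (fun k => integral_nonneg fun _ => norm_nonneg _) (fun k => ?_)
      ((Real.summable_pow_div_factorial p⁻¹).mul_left (D * p ^ (-(ν + 1)) / 2))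
    rw [hnorm]
    have e : p ^ (-(k + ν + 1)) = p ^ (-(ν + 1)) * p⁻¹ ^ k := by
      rw [inv_pow, ← Real.rpow_natCast, ← Real.rpow_neg hp.le, ← Real.rpow_add hp]
      congr 1; ring
    rw [e]
    have hp' : 0 < p ^ (-(ν + 1)) := Real.rpow_pos_of_pos hp _
    calc |c k| * (Real.Gamma (k + ν + 1) / 2 * (p ^ (-(ν + 1)) * p⁻¹ ^ k))
        = (|c k| * Real.Gamma (k + ν + 1)) * (p ^ (-(ν + 1)) * p⁻¹ ^ k / 2) := by ring
      _ ≤ D / (k.factorial : ℝ) * (p ^ (-(ν + 1)) * p⁻¹ ^ k / 2) := by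
        gcongr
        exact hc k
      _ = _ := by ring
  have main := integral_tsum_of_summable_integral_norm hF hsum
  have e : ∀ k : ℕ, ∫ u in Ioi (0 : ℝ), c k * (u ^ (2 * (k : ℝ) + 2 * ν + 1) *
      Real.exp (-p * u ^ 2)) = c k * (Real.Gamma (k + ν + 1) / 2 * p ^ (-(k + ν + 1))) :=
    fun k => by rw [integral_const_mul, hval]
  rw [← tsum_congr e, main]
  refine setIntegral_congr_fun measurableSet_Ioi fun u _ => ?_
  rw [← tsum_mul_right]
  exact tsum_congr fun k => by ring

/-! ### Beta integrals -/

/-- Euler's beta integral for real parameters, together with its convergence. -/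
lemma integral_beta {α β : ℝ} (hα : 0 < α) (hβ : 0 < β) :
    IntegrableOn (fun s : ℝ => s ^ (α - 1) * (1 - s) ^ (β - 1)) (Ioo 0 1) ∧
    ∫ s in Ioo (0 : ℝ) 1, s ^ (α - 1) * (1 - s) ^ (β - 1) =
      Real.Gamma α * Real.Gamma β / Real.Gamma (α + β) := by
  have hconv := Complex.betaIntegral_convergent (u := α) (v := β) (by simpa) (by simpa)
  have heq : ∀ s ∈ Ioo (0 : ℝ) 1, (s : ℂ) ^ ((α : ℂ) - 1) * (1 - (s : ℂ)) ^ ((β : ℂ) - 1) =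
      ((s ^ (α - 1) * (1 - s) ^ (β - 1) : ℝ) : ℂ) := by
    intro s hs
    have h1 : 0 ≤ s := hs.1.le
    have h2 : 0 ≤ 1 - s := by linarith [hs.2]
    push_cast [Complex.ofReal_cpow h1, Complex.ofReal_cpow h2]
    rfl
  rw [intervalIntegrable_iff_integrableOn_Ioo_of_le zero_le_one] at hconv
  have hconv' := hconv.congr_fun heq measurableSet_Ioo
  refine ⟨by simpa [IntegrableOn] using hconv'.re, ?_⟩
  have hb := ProbabilityTheory.beta_eq_betaIntegralReal α β hα hβ
  rw [ProbabilityTheory.beta, Complex.betaIntegral, intervalIntegral.integral_of_le zero_le_one,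
    integral_Ioc_eq_integral_Ioo, setIntegral_congr_fun measurableSet_Ioo heq,
    integral_complex_ofReal, Complex.ofReal_re] at hb
  exact hb.symm

/-- The beta function decreases in its first argument, since its integrand does. -/
lemma beta_add_nat_le {α β : ℝ} (hα : 0 < α) (hβ : 0 < β) (k : ℕ) :
    Real.Gamma (α + k) * Real.Gamma β / Real.Gamma (α + k + β) ≤
      Real.Gamma α * Real.Gamma β / Real.Gamma (α + β) := by
  have hk : (0 : ℝ) ≤ k := k.cast_nonneg
  obtain ⟨i1, e1⟩ := integral_beta hα hβ
  obtain ⟨i2, e2⟩ := integral_beta (show 0 < α + k by linarith) hβ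
  rw [← e1, ← e2]
  refine setIntegral_mono_on i2 i1 measurableSet_Ioo fun s hs => ?_
  have h1 : 0 ≤ 1 - s := by linarith [hs.2]
  gcongr ?_ * _
  exact Real.rpow_le_rpow_of_exponent_ge hs.1 hs.2.le (by linarith)

lemma hasSum_exp_neg (y : ℝ) :
    HasSum (fun k : ℕ => (-1 : ℝ) ^ k / (k.factorial : ℝ) * y ^ k) (Real.exp (-y)) := by
  have h := NormedSpace.expSeries_div_hasSum_exp (-y)
  rw [← Real.exp_eq_exp_ℝ] at h
  convert! h using 1
  funext k
  rw [neg_pow]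
  ring

/-- The Laplace transform of the beta density as a power series. -/
lemma tsum_beta_eq_integral_exp {α β z : ℝ} (hα : 0 < α) (hβ : 0 < β) (hz : 0 ≤ z) :
    ∑' k : ℕ, (-1 : ℝ) ^ k / (k.factorial : ℝ) * z ^ k *
      (Real.Gamma (α + k) * Real.Gamma β / Real.Gamma (α + k + β)) =
    ∫ s in Ioo (0 : ℝ) 1, Real.exp (-(z * s)) * (s ^ (α - 1) * (1 - s) ^ (β - 1)) := by
  have hpos : ∀ k : ℕ, 0 < α + k := fun k => by
    have : (0 : ℝ) ≤ k := k.cast_nonneg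
    linarith
  set F : ℕ → ℝ → ℝ := fun k s => (-1 : ℝ) ^ k / (k.factorial : ℝ) * z ^ k *
    (s ^ (α + k - 1) * (1 - s) ^ (β - 1))
  have hF : ∀ k, Integrable (F k) (volume.restrict (Ioo 0 1)) :=
    fun k => (integral_beta (hpos k) hβ).1.const_mul _
  have hval : ∀ k, ∫ s in Ioo (0 : ℝ) 1, F k s = (-1 : ℝ) ^ k / (k.factorial : ℝ) * z ^ k *
      (Real.Gamma (α + k) * Real.Gamma β / Real.Gamma (α + k + β)) := fun k => by
    simp only [F]
    rw [integral_const_mul, (integral_beta (hpos k) hβ).2]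
  have hsum : Summable fun k => ∫ s in Ioo (0 : ℝ) 1, ‖F k s‖ := by
    refine Summable.of_nonneg_of_le (fun k => integral_nonneg fun _ => norm_nonneg _) (fun k => ?_)
      ((Real.summable_pow_div_factorial z).mul_right
        (Real.Gamma α * Real.Gamma β / Real.Gamma (α + β)))
    have : ∫ s in Ioo (0 : ℝ) 1, ‖F k s‖ = z ^ k / (k.factorial : ℝ) *
        (Real.Gamma (α + k) * Real.Gamma β / Real.Gamma (α + k + β)) := by
      rw [← (integral_beta (hpos k) hβ).2, ← integral_const_mul]
      refine setIntegral_congr_fun measurableSet_Ioo fun s hs => ?_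
      have h1 : 0 ≤ 1 - s := by linarith [hs.2]
      have h2 : 0 ≤ s := hs.1.le
      simp only [F, norm_mul, norm_div, norm_pow, norm_neg, norm_one, one_pow, Real.norm_eq_abs]
      rw [abs_of_nonneg hz, abs_of_nonneg (Real.rpow_nonneg h1 _),
        abs_of_nonneg (Real.rpow_nonneg h2 _), abs_of_nonneg (by positivity)]
      ring
    rw [this]
    exact mul_le_mul_of_nonneg_left (beta_add_nat_le hα hβ k) (by positivity)
  rw [← tsum_congr hval, integral_tsum_of_summable_integral_norm hF hsum]
  refine setIntegral_congr_fun measurableSet_Ioo fun s hs => ?_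
  simp only [F]
  rw [← (hasSum_exp_neg (z * s)).tsum_eq, ← tsum_mul_right]
  refine tsum_congr fun k => ?_
  rw [show α + k - 1 = (α - 1) + k by ring, Real.rpow_add hs.1, Real.rpow_natCast, mul_pow]
  ring

/-- The lower incomplete gamma function as a power series. -/
lemma tsum_eq_integral_rpow_mul_exp {ν x : ℝ} (hν : -1 < ν) (hx : 0 < x) :
    ∑' k : ℕ, (-1 : ℝ) ^ k / (k.factorial : ℝ) * (x ^ (ν + k + 1) / (ν + k + 1)) =
    ∫ y in Ioc (0 : ℝ) x, y ^ ν * Real.exp (-y) := by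
  have hpos : ∀ k : ℕ, -1 < ν + k := fun k => by
    have : (0 : ℝ) ≤ k := k.cast_nonneg
    linarith
  set F : ℕ → ℝ → ℝ := fun k y => (-1 : ℝ) ^ k / (k.factorial : ℝ) * y ^ (ν + k)
  have hint : ∀ k : ℕ, IntegrableOn (fun y : ℝ => y ^ (ν + k)) (Ioc 0 x) := fun k =>
    (intervalIntegrable_iff_integrableOn_Ioc_of_le hx.le).1
      (intervalIntegral.intervalIntegrable_rpow' (hpos k))
  have hv : ∀ k : ℕ, ∫ y in Ioc (0 : ℝ) x, y ^ (ν + k) = x ^ (ν + k + 1) / (ν + k + 1) := by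
    intro k
    have : ν + k + 1 ≠ 0 := by linarith [hpos k]
    rw [← intervalIntegral.integral_of_le hx.le, integral_rpow (Or.inl (hpos k)),
      Real.zero_rpow this, sub_zero]
  have hF : ∀ k, Integrable (F k) (volume.restrict (Ioc 0 x)) := fun k => (hint k).const_mul _
  have hval : ∀ k, ∫ y in Ioc (0 : ℝ) x, F k y =
      (-1 : ℝ) ^ k / (k.factorial : ℝ) * (x ^ (ν + k + 1) / (ν + k + 1)) := fun k => by
    simp only [F]
    rw [integral_const_mul, hv]
  have hsum : Summable fun k => ∫ s in Ioc (0 : ℝ) x, ‖F k s‖ := by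
    refine Summable.of_nonneg_of_le (fun k => integral_nonneg fun _ => norm_nonneg _) (fun k => ?_)
      ((Real.summable_pow_div_factorial x).mul_right (x ^ (ν + 1) / (ν + 1)))
    have : ∫ s in Ioc (0 : ℝ) x, ‖F k s‖ =
        1 / (k.factorial : ℝ) * (x ^ (ν + k + 1) / (ν + k + 1)) := by
      rw [← hv k, ← integral_const_mul]
      refine setIntegral_congr_fun measurableSet_Ioc fun s hs => ?_
      have h2 : 0 ≤ s := hs.1.le
      simp only [F, norm_mul, norm_div, norm_pow, norm_neg, norm_one, one_pow, Real.norm_eq_abs]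
      rw [abs_of_nonneg (Real.rpow_nonneg h2 _), abs_of_nonneg (by positivity)]
    have hk : (0 : ℝ) ≤ k := k.cast_nonneg
    rw [this, show ν + k + 1 = (ν + 1) + k by ring, Real.rpow_add hx, Real.rpow_natCast]
    have h0 : 0 < ν + 1 := by linarith
    calc 1 / (k.factorial : ℝ) * (x ^ (ν + 1) * x ^ k / (ν + 1 + k))
        ≤ 1 / (k.factorial : ℝ) * (x ^ (ν + 1) * x ^ k / (ν + 1)) :=
          mul_le_mul_of_nonneg_left (div_le_div_of_nonneg_left (by positivity) h0 (by linarith))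
            (by positivity)
      _ = _ := by ring
  rw [← tsum_congr hval, integral_tsum_of_summable_integral_norm hF hsum]
  refine setIntegral_congr_fun measurableSet_Ioc fun s hs => ?_
  simp only [F]
  rw [← (hasSum_exp_neg s).tsum_eq, ← tsum_mul_left]
  refine tsum_congr fun k => ?_
  rw [Real.rpow_add hs.1, Real.rpow_natCast]
  ring

/-! ### Exact Gaussian means -/

/-- Legendre's duplication formula. -/
lemma two_rpow_mul_Gamma (s : ℝ) :
    Real.Gamma (2 * s) * 2 ^ (1 - 2 * s) = Real.Gamma s * Real.Gamma (s + 1 / 2) / √Real.pi := by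
  rw [eq_div_iff (Real.sqrt_pos.2 Real.pi_pos).ne', Real.Gamma_mul_Gamma_add_half]

/-- Weber's integral of `u J_ν(u)²` against a Gaussian, as a Laplace transform of a beta density.
By the duplication formula the integrals of the terms of the series of `J_ν²` are beta values. -/
lemma integral_sqrtBessel_sq_mul_gaussian {ν z : ℝ} (hν : 1 / 2 ≤ ν) (hz : 0 < z) :
    ∫ u in Ioi (0 : ℝ), sqrtBessel ν u ^ 2 * Real.exp (-z⁻¹ * u ^ 2) =
      z ^ (ν + 1) / (2 * √Real.pi * Real.Gamma (ν + 1 / 2)) *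
      ∫ s in Ioo (0 : ℝ) 1, Real.exp (-(z * s)) *
        (s ^ (ν + 1 / 2 - 1) * (1 - s) ^ (ν + 1 / 2 - 1)) := by
  have hν1 : -1 < ν := by linarith
  have hh : 0 < ν + 1 / 2 := by linarith
  have hGh := Real.Gamma_pos_of_pos hh
  have hpi := Real.sqrt_pos.2 Real.pi_pos
  set c : ℕ → ℝ := fun k => (-1 : ℝ) ^ k * besselProdCoeff ν ν k * 2 ^ (-(2 * (k : ℝ) + ν + ν))
    with hc
  have hcoef : ∀ k : ℕ, besselProdCoeff ν ν k * 2 ^ (-(2 * (k : ℝ) + ν + ν)) *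
      Real.Gamma (k + ν + 1) = (√Real.pi * Real.Gamma (ν + 1 / 2))⁻¹ *
      (Real.Gamma (ν + 1 / 2 + k) * Real.Gamma (ν + 1 / 2) /
        Real.Gamma (ν + 1 / 2 + k + (ν + 1 / 2))) / (k.factorial : ℝ) := by
    intro k
    have hk : (0 : ℝ) ≤ k := k.cast_nonneg
    have hd := two_rpow_mul_Gamma (k + ν + 1 / 2)
    have h1 := (Gamma_nat_add_pos hν1 k).ne'
    have h3 : Real.Gamma (k + ν + ν + 1) ≠ 0 := (Real.Gamma_pos_of_pos (by linarith)).ne'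
    have hf : (k.factorial : ℝ) ≠ 0 := by exact_mod_cast k.factorial_ne_zero
    rw [show 2 * ((k : ℝ) + ν + 1 / 2) = 2 * k + ν + ν + 1 by ring,
      show 1 - (2 * (k : ℝ) + ν + ν + 1) = -(2 * k + ν + ν) by ring,
      show (k : ℝ) + ν + 1 / 2 + 1 / 2 = k + ν + 1 by ring] at hd
    rw [show ν + 1 / 2 + (k : ℝ) + (ν + 1 / 2) = k + ν + ν + 1 by ring,
      show ν + 1 / 2 + (k : ℝ) = k + ν + 1 / 2 by ring, besselProdCoeff]
    have : Real.Gamma (2 * k + ν + ν + 1) / ((k.factorial : ℝ) * Real.Gamma (k + ν + 1) *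
        Real.Gamma (k + ν + 1) * Real.Gamma (k + ν + ν + 1)) * 2 ^ (-(2 * (k : ℝ) + ν + ν)) *
        Real.Gamma (k + ν + 1) = (Real.Gamma (2 * k + ν + ν + 1) * 2 ^ (-(2 * (k : ℝ) + ν + ν))) /
        ((k.factorial : ℝ) * Real.Gamma (k + ν + 1) * Real.Gamma (k + ν + ν + 1)) := by
      field_simp
    rw [this, hd]
    field_simp
  have hcb : ∀ k, |c k| * Real.Gamma (k + ν + 1) ≤ ((√Real.pi * Real.Gamma (ν + 1 / 2))⁻¹ *
      (Real.Gamma (ν + 1 / 2) * Real.Gamma (ν + 1 / 2) / Real.Gamma (ν + 1 / 2 + (ν + 1 / 2)))) /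
        (k.factorial : ℝ) := by
    intro k
    have hk : (0 : ℝ) ≤ k := k.cast_nonneg
    have h0 : 0 ≤ besselProdCoeff ν ν k * 2 ^ (-(2 * (k : ℝ) + ν + ν)) := by
      have h1 := Gamma_nat_add_pos hν1 k
      have h2 : 0 < Real.Gamma (2 * k + ν + ν + 1) := Real.Gamma_pos_of_pos (by linarith)
      have h3 : 0 < Real.Gamma (k + ν + ν + 1) := Real.Gamma_pos_of_pos (by linarith)
      unfold besselProdCoeff
      positivity
    have : |c k| = besselProdCoeff ν ν k * 2 ^ (-(2 * (k : ℝ) + ν + ν)) := by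
      simp only [hc]
      rw [mul_assoc, abs_mul, abs_pow, abs_neg, abs_one, one_pow, one_mul, abs_of_nonneg h0]
    rw [this, hcoef]
    gcongr (_ * ?_) / _
    exact beta_add_nat_le hh hh k
  have main := integral_tsum_rpow_mul_gaussian hν1 (inv_pos.2 hz) hcb
  have e1 : ∫ u in Ioi (0 : ℝ), sqrtBessel ν u ^ 2 * Real.exp (-z⁻¹ * u ^ 2) =
      ∫ u in Ioi (0 : ℝ), (∑' k : ℕ, c k * u ^ (2 * (k : ℝ) + 2 * ν + 1)) *
        Real.exp (-z⁻¹ * u ^ 2) := by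
    refine setIntegral_congr_fun measurableSet_Ioi fun u hu => ?_
    have hu : 0 < u := hu
    congr 1
    rw [sqrtBessel_of_pos hu, mul_pow, Real.sq_sqrt hu.le, sq (besselJ ν u),
      besselJ_mul_besselJ hν1 hν1 (by linarith) hu, ← tsum_mul_left]
    refine tsum_congr fun k => ?_
    simp only [hc]
    rw [show 2 * (k : ℝ) + 2 * ν + 1 = (2 * k + ν + ν) + 1 by ring, Real.rpow_add_one hu.ne',
      Real.div_rpow hu.le zero_le_two, Real.rpow_neg zero_le_two]
    ring
  rw [e1, main, ← tsum_beta_eq_integral_exp hh hh hz.le, ← tsum_mul_left]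
  refine tsum_congr fun k => ?_
  rw [Real.inv_rpow hz.le, Real.rpow_neg hz.le, inv_inv]
  have e2 : c k * (Real.Gamma (k + ν + 1) / 2 * z ^ ((k : ℝ) + ν + 1)) =
      (-1 : ℝ) ^ k / 2 * z ^ ((k : ℝ) + ν + 1) * (besselProdCoeff ν ν k *
        2 ^ (-(2 * (k : ℝ) + ν + ν)) * Real.Gamma (k + ν + 1)) := by
    simp only [hc]; ring
  rw [e2, hcoef, add_assoc, Real.rpow_add hz, Real.rpow_natCast]
  field_simp

/-- The integral of `J_ν(u) J_{ν+1}(u)` against a Gaussian, as a beta average of the lower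
incomplete gamma function. -/
lemma integral_sqrtBessel_mul_mul_gaussian {ν z : ℝ} (hν : 1 / 2 ≤ ν) (hz : 0 < z) :
    ∫ u in Ioi (0 : ℝ), sqrtBessel ν u * sqrtBessel (ν + 1) u / u * Real.exp (-z⁻¹ * u ^ 2) =
      (2 * √Real.pi * Real.Gamma (ν + 1 / 2))⁻¹ *
      ∫ s in Ioo (0 : ℝ) 1, (∫ y in Ioc (0 : ℝ) (z * s), y ^ ν * Real.exp (-y)) *
        (s ^ (1 / 2 - 1 : ℝ) * (1 - s) ^ (ν + 1 / 2 - 1)) := by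
  have hν1 : -1 < ν := by linarith
  have hν2 : -1 < ν + 1 := by linarith
  have hh : 0 < ν + 1 / 2 := by linarith
  have hh3 : 0 < ν + 3 / 2 := by linarith
  have hGh := Real.Gamma_pos_of_pos hh
  have hpi := Real.sqrt_pos.2 Real.pi_pos
  set Bt : ℕ → ℝ := fun k => Real.Gamma (ν + 3 / 2 + k) * Real.Gamma (ν + 1 / 2) /
        Real.Gamma (ν + 3 / 2 + k + (ν + 1 / 2)) with hBt
  set B0 : ℝ := Real.Gamma (ν + 3 / 2) * Real.Gamma (ν + 1 / 2) /
        Real.Gamma (ν + 3 / 2 + (ν + 1 / 2)) with hB0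
  have hBle : ∀ k, Bt k ≤ B0 := beta_add_nat_le hh3 hh
  have hBpos : ∀ k, 0 ≤ Bt k := fun k => by
    have hk : (0 : ℝ) ≤ k := k.cast_nonneg
    exact div_nonneg (mul_nonneg (Real.Gamma_pos_of_pos (by linarith)).le hGh.le)
      (Real.Gamma_pos_of_pos (by linarith)).le
  have hB0pos : 0 ≤ B0 := (hBpos 0).trans (hBle 0)
  set c : ℕ → ℝ := fun k => (-1 : ℝ) ^ k * besselProdCoeff ν (ν + 1) k *
    2 ^ (-(2 * (k : ℝ) + ν + (ν + 1))) with hc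
  have hcoef : ∀ k : ℕ, besselProdCoeff ν (ν + 1) k * 2 ^ (-(2 * (k : ℝ) + ν + (ν + 1))) *
      Real.Gamma (k + ν + 1) = (√Real.pi * Real.Gamma (ν + 1 / 2))⁻¹ *
      (Bt k / (ν + k + 1)) / (k.factorial : ℝ) := by
    intro k
    have hk : (0 : ℝ) ≤ k := k.cast_nonneg
    have hd := two_rpow_mul_Gamma (k + ν + 1)
    have h1 := (Gamma_nat_add_pos hν1 k).ne'
    have h3 : Real.Gamma (k + ν + (ν + 1) + 1) ≠ 0 := (Real.Gamma_pos_of_pos (by linarith)).ne'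
    have hf : (k.factorial : ℝ) ≠ 0 := by exact_mod_cast k.factorial_ne_zero
    have hk1 : ν + (k : ℝ) + 1 ≠ 0 := by linarith
    rw [show 2 * ((k : ℝ) + ν + 1) = 2 * k + ν + (ν + 1) + 1 by ring,
      show 1 - (2 * (k : ℝ) + ν + (ν + 1) + 1) = -(2 * k + ν + (ν + 1)) by ring] at hd
    simp only [hBt]
    rw [show ν + 3 / 2 + (k : ℝ) + (ν + 1 / 2) = k + ν + (ν + 1) + 1 by ring,
      show ν + 3 / 2 + (k : ℝ) = k + ν + 1 + 1 / 2 by ring, besselProdCoeff,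
      show (k : ℝ) + (ν + 1) + 1 = (k + ν + 1) + 1 by ring,
      Real.Gamma_add_one (s := k + ν + 1) (by linarith)]
    have : Real.Gamma (2 * k + ν + (ν + 1) + 1) / ((k.factorial : ℝ) * Real.Gamma (k + ν + 1) *
        ((k + ν + 1) * Real.Gamma (k + ν + 1)) * Real.Gamma (k + ν + (ν + 1) + 1)) *
        2 ^ (-(2 * (k : ℝ) + ν + (ν + 1))) * Real.Gamma (k + ν + 1) =
        (Real.Gamma (2 * k + ν + (ν + 1) + 1) * 2 ^ (-(2 * (k : ℝ) + ν + (ν + 1)))) /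
        ((k.factorial : ℝ) * (ν + k + 1) * Real.Gamma (k + ν + 1) *
          Real.Gamma (k + ν + (ν + 1) + 1)) := by
      rw [show (k : ℝ) + ν + 1 = ν + k + 1 by ring] at h1 ⊢
      field_simp
    rw [this, hd]
    field_simp
  have hcb : ∀ k, |c k| * Real.Gamma (k + ν + 1) ≤
      ((√Real.pi * Real.Gamma (ν + 1 / 2))⁻¹ * B0) / (k.factorial : ℝ) := by
    intro k
    have hk : (0 : ℝ) ≤ k := k.cast_nonneg
    have h0 : 0 ≤ besselProdCoeff ν (ν + 1) k * 2 ^ (-(2 * (k : ℝ) + ν + (ν + 1))) := by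
      have h1 := Gamma_nat_add_pos hν1 k
      have h1' := Gamma_nat_add_pos hν2 k
      have h2 : 0 < Real.Gamma (2 * k + ν + (ν + 1) + 1) := Real.Gamma_pos_of_pos (by linarith)
      have h3 : 0 < Real.Gamma (k + ν + (ν + 1) + 1) := Real.Gamma_pos_of_pos (by linarith)
      unfold besselProdCoeff
      positivity
    have : |c k| = besselProdCoeff ν (ν + 1) k * 2 ^ (-(2 * (k : ℝ) + ν + (ν + 1))) := by
      simp only [hc]
      rw [mul_assoc, abs_mul, abs_pow, abs_neg, abs_one, one_pow, one_mul, abs_of_nonneg h0]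
    rw [this, hcoef]
    gcongr
    exact (div_le_self (hBpos k) (by linarith)).trans (hBle k)
  have main := integral_tsum_rpow_mul_gaussian hν1 (inv_pos.2 hz) hcb
  have e1 : ∫ u in Ioi (0 : ℝ), sqrtBessel ν u * sqrtBessel (ν + 1) u / u *
        Real.exp (-z⁻¹ * u ^ 2) =
      ∫ u in Ioi (0 : ℝ), (∑' k : ℕ, c k * u ^ (2 * (k : ℝ) + 2 * ν + 1)) *
        Real.exp (-z⁻¹ * u ^ 2) := by
    refine setIntegral_congr_fun measurableSet_Ioi fun u hu => ?_
    have hu : 0 < u := hu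
    congr 1
    have e : √u * besselJ ν u * (√u * besselJ (ν + 1) u) / u = besselJ ν u * besselJ (ν + 1) u := by
      have := Real.mul_self_sqrt hu.le
      rw [div_eq_iff hu.ne']
      linear_combination (besselJ ν u * besselJ (ν + 1) u) * this
    rw [sqrtBessel_of_pos hu, sqrtBessel_of_pos hu, e, besselJ_mul_besselJ hν1 hν2 (by linarith) hu]
    refine tsum_congr fun k => ?_
    simp only [hc]
    rw [show 2 * (k : ℝ) + 2 * ν + 1 = 2 * k + ν + (ν + 1) by ring,
      Real.div_rpow hu.le zero_le_two, Real.rpow_neg zero_le_two]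
    ring
  have hterm : ∀ k : ℕ, c k * (Real.Gamma (k + ν + 1) / 2 * z⁻¹ ^ (-((k : ℝ) + ν + 1))) =
      (2 * √Real.pi * Real.Gamma (ν + 1 / 2))⁻¹ * ((-1 : ℝ) ^ k / (k.factorial : ℝ) *
        (z ^ (ν + k + 1) / (ν + k + 1)) * Bt k) := by
    intro k
    rw [Real.inv_rpow hz.le, Real.rpow_neg hz.le, inv_inv]
    have e2 : c k * (Real.Gamma (k + ν + 1) / 2 * z ^ ((k : ℝ) + ν + 1)) =
        (-1 : ℝ) ^ k / 2 * z ^ ((k : ℝ) + ν + 1) * (besselProdCoeff ν (ν + 1) k *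
          2 ^ (-(2 * (k : ℝ) + ν + (ν + 1))) * Real.Gamma (k + ν + 1)) := by
      simp only [hc]; ring
    rw [e2, hcoef, show (k : ℝ) + ν + 1 = ν + k + 1 by ring]
    field_simp
  rw [e1, main, tsum_congr hterm, tsum_mul_left]
  congr 1
  have hpos : ∀ k : ℕ, 0 < ν + 3 / 2 + k := fun k => by
    have : (0 : ℝ) ≤ k := k.cast_nonneg
    linarith
  have hposk : ∀ k : ℕ, 0 < ν + k + 1 := fun k => by
    have : (0 : ℝ) ≤ k := k.cast_nonneg
    linarith
  set F : ℕ → ℝ → ℝ := fun k s => (-1 : ℝ) ^ k / (k.factorial : ℝ) *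
    (z ^ (ν + k + 1) / (ν + k + 1)) * (s ^ (ν + 3 / 2 + k - 1) * (1 - s) ^ (ν + 1 / 2 - 1))
  have hF : ∀ k, Integrable (F k) (volume.restrict (Ioo 0 1)) :=
    fun k => (integral_beta (hpos k) hh).1.const_mul _
  have hval : ∀ k, ∫ s in Ioo (0 : ℝ) 1, F k s = (-1 : ℝ) ^ k / (k.factorial : ℝ) *
      (z ^ (ν + k + 1) / (ν + k + 1)) * Bt k := fun k => by
    simp only [F]
    rw [integral_const_mul, (integral_beta (hpos k) hh).2]
  have hsum : Summable fun k => ∫ s in Ioo (0 : ℝ) 1, ‖F k s‖ := by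
    refine Summable.of_nonneg_of_le (fun k => integral_nonneg fun _ => norm_nonneg _) (fun k => ?_)
      ((Real.summable_pow_div_factorial z).mul_right (z ^ (ν + 1) * B0))
    have : ∫ s in Ioo (0 : ℝ) 1, ‖F k s‖ = 1 / (k.factorial : ℝ) *
        (z ^ (ν + k + 1) / (ν + k + 1)) * Bt k := by
      rw [hBt]
      simp only
      rw [← (integral_beta (hpos k) hh).2, ← integral_const_mul]
      refine setIntegral_congr_fun measurableSet_Ioo fun s hs => ?_
      have h1 : 0 ≤ 1 - s := by linarith [hs.2]
      have h2 : 0 ≤ s := hs.1.le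
      simp only [F, norm_mul, norm_div, norm_pow, norm_neg, norm_one, one_pow, Real.norm_eq_abs]
      rw [abs_of_nonneg (Real.rpow_nonneg hz.le _), abs_of_nonneg (Real.rpow_nonneg h1 _),
        abs_of_nonneg (Real.rpow_nonneg h2 _), abs_of_pos (hposk k),
        abs_of_nonneg (by positivity)]
    have e3 : z ^ (ν + k + 1) = z ^ k * z ^ (ν + 1) := by
      rw [show ν + k + 1 = k + (ν + 1) by ring, Real.rpow_add hz, Real.rpow_natCast]
    have hk : (0 : ℝ) ≤ k := k.cast_nonneg
    have hzp : 0 < z ^ (ν + 1) := Real.rpow_pos_of_pos hz _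
    rw [this, e3]
    calc 1 / (k.factorial : ℝ) * (z ^ k * z ^ (ν + 1) / (ν + k + 1)) * Bt k
        ≤ 1 / (k.factorial : ℝ) * (z ^ k * z ^ (ν + 1)) * B0 := by
          have hle : z ^ k * z ^ (ν + 1) / (ν + k + 1) ≤ z ^ k * z ^ (ν + 1) :=
            div_le_self (by positivity) (by linarith)
          have := hBle k
          have := hBpos k
          gcongr
      _ = _ := by ring
  rw [← tsum_congr hval, integral_tsum_of_summable_integral_norm hF hsum]
  refine setIntegral_congr_fun measurableSet_Ioo fun s hs => ?_
  simp only [F]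
  rw [← tsum_eq_integral_rpow_mul_exp hν1 (mul_pos hz hs.1), ← tsum_mul_right]
  refine tsum_congr fun k => ?_
  rw [show ν + 3 / 2 + (k : ℝ) - 1 = (ν + k + 1) + (1 / 2 - 1) by ring, Real.rpow_add hs.1,
    Real.mul_rpow hz.le hs.1.le]
  ring

/-! ### Evaluation of the two constants -/

/-- Watson's lemma for the beta density. For `α ≥ 1` the rescaled integrand is dominated by that
of `Γ(α)`. -/
lemma tendsto_laplace_beta {α : ℝ} (hα : 1 ≤ α) :
    Tendsto (fun z : ℝ => z ^ α * ∫ s in Ioo (0 : ℝ) 1, Real.exp (-(z * s)) *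
      (s ^ (α - 1) * (1 - s) ^ (α - 1))) atTop (𝓝 (Real.Gamma α)) := by
  have hα0 : 0 < α := by linarith
  set F : ℝ → ℝ → ℝ := fun z v => (Ioo 0 z).indicator
    (fun v => Real.exp (-v) * v ^ (α - 1) * (1 - v / z) ^ (α - 1)) v
  have heq : ∀ z : ℝ, 0 < z → z ^ α * ∫ s in Ioo (0 : ℝ) 1, Real.exp (-(z * s)) *
      (s ^ (α - 1) * (1 - s) ^ (α - 1)) = ∫ v in Ioi (0 : ℝ), F z v := by
    intro z hz
    set g : ℝ → ℝ := (Ioo (0 : ℝ) 1).indicator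
      (fun s => Real.exp (-(z * s)) * (s ^ (α - 1) * (1 - s) ^ (α - 1)))
    have h1 : ∫ s in Ioo (0 : ℝ) 1, Real.exp (-(z * s)) *
      (s ^ (α - 1) * (1 - s) ^ (α - 1)) = ∫ s in Ioi (0 : ℝ), g s := by
      rw [setIntegral_indicator measurableSet_Ioo, inter_eq_right.2 Ioo_subset_Ioi_self]
    have h2 := integral_comp_mul_left_Ioi g 0 (inv_pos.2 hz)
    rw [mul_zero, inv_inv, smul_eq_mul] at h2
    have h3 : z ^ α = z ^ (α - 1) * z := by rw [← Real.rpow_add_one hz.ne']; congr 1; ring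
    rw [h1, h3, mul_assoc, ← h2, ← integral_const_mul]
    refine setIntegral_congr_fun measurableSet_Ioi fun v hv => ?_
    have hv : 0 < v := hv
    simp only [g, F, indicator]
    have hiff : z⁻¹ * v ∈ Ioo (0 : ℝ) 1 ↔ v ∈ Ioo 0 z := by
      rw [mem_Ioo, mem_Ioo, inv_mul_lt_iff₀ hz, mul_one]
      exact and_congr_left fun _ => ⟨fun _ => hv, fun _ => by positivity⟩
    by_cases h : v ∈ Ioo 0 z
    · rw [if_pos (hiff.2 h), if_pos h, Real.mul_rpow (by positivity) hv.le,
        Real.inv_rpow hz.le, ← mul_assoc z z⁻¹ v, mul_inv_cancel₀ hz.ne', one_mul,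
        ← div_eq_inv_mul v z]
      have := (Real.rpow_pos_of_pos hz (α - 1)).ne'
      field_simp
    · rw [if_neg (fun h' => h (hiff.1 h')), if_neg h, mul_zero]
  rw [Real.Gamma_eq_integral hα0]
  have hlim : Tendsto (fun z => ∫ v in Ioi (0 : ℝ), F z v) atTop
      (𝓝 (∫ v in Ioi (0 : ℝ), Real.exp (-v) * v ^ (α - 1))) := by
    refine tendsto_integral_filter_of_dominated_convergence
      (fun v => Real.exp (-v) * v ^ (α - 1)) ?_ ?_ (Real.GammaIntegral_convergent hα0) ?_
    · refine Eventually.of_forall fun z => ?_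
      refine Measurable.aestronglyMeasurable (Measurable.indicator ?_ measurableSet_Ioo)
      fun_prop
    · filter_upwards [eventually_gt_atTop 0] with z hz
      refine (ae_restrict_iff' measurableSet_Ioi).2 (ae_of_all _ fun v hv => ?_)
      have hv : 0 < v := hv
      simp only [F, indicator]
      split_ifs with h
      · have h4 : 0 ≤ 1 - v / z := by
          rw [sub_nonneg, div_le_one hz]; exact h.2.le
        have h5 : 1 - v / z ≤ 1 := by
          have : 0 < v / z := by positivity
          linarith
        have h6 : (1 - v / z) ^ (α - 1) ≤ 1 := Real.rpow_le_one h4 h5 (by linarith)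
        rw [Real.norm_of_nonneg (by positivity)]
        exact mul_le_of_le_one_right (by positivity) h6
      · rw [norm_zero]; positivity
    · refine (ae_restrict_iff' measurableSet_Ioi).2 (ae_of_all _ fun v hv => ?_)
      have hv : 0 < v := hv
      have h1 : Tendsto (fun z : ℝ => (1 - v / z) ^ (α - 1)) atTop (𝓝 1) := by
        have h2 : Tendsto (fun z : ℝ => 1 - v / z) atTop (𝓝 (1 - 0)) :=
          tendsto_const_nhds.sub (tendsto_const_nhds.div_atTop tendsto_id)
        have h3 := h2.rpow_const (p := α - 1) (Or.inr (by linarith))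
        simpa using h3
      have h2 := h1.const_mul (Real.exp (-v) * v ^ (α - 1))
      rw [mul_one] at h2
      refine h2.congr' ?_
      filter_upwards [eventually_gt_atTop v] with z hz
      simp only [F]
      have hmem : v ∈ Ioo 0 z := ⟨hv, hz⟩
      rw [indicator_of_mem hmem]
  refine hlim.congr' ?_
  filter_upwards [eventually_gt_atTop 0] with z hz using (heq z hz).symm

/-- As `z → ∞` the incomplete gamma function tends to `Γ(ν+1)` inside the beta average. -/
lemma tendsto_integral_incomplete_gamma {ν : ℝ} (hν : 1 / 2 ≤ ν) :
    Tendsto (fun z : ℝ => ∫ s in Ioo (0 : ℝ) 1,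
      (∫ y in Ioc (0 : ℝ) (z * s), y ^ ν * Real.exp (-y)) *
        (s ^ (1 / 2 - 1 : ℝ) * (1 - s) ^ (ν + 1 / 2 - 1))) atTop
      (𝓝 (√Real.pi * Real.Gamma (ν + 1 / 2))) := by
  have hν1 : 0 < ν + 1 := by linarith
  have hh : 0 < ν + 1 / 2 := by linarith
  have hG := (Real.Gamma_pos_of_pos hν1).ne'
  set γ : ℝ → ℝ := fun x => ∫ y in Ioc (0 : ℝ) x, y ^ ν * Real.exp (-y) with hγ
  have hΓ : Real.Gamma (ν + 1) = ∫ y in Ioi (0 : ℝ), y ^ ν * Real.exp (-y) := by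
    rw [Real.Gamma_eq_integral hν1]
    simp only [add_sub_cancel_right, mul_comm]
  have hint : IntegrableOn (fun y : ℝ => y ^ ν * Real.exp (-y)) (Ioi 0) := by
    have := Real.GammaIntegral_convergent hν1
    simpa only [add_sub_cancel_right, mul_comm] using this
  have hnn : ∀ᵐ y ∂(volume.restrict (Ioi (0 : ℝ))), 0 ≤ y ^ ν * Real.exp (-y) :=
    (ae_restrict_iff' measurableSet_Ioi).2 (ae_of_all _ fun y hy => by
      have : (0 : ℝ) < y := hy
      positivity)
  have hγmono : Monotone γ := fun x x' h =>
    setIntegral_mono_set (hint.mono_set Ioc_subset_Ioi_self)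
      (ae_restrict_of_ae_restrict_of_subset Ioc_subset_Ioi_self hnn)
      (Ioc_subset_Ioc_right h).eventuallyLE
  have hγnn : ∀ x, 0 ≤ γ x := fun x =>
    integral_nonneg_of_ae (ae_restrict_of_ae_restrict_of_subset Ioc_subset_Ioi_self hnn)
  have hγle : ∀ x, γ x ≤ Real.Gamma (ν + 1) := fun x => by
    rw [hΓ]
    exact setIntegral_mono_set hint hnn Ioc_subset_Ioi_self.eventuallyLE
  have hγlim : Tendsto γ atTop (𝓝 (Real.Gamma (ν + 1))) := by
    rw [hΓ]
    refine (intervalIntegral_tendsto_integral_Ioi 0 hint tendsto_id).congr' ?_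
    filter_upwards [eventually_ge_atTop 0] with x hx
    exact intervalIntegral.integral_of_le hx
  obtain ⟨hb, hbv⟩ := integral_beta (show (0 : ℝ) < 1 / 2 by norm_num) hh
  have hval : ∫ s in Ioo (0 : ℝ) 1, Real.Gamma (ν + 1) *
      (s ^ (1 / 2 - 1 : ℝ) * (1 - s) ^ (ν + 1 / 2 - 1)) = √Real.pi * Real.Gamma (ν + 1 / 2) := by
    rw [integral_const_mul, hbv, Real.Gamma_one_half_eq, show 1 / 2 + (ν + 1 / 2) = ν + 1 by ring]
    field_simp
  rw [← hval]
  refine tendsto_integral_filter_of_dominated_convergence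
    (fun s => Real.Gamma (ν + 1) * (s ^ (1 / 2 - 1 : ℝ) * (1 - s) ^ (ν + 1 / 2 - 1)))
    (Eventually.of_forall fun z => ?_) (Eventually.of_forall fun z => ?_)
    (hb.const_mul _) ?_
  · have : Measurable fun s => γ (z * s) := hγmono.measurable.comp (measurable_const_mul z)
    exact (this.mul (by fun_prop)).aestronglyMeasurable
  · refine (ae_restrict_iff' measurableSet_Ioo).2 (ae_of_all _ fun s hs => ?_)
    have h1 : 0 ≤ 1 - s := by linarith [hs.2]
    have h2 : 0 ≤ s := hs.1.le
    have h3 := hγnn (z * s)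
    change ‖γ (z * s) * _‖ ≤ _
    rw [Real.norm_of_nonneg (by positivity)]
    gcongr
    exact hγle _
  · refine (ae_restrict_iff' measurableSet_Ioo).2 (ae_of_all _ fun s hs => ?_)
    exact (hγlim.comp (tendsto_id.atTop_mul_const hs.1)).mul_const _

/-- An Abelian theorem for Gaussian means: if the primitive `G` of `g` satisfies `G(u) ~ c uⁿ` then
`R⁻ⁿ ∫ g(u) exp(-u²/R²) du` tends to `c Γ(1+n/2)`. -/
lemma tendsto_gaussian_mean {g G : ℝ → ℝ} {C c : ℝ} (n : ℕ)
    (hG : ∀ u, 0 < u → HasDerivAt G (g u) u) (hG0 : Tendsto G (𝓝[>] 0) (𝓝 0))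
    (hGb : ∀ u, 0 < u → |G u| ≤ C * u ^ n)
    (hint : ∀ R : ℝ, 0 < R → IntegrableOn (fun u => g u * Real.exp (-(R ^ 2)⁻¹ * u ^ 2)) (Ioi 0))
    (hlim : Tendsto (fun u => G u / u ^ n) atTop (𝓝 c)) :
    Tendsto (fun R : ℝ => (R ^ n)⁻¹ * ∫ u in Ioi (0 : ℝ), g u * Real.exp (-(R ^ 2)⁻¹ * u ^ 2)) atTop
      (𝓝 (c * Real.Gamma ((n + 2) / 2))) := by
  have hGm : AEStronglyMeasurable G (volume.restrict (Ioi 0)) :=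
    ContinuousOn.aestronglyMeasurable (fun u hu => (hG u hu).continuousAt.continuousWithinAt)
      measurableSet_Ioi
  have hC : 0 ≤ C := by simpa using (abs_nonneg _).trans (hGb 1 one_pos)
  have hgauss : ∀ p : ℝ, 0 < p →
      IntegrableOn (fun u : ℝ => u ^ (n + 1) * Real.exp (-p * u ^ 2)) (Ioi 0) := by
    intro p hp
    have := integrableOn_rpow_mul_exp_neg_mul_sq hp (s := ((n + 1 : ℕ) : ℝ))
      (by have : (0 : ℝ) ≤ ((n + 1 : ℕ) : ℝ) := Nat.cast_nonneg _
          linarith)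
    simpa only [Real.rpow_natCast] using this
  -- integration by parts moves the derivative from `G` to the Gaussian
  have hparts : ∀ R : ℝ, 0 < R → ∫ u in Ioi (0 : ℝ), g u * Real.exp (-(R ^ 2)⁻¹ * u ^ 2) =
      ∫ u in Ioi (0 : ℝ), 2 * (R ^ 2)⁻¹ * u * Real.exp (-(R ^ 2)⁻¹ * u ^ 2) * G u := by
    intro R hR
    set p := (R ^ 2)⁻¹
    have hp : 0 < p := by positivity
    have hd : ∀ u ∈ Ioi (0 : ℝ), HasDerivAt (fun u : ℝ => Real.exp (-p * u ^ 2))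
        (-(2 * p * u * Real.exp (-p * u ^ 2))) u := by
      intro u _
      convert! ((hasDerivAt_pow 2 u).const_mul (-p)).exp using 1
      simp
      ring
    have hI : IntegrableOn (fun u => -(2 * p * u * Real.exp (-p * u ^ 2)) * G u) (Ioi 0) := by
      refine Integrable.mono' ((hgauss p hp).const_mul (2 * p * C))
        ((Continuous.aestronglyMeasurable (by fun_prop)).mul hGm) ?_
      refine (ae_restrict_iff' measurableSet_Ioi).2 (ae_of_all _ fun u hu => ?_)
      have hu : 0 < u := hu
      have := hGb u hu
      rw [norm_mul, norm_neg, Real.norm_of_nonneg (by positivity), Real.norm_eq_abs]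
      calc 2 * p * u * Real.exp (-p * u ^ 2) * |G u|
          ≤ 2 * p * u * Real.exp (-p * u ^ 2) * (C * u ^ n) := by gcongr
        _ = _ := by ring
    have hinf : Tendsto (fun u : ℝ => Real.exp (-p * u ^ 2) * G u) atTop (𝓝 0) := by
      have h1 : Tendsto (fun u : ℝ => C * (u ^ (n : ℝ) * Real.exp (-p * u ^ 2))) atTop (𝓝 0) := by
        have h2 := (rpow_mul_exp_neg_mul_sq_isLittleO_exp_neg hp (n : ℝ)).trans_tendsto
          (Real.tendsto_exp_atBot.comp (tendsto_id.const_mul_atTop_of_neg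
            (show (-(1 / 2) : ℝ) < 0 by norm_num)))
        simpa using h2.const_mul C
      refine squeeze_zero_norm' ?_ h1
      filter_upwards [eventually_gt_atTop 0] with u hu
      rw [norm_mul, Real.norm_of_nonneg (Real.exp_nonneg _), Real.norm_eq_abs, Real.rpow_natCast]
      calc Real.exp (-p * u ^ 2) * |G u| ≤ Real.exp (-p * u ^ 2) * (C * u ^ n) := by
            gcongr; exact hGb u hu
        _ = _ := by ring
    have hz : Tendsto (fun u : ℝ => Real.exp (-p * u ^ 2) * G u) (𝓝[>] 0) (𝓝 0) := by
      have h1 : Tendsto (fun u : ℝ => Real.exp (-p * u ^ 2)) (𝓝[>] 0) (𝓝 1) := by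
        have : Continuous fun u : ℝ => Real.exp (-p * u ^ 2) := by fun_prop
        have h2 := (this.tendsto 0).mono_left (nhdsWithin_le_nhds (s := Ioi 0))
        simpa using h2
      simpa using h1.mul hG0
    have h := integral_Ioi_mul_deriv_eq_deriv_mul (a := 0) hd (fun u hu => hG u hu)
      (by
        have := hint R hR
        simpa only [Pi.mul_def, mul_comm] using this)
      hI hz hinf
    rw [sub_zero, zero_sub, ← integral_neg] at h
    simp only [neg_mul, neg_neg] at h
    simpa only [mul_comm (g _), neg_mul] using h
  -- the substitution `u = R v` makes the Gaussian independent of `R`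
  have hscale : ∀ R : ℝ, 0 < R → (R ^ n)⁻¹ *
      ∫ u in Ioi (0 : ℝ), g u * Real.exp (-(R ^ 2)⁻¹ * u ^ 2) =
      ∫ v in Ioi (0 : ℝ), 2 * v * Real.exp (-1 * v ^ 2) * (G (R * v) / R ^ n) := by
    intro R hR
    have h2 := integral_comp_mul_left_Ioi
      (fun u => 2 * (R ^ 2)⁻¹ * u * Real.exp (-(R ^ 2)⁻¹ * u ^ 2) * G u) 0 hR
    rw [mul_zero, smul_eq_mul, eq_inv_mul_iff_mul_eq₀ hR.ne'] at h2
    rw [hparts R hR, ← h2, ← integral_const_mul, ← integral_const_mul]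
    refine setIntegral_congr_fun measurableSet_Ioi fun v _ => ?_
    have e : -(R ^ 2)⁻¹ * (R * v) ^ 2 = -1 * v ^ 2 := by field_simp
    simp only [e]
    field_simp
  have hval : ∫ v in Ioi (0 : ℝ), 2 * v * Real.exp (-1 * v ^ 2) * (c * v ^ n) =
      c * Real.Gamma ((n + 2) / 2) := by
    have h := integral_rpow_mul_exp_neg_mul_rpow (p := 2) (q := ((n + 1 : ℕ) : ℝ)) (b := 1) two_pos
      (by have : (0 : ℝ) ≤ ((n + 1 : ℕ) : ℝ) := Nat.cast_nonneg _
          linarith) one_pos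
    simp only [Real.rpow_two, Real.rpow_natCast, Real.one_rpow] at h
    have e : (((n + 1 : ℕ) : ℝ) + 1) / 2 = (n + 2) / 2 := by push_cast; ring
    rw [e] at h
    have : Real.Gamma ((n + 2) / 2) =
        2 * ∫ x in Ioi (0 : ℝ), x ^ (n + 1) * Real.exp (-1 * x ^ 2) := by
      rw [h]; ring
    rw [this, ← integral_const_mul, ← integral_const_mul]
    refine setIntegral_congr_fun measurableSet_Ioi fun v _ => ?_
    ring
  rw [← hval]
  have hdom : Tendsto (fun R : ℝ => ∫ v in Ioi (0 : ℝ), 2 * v * Real.exp (-1 * v ^ 2) *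
      (G (R * v) / R ^ n)) atTop
      (𝓝 (∫ v in Ioi (0 : ℝ), 2 * v * Real.exp (-1 * v ^ 2) * (c * v ^ n))) := by
    refine tendsto_integral_filter_of_dominated_convergence
      (fun v => 2 * C * (v ^ (n + 1) * Real.exp (-1 * v ^ 2))) ?_ ?_
      ((hgauss 1 one_pos).const_mul _) ?_
    · filter_upwards [eventually_gt_atTop 0] with R hR
      refine (Continuous.aestronglyMeasurable (by fun_prop)).mul ?_
      refine ContinuousOn.aestronglyMeasurable (ContinuousOn.div_const (fun v hv => ?_) _)
        measurableSet_Ioi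
      have hv : 0 < v := hv
      exact ((hG (R * v) (mul_pos hR hv)).continuousAt.comp
        (f := fun v => R * v) (by fun_prop)).continuousWithinAt
    · filter_upwards [eventually_gt_atTop 0] with R hR
      refine (ae_restrict_iff' measurableSet_Ioi).2 (ae_of_all _ fun v hv => ?_)
      have hv : 0 < v := hv
      have h1 := hGb (R * v) (mul_pos hR hv)
      have hRn : 0 < R ^ n := by positivity
      rw [norm_mul, norm_div, Real.norm_of_nonneg
        (by positivity : 0 ≤ 2 * v * Real.exp (-1 * v ^ 2)),
        Real.norm_of_nonneg hRn.le, Real.norm_eq_abs]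
      have h2 : |G (R * v)| / R ^ n ≤ C * v ^ n := by
        rw [div_le_iff₀ hRn]
        refine h1.trans_eq ?_
        rw [mul_pow]; ring
      calc 2 * v * Real.exp (-1 * v ^ 2) * (|G (R * v)| / R ^ n)
          ≤ 2 * v * Real.exp (-1 * v ^ 2) * (C * v ^ n) := by gcongr
        _ = _ := by ring
    · refine (ae_restrict_iff' measurableSet_Ioi).2 (ae_of_all _ fun v hv => ?_)
      have hv : 0 < v := hv
      have h1 : Tendsto (fun R : ℝ => G (R * v) / (R * v) ^ n * v ^ n) atTop (𝓝 (c * v ^ n)) :=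
        (hlim.comp (tendsto_id.atTop_mul_const hv)).mul_const _
      refine Tendsto.const_mul _ (h1.congr' ?_)
      filter_upwards [eventually_gt_atTop 0] with R hR
      rw [mul_pow]
      field_simp
  refine hdom.congr' ?_
  filter_upwards [eventually_gt_atTop 0] with R hR using (hscale R hR).symm

lemma tendsto_sqrtBessel_sq_div {ν : ℝ} (hν : -1 < ν) (c : ℝ) :
    Tendsto (fun s => c / s * sqrtBessel (ν + 1) s ^ 2) atTop (𝓝 0) ∧
    Tendsto (fun s => c / s * (sqrtBessel ν s * sqrtBessel (ν + 1) s)) atTop (𝓝 0) := by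
  obtain ⟨C, hC, hb⟩ := exists_sqrtBessel_sq_le_of_one_le hν
  have h0 : Tendsto (fun s : ℝ => |c| * C / s) atTop (𝓝 0) :=
    tendsto_const_nhds.div_atTop tendsto_id
  constructor
  · refine squeeze_zero_norm' ?_ h0
    filter_upwards [eventually_ge_atTop 1] with s hs
    have hs0 : 0 < s := by linarith
    rw [Real.norm_eq_abs, abs_mul, abs_div, abs_of_pos hs0,
      abs_of_nonneg (sq_nonneg (sqrtBessel (ν + 1) s)), div_mul_eq_mul_div]
    gcongr
    exact (hb s hs).2
  · refine squeeze_zero_norm' ?_ h0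
    filter_upwards [eventually_ge_atTop 1] with s hs
    have hs0 : 0 < s := by linarith
    rw [Real.norm_eq_abs, abs_mul, abs_div, abs_of_pos hs0, div_mul_eq_mul_div]
    gcongr
    obtain ⟨h1, h2⟩ := hb s hs
    rw [abs_le]
    constructor <;> nlinarith [sq_nonneg (sqrtBessel ν s + sqrtBessel (ν + 1) s),
        sq_nonneg (sqrtBessel ν s - sqrtBessel (ν + 1) s)]

lemma integrableOn_mul_gaussian {g : ℝ → ℝ} {r C p : ℝ} (hr : -1 < r) (hp : 0 < p)
    (hg : ContinuousOn g (Ioi 0)) (h0 : ∀ s, 0 < s → s ≤ 1 → |g s| ≤ C * s ^ r)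
    (h1 : ∀ s, 1 ≤ s → |g s| ≤ C) :
    IntegrableOn (fun u => g u * Real.exp (-p * u ^ 2)) (Ioi 0) := by
  have hC : 0 ≤ C := (abs_nonneg _).trans (h1 1 le_rfl)
  have i1 := (integrableOn_rpow_mul_exp_neg_mul_sq hp hr).const_mul C
  have i2 := (integrable_exp_neg_mul_sq hp).integrableOn (s := Ioi (0 : ℝ)).const_mul C
  refine Integrable.mono' (i1.add i2)
    ((hg.aestronglyMeasurable measurableSet_Ioi).mul
      (Continuous.aestronglyMeasurable (by fun_prop))) ?_
  refine (ae_restrict_iff' measurableSet_Ioi).2 (ae_of_all _ fun s hs => ?_)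
  have hs : 0 < s := hs
  have he := Real.exp_nonneg (-p * s ^ 2)
  have hr0 := Real.rpow_nonneg hs.le r
  rw [norm_mul, Real.norm_of_nonneg he, Real.norm_eq_abs, Pi.add_apply, ← mul_assoc, ← add_mul]
  gcongr
  rcases le_total s 1 with h | h
  · exact (h0 s hs h).trans (by linarith)
  · exact (h1 s h).trans (by nlinarith [mul_nonneg hC hr0])

/-- For `ν ≥ 1/2` the energy tends to `1/π`. Its limit is also that of the means of `u J_ν(u)²`
over `[0,s]`, hence is determined by the Gaussian means, which are known exactly. -/
lemma tendsto_besselEnergy_of_half_le {ν : ℝ} (hν : 1 / 2 ≤ ν) :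
    Tendsto (besselEnergy ν) atTop (𝓝 (1 / Real.pi)) := by
  have hν1 : -1 < ν := by linarith
  have hh : 0 < ν + 1 / 2 := by linarith
  have hGh := Real.Gamma_pos_of_pos hh
  have hpi := Real.sqrt_pos.2 Real.pi_pos
  obtain ⟨l, C, hC, hl⟩ := exists_besselEnergy_limit hν1
  have hE : Tendsto (besselEnergy ν) atTop (𝓝 l) := by
    rw [tendsto_iff_norm_sub_tendsto_zero]
    refine squeeze_zero' (Eventually.of_forall fun _ => norm_nonneg _)
      ((eventually_ge_atTop 1).mono fun s hs => hl s hs) ?_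
    exact tendsto_const_nhds.div_atTop (tendsto_pow_atTop two_ne_zero)
  have hM : Tendsto (besselMean ν) atTop (𝓝 l) := by
    have h := hE.add (tendsto_sqrtBessel_sq_div hν1 (1 / 2)).2
    rw [add_zero] at h
    refine h.congr fun s => ?_
    simp only [besselEnergy, besselMean]
    ring
  obtain ⟨A, hA, hA'⟩ := exists_sqrtBessel_sq_le_of_one_le hν1
  obtain ⟨B, hB, hB'⟩ := exists_sqrtBessel_mul_le_rpow hν1
  have hmean : ∃ D, ∀ s, 0 < s → |besselMean ν s| ≤ D := by
    refine ⟨(A + ν * A) + (B + ν * B), fun s hs => ?_⟩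
    have hν0 : 0 ≤ ν := by linarith
    have e : |besselMean ν s| ≤ (sqrtBessel ν s ^ 2 + sqrtBessel (ν + 1) s ^ 2) / 2 +
        ν * |sqrtBessel ν s * sqrtBessel (ν + 1) s / s| := by
      have e1 : besselMean ν s = (sqrtBessel ν s ^ 2 + sqrtBessel (ν + 1) s ^ 2) / 2 -
        ν * (sqrtBessel ν s * sqrtBessel (ν + 1) s / s) := by
        simp only [besselMean]; ring
      rw [e1]
      refine (abs_sub _ _).trans ?_
      rw [abs_mul, abs_of_nonneg hν0, abs_of_nonneg (by positivity)]
    refine e.trans ?_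
    rcases le_total s 1 with h | h
    · obtain ⟨h1, h2, h3⟩ := hB' s hs h
      have p1 : s ^ (2 * ν + 1) ≤ 1 := Real.rpow_le_one hs.le h (by linarith)
      have h3' : |sqrtBessel ν s * sqrtBessel (ν + 1) s / s| ≤ B := by
        rw [abs_div, abs_of_pos hs, div_le_iff₀ hs]
        refine h3.trans ?_
        gcongr
        calc s ^ (2 * ν + 2) ≤ s ^ (1 : ℝ) :=
              Real.rpow_le_rpow_of_exponent_ge hs h (by linarith)
          _ = s := Real.rpow_one s
      have h1' : sqrtBessel ν s ^ 2 ≤ B := h1.trans (mul_le_of_le_one_right hB p1)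
      have h2' : sqrtBessel (ν + 1) s ^ 2 ≤ B := h2.trans (mul_le_of_le_one_right hB p1)
      have := mul_le_mul_of_nonneg_left h3' hν0
      nlinarith [mul_nonneg hν0 hA]
    · obtain ⟨h1, h2⟩ := hA' s h
      have h3' : |sqrtBessel ν s * sqrtBessel (ν + 1) s / s| ≤ A := by
        rw [abs_div, abs_of_pos hs, div_le_iff₀ hs]
        have : |sqrtBessel ν s * sqrtBessel (ν + 1) s| ≤ A := by
          rw [abs_le]
          constructor <;> nlinarith [sq_nonneg (sqrtBessel ν s + sqrtBessel (ν + 1) s),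
            sq_nonneg (sqrtBessel ν s - sqrtBessel (ν + 1) s)]
        nlinarith
      have := mul_le_mul_of_nonneg_left h3' hν0
      nlinarith [mul_nonneg hν0 hB]
  obtain ⟨D, hD⟩ := hmean
  have habel := tendsto_gaussian_mean (g := fun u => sqrtBessel ν u ^ 2)
    (G := fun u => u * besselMean ν u) (C := D) (c := l) 1
    (fun u hu => hasDerivAt_mul_besselMean hν1 hu) (tendsto_mul_quadratic_zero hν1 ν)
    (fun u hu => by
      rw [abs_mul, abs_of_pos hu, pow_one, mul_comm]
      gcongr
      exact hD u hu)
    (fun R hR => integrableOn_mul_gaussian (r := 2 * ν + 1) (C := max A B) (by linarith)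
      (by positivity) ((continuousOn_sqrtBessel hν1).pow 2)
      (fun s hs hs1 => by
        rw [abs_of_nonneg (sq_nonneg _)]
        refine (hB' s hs hs1).1.trans ?_
        gcongr
        exact le_max_right _ _)
      (fun s hs => by
        rw [abs_of_nonneg (sq_nonneg _)]
        exact (hA' s hs).1.trans (le_max_left _ _)))
    (hM.congr' (by
      filter_upwards [eventually_gt_atTop 0] with u hu
      rw [pow_one, mul_div_cancel_left₀ _ hu.ne']))
  have hexact : Tendsto (fun R : ℝ => (R ^ 1)⁻¹ * ∫ u in Ioi (0 : ℝ),
      sqrtBessel ν u ^ 2 * Real.exp (-(R ^ 2)⁻¹ * u ^ 2)) atTop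
      (𝓝 ((2 * √Real.pi * Real.Gamma (ν + 1 / 2))⁻¹ * Real.Gamma (ν + 1 / 2))) := by
    have h := ((tendsto_laplace_beta (α := ν + 1 / 2) (by linarith)).comp
      (tendsto_pow_atTop (α := ℝ) two_ne_zero)).const_mul
        (2 * √Real.pi * Real.Gamma (ν + 1 / 2))⁻¹
    refine h.congr' ?_
    filter_upwards [eventually_gt_atTop 0] with R hR
    rw [integral_sqrtBessel_sq_mul_gaussian hν (by positivity), Function.comp_apply]
    have e : (R ^ 2) ^ (ν + 1) = (R ^ 2) ^ (ν + 1 / 2) * R := by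
      rw [show ν + 1 = ν + 1 / 2 + 1 / 2 by ring, Real.rpow_add (by positivity),
        ← Real.sqrt_eq_rpow, Real.sqrt_sq hR.le]
    rw [e]
    field_simp
  have huniq := tendsto_nhds_unique habel hexact
  have hG : Real.Gamma (((1 : ℕ) + 2) / 2) = √Real.pi / 2 := by
    rw [show (((1 : ℕ) : ℝ) + 2) / 2 = 1 / 2 + 1 by norm_num,
      Real.Gamma_add_one (by norm_num), Real.Gamma_one_half_eq]
    ring
  rw [hG] at huniq
  have hl' : l = 1 / Real.pi := by
    have hsq := Real.mul_self_sqrt Real.pi_pos.le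
    field_simp at huniq
    rw [eq_div_iff Real.pi_pos.ne', ← hsq]
    linear_combination huniq
  rwa [← hl']

/-- `∫₀^∞ J_ν J_{ν+1} = 1/2` for `ν ≥ 1/2`, by evaluation of the Abel means with Gaussian
weights. -/
lemma tendsto_besselProdInt_of_half_le {ν : ℝ} (hν : 1 / 2 ≤ ν) :
    Tendsto (besselProdInt ν) atTop (𝓝 (1 / 2)) := by
  have hν1 : -1 < ν := by linarith
  have hh : 0 < ν + 1 / 2 := by linarith
  have hGh := Real.Gamma_pos_of_pos hh
  have hpi := Real.sqrt_pos.2 Real.pi_pos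
  obtain ⟨l, C, hC, hl⟩ := exists_besselProdInt_limit hν1
  have hL : Tendsto (besselProdInt ν) atTop (𝓝 l) := by
    rw [tendsto_iff_norm_sub_tendsto_zero]
    refine squeeze_zero' (Eventually.of_forall fun _ => norm_nonneg _)
      ((eventually_ge_atTop 1).mono fun s hs => hl s hs) ?_
    exact tendsto_const_nhds.div_atTop tendsto_id
  obtain ⟨A, hA, hA'⟩ := exists_sqrtBessel_sq_le_of_one_le hν1
  obtain ⟨B, hB, hB'⟩ := abs_sqrtBessel_mul_div_le hν1
  have hbdd : ∃ D, ∀ s, 0 < s → |besselProdInt ν s| ≤ D := by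
    have h : ContinuousOn (besselProdInt ν) (uIcc 0 1) :=
      intervalIntegral.continuousOn_primitive_interval
        ((intervalIntegrable_iff').1 (intervalIntegrable_sqrtBessel_mul_div hν1 le_rfl zero_le_one))
    rw [uIcc_of_le zero_le_one] at h
    obtain ⟨D, hD⟩ := isCompact_Icc.exists_bound_of_continuousOn h
    refine ⟨max D (|l| + C), fun s hs => ?_⟩
    rcases le_total s 1 with h1 | h1
    · exact (hD s ⟨hs.le, h1⟩).trans (le_max_left _ _)
    · refine le_trans ?_ (le_max_right _ _)
      have h2 := hl s h1
      have h3 : C / s ≤ C := div_le_self hC h1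
      have h4 := abs_add_le l (besselProdInt ν s - l)
      rw [add_sub_cancel] at h4
      linarith
  obtain ⟨D, hD⟩ := hbdd
  have habel := tendsto_gaussian_mean (g := fun u => sqrtBessel ν u * sqrtBessel (ν + 1) u / u)
    (G := besselProdInt ν) (C := D) (c := l) 0
    (fun u hu => hasDerivAt_besselProdInt hν1 hu) (tendsto_besselProdInt_zero hν1)
    (fun u hu => by simpa using hD u hu)
    (fun R hR => integrableOn_mul_gaussian (r := 2 * ν + 1) (C := max A B) (by linarith)
      (by positivity) (continuousOn_sqrtBessel_mul_div hν1)
      (fun s hs hs1 => by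
        refine (hB' s hs hs1).trans ?_
        gcongr
        exact le_max_right _ _)
      (fun s hs => by
        refine le_trans ?_ (le_max_left _ _)
        have hs0 : 0 < s := by linarith
        obtain ⟨h1, h2⟩ := hA' s hs
        rw [abs_div, abs_of_pos hs0, div_le_iff₀ hs0]
        have : |sqrtBessel ν s * sqrtBessel (ν + 1) s| ≤ A := by
          rw [abs_le]
          constructor <;> nlinarith [sq_nonneg (sqrtBessel ν s + sqrtBessel (ν + 1) s),
            sq_nonneg (sqrtBessel ν s - sqrtBessel (ν + 1) s)]
        nlinarith))
    (by simpa using hL)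
  have hexact : Tendsto (fun R : ℝ => (R ^ 0)⁻¹ * ∫ u in Ioi (0 : ℝ),
      sqrtBessel ν u * sqrtBessel (ν + 1) u / u * Real.exp (-(R ^ 2)⁻¹ * u ^ 2)) atTop
      (𝓝 ((2 * √Real.pi * Real.Gamma (ν + 1 / 2))⁻¹ * (√Real.pi * Real.Gamma (ν + 1 / 2)))) := by
    have h := ((tendsto_integral_incomplete_gamma hν).comp
      (tendsto_pow_atTop (α := ℝ) two_ne_zero)).const_mul
        (2 * √Real.pi * Real.Gamma (ν + 1 / 2))⁻¹
    refine h.congr' ?_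
    filter_upwards [eventually_gt_atTop 0] with R hR
    rw [integral_sqrtBessel_mul_mul_gaussian hν (by positivity), Function.comp_apply, pow_zero,
      inv_one, one_mul]
  have huniq := tendsto_nhds_unique habel hexact
  have hl' : l = 1 / 2 := by
    have e1 : (((0 : ℕ) : ℝ) + 2) / 2 = 1 := by norm_num
    rw [e1, Real.Gamma_one, mul_one] at huniq
    rw [huniq]
    field_simp
  rwa [← hl']

/-- The limit of the energy is the same for `ν` and `ν + 1`: by the three-term recurrence,
`√s J_{ν+2}(s) = -√s J_ν(s) + O(1/s)`. -/
lemma tendsto_besselEnergy_of_add_one {ν l : ℝ} (hν : -1 < ν)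
    (h : Tendsto (besselEnergy (ν + 1)) atTop (𝓝 l)) : Tendsto (besselEnergy ν) atTop (𝓝 l) := by
  have hz := (tendsto_sqrtBessel_sq_div hν 1).1
  have hz2 : Tendsto (fun s : ℝ => (2 * (ν + 1) ^ 2 - 2 * (ν + 1) * (ν + 3 / 2)) / s) atTop (𝓝 0) :=
    tendsto_const_nhds.div_atTop tendsto_id
  have h1 := (h.sub (hz2.mul hz)).sub
    (tendsto_sqrtBessel_sq_div hν (-2 * (ν + 1) + (ν + 3 / 2) + (ν + 1 / 2))).2
  rw [mul_zero, sub_zero, sub_zero] at h1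
  refine h1.congr' ?_
  filter_upwards [eventually_gt_atTop 0] with s hs
  simp only [besselEnergy]
  rw [show ν + 1 + 1 = ν + 2 by ring, sqrtBessel_recurrence hν hs]
  field_simp
  ring

/-- The integral `∫₀^∞ J_ν J_{ν+1}` is the same for `ν` and `ν + 1`: the difference of the
integrands is the derivative of `J_{ν+1}²`, which vanishes at both ends. -/
lemma tendsto_besselProdInt_of_add_one {ν l : ℝ} (hν : -1 < ν)
    (h : Tendsto (besselProdInt (ν + 1)) atTop (𝓝 l)) :
    Tendsto (besselProdInt ν) atTop (𝓝 l) := by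
  have hν1 : -1 < ν + 1 := by linarith
  have hz := (tendsto_sqrtBessel_sq_div hν 1).1
  have hsum := h.add hz
  rw [add_zero] at hsum
  refine hsum.congr' ?_
  filter_upwards [eventually_gt_atTop 0] with S hS
  have hd : ∀ s, 0 < s → HasDerivAt (fun s => 1 / s * sqrtBessel (ν + 1) s ^ 2)
      (sqrtBessel ν s * sqrtBessel (ν + 1) s / s -
        sqrtBessel (ν + 1) s * sqrtBessel (ν + 1 + 1) s / s) s := by
    intro s hs
    have h2 := (hasDerivAt_inv hs.ne').mul ((hasDerivAt_sqrtBessel_add_one hν hs).pow 2)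
    simp only [one_div]
    convert! h2 using 1
    rw [show ν + 1 + 1 = ν + 2 by ring, sqrtBessel_recurrence hν hs]
    simp only [Nat.cast_ofNat, Pi.pow_apply]
    field_simp
    ring
  have h0 : Tendsto (fun s => 1 / s * sqrtBessel (ν + 1) s ^ 2) (𝓝[>] 0) (𝓝 0) := by
    obtain ⟨B, hB, hb⟩ := exists_abs_sqrtBessel_le_rpow hν1
    refine squeeze_zero_norm' ?_ (tendsto_rpow_nhdsGT_zero (show 0 < 2 * ν + 2 by linarith) (B ^ 2))
    filter_upwards [Ioo_mem_nhdsGT (zero_lt_one (α := ℝ))] with s hs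
    have hs0 := hs.1
    rw [Real.norm_of_nonneg (by positivity), one_div, inv_mul_le_iff₀ hs0, ← sq_abs]
    have h3 := hb s hs0 hs.2.le
    calc |sqrtBessel (ν + 1) s| ^ 2 ≤ (B * s ^ (ν + 1 + 1 / 2)) ^ 2 := by gcongr
      _ = B ^ 2 * (s ^ (ν + 1 + 1 / 2) * s ^ (ν + 1 + 1 / 2)) := by ring
      _ = B ^ 2 * (s ^ (2 * ν + 2) * s) := by
        rw [← Real.rpow_add hs0, ← Real.rpow_add_one hs0.ne']; congr 2; ring
      _ = _ := by ring
  have i1 := intervalIntegrable_sqrtBessel_mul_div hν le_rfl hS.le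
  have i2 := intervalIntegrable_sqrtBessel_mul_div hν1 le_rfl hS.le
  have hftc := intervalIntegral.integral_eq_sub_of_hasDerivAt_of_tendsto hS
    (fun s hs => hd s hs.1) (i1.sub i2) h0
    ((hd S hS).continuousAt.tendsto.mono_left nhdsWithin_le_nhds)
  rw [intervalIntegral.integral_sub i1 i2] at hftc
  simp only [besselProdInt]
  linarith

/-- The energy tends to `1/π`, i.e. `√s J_ν(s)` has asymptotic amplitude `√(2/π)`. -/
lemma tendsto_besselEnergy {ν : ℝ} (hν : -1 < ν) :
    Tendsto (besselEnergy ν) atTop (𝓝 (1 / Real.pi)) :=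
  tendsto_besselEnergy_of_add_one hν (tendsto_besselEnergy_of_add_one (by linarith)
    (tendsto_besselEnergy_of_half_le (by linarith)))

/-- `∫₀^∞ J_ν J_{ν+1} = 1/2` as a conditionally convergent integral. -/
lemma tendsto_besselProdInt {ν : ℝ} (hν : -1 < ν) :
    Tendsto (besselProdInt ν) atTop (𝓝 (1 / 2)) :=
  tendsto_besselProdInt_of_add_one hν (tendsto_besselProdInt_of_add_one (by linarith)
    (tendsto_besselProdInt_of_half_le (by linarith)))

/-! ### The primitive of the mean value -/

/-- The primitive `ν/2 + ∫₀ˢ (besselMean ν - 1/π)`, in closed form. The additive constant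
makes it vanish at infinity; the value at the origin is where the term `-ν b(0)/2` comes from. -/
noncomputable def besselRemainder (ν s : ℝ) : ℝ :=
  ν * (1 / 2 - besselProdInt ν s) + s * (besselEnergy ν s - 1 / Real.pi)

lemma hasDerivAt_besselRemainder {ν s : ℝ} (hν : -1 < ν) (hs : 0 < s) :
    HasDerivAt (besselRemainder ν) (besselMean ν s - 1 / Real.pi) s := by
  have h := (((hasDerivAt_besselProdInt hν hs).const_sub (1 / 2)).const_mul ν).add
    ((hasDerivAt_id s).mul ((hasDerivAt_besselEnergy hν hs).sub_const (1 / Real.pi)))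
  convert! h using 1
  simp only [besselMean, besselEnergy, id]
  field_simp
  ring

lemma tendsto_besselRemainder_zero {ν : ℝ} (hν : -1 < ν) :
    Tendsto (besselRemainder ν) (𝓝[>] 0) (𝓝 (ν / 2)) := by
  have h1 := ((tendsto_besselProdInt_zero hν).const_sub (1 / 2)).const_mul ν
  have h2 := tendsto_mul_quadratic_zero hν (ν + 1 / 2)
  have h3 : Tendsto (fun s : ℝ => s * (1 / Real.pi)) (𝓝[>] 0) (𝓝 0) := by
    have : Continuous fun s : ℝ => s * (1 / Real.pi) := by fun_prop
    have h := (this.tendsto 0).mono_left (nhdsWithin_le_nhds (s := Ioi 0))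
    simpa using h
  have h := (h1.add h2).sub h3
  have e : ν * (1 / 2 - 0) + 0 - 0 = ν / 2 := by ring
  rw [e] at h
  refine h.congr fun s => ?_
  simp only [besselRemainder, besselEnergy]
  ring

lemma besselRemainder_zero (ν : ℝ) : besselRemainder ν 0 = ν / 2 := by
  simp [besselRemainder, besselProdInt]
  ring

lemma continuousOn_besselRemainder {ν : ℝ} (hν : -1 < ν) :
    ContinuousOn (besselRemainder ν) (Ici 0) := by
  intro s hs
  rcases (mem_Ici.1 hs).eq_or_lt with rfl | h
  · rw [← Ioi_insert, continuousWithinAt_insert_self, ContinuousWithinAt, besselRemainder_zero]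
    exact tendsto_besselRemainder_zero hν
  · exact (hasDerivAt_besselRemainder hν h).continuousAt.continuousWithinAt

/-- The remainder decays like `1/s`; both constants, `1/2` and `1/π`, are the actual limits. -/
lemma exists_abs_besselRemainder_le {ν : ℝ} (hν : -1 < ν) :
    ∃ C, 0 ≤ C ∧ ∀ s, 0 < s → |besselRemainder ν s| ≤ C / (1 + s) := by
  obtain ⟨l, C, hC, hl⟩ := exists_besselEnergy_limit hν
  obtain ⟨l', C', hC', hl'⟩ := exists_besselProdInt_limit hν
  have e1 : l = 1 / Real.pi := by
    refine tendsto_nhds_unique ?_ (tendsto_besselEnergy hν)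
    rw [tendsto_iff_norm_sub_tendsto_zero]
    refine squeeze_zero' (Eventually.of_forall fun _ => norm_nonneg _)
      ((eventually_ge_atTop 1).mono fun s hs => hl s hs) ?_
    exact tendsto_const_nhds.div_atTop (tendsto_pow_atTop two_ne_zero)
  have e2 : l' = 1 / 2 := by
    refine tendsto_nhds_unique ?_ (tendsto_besselProdInt hν)
    rw [tendsto_iff_norm_sub_tendsto_zero]
    refine squeeze_zero' (Eventually.of_forall fun _ => norm_nonneg _)
      ((eventually_ge_atTop 1).mono fun s hs => hl' s hs) ?_
    exact tendsto_const_nhds.div_atTop tendsto_id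
  subst e1 e2
  obtain ⟨D, hD'⟩ := isCompact_Icc.exists_bound_of_continuousOn
    ((continuousOn_besselRemainder hν).mono (Icc_subset_Ici_self : Icc (0 : ℝ) 1 ⊆ Ici 0))
  have hD0 : 0 ≤ D := (norm_nonneg _).trans (hD' 0 (by simp))
  have hD : ∀ s, 0 < s → s ≤ 1 → |besselRemainder ν s| ≤ D := fun s hs hs1 => hD' s ⟨hs.le, hs1⟩
  refine ⟨2 * (D + (|ν| * C' + C)), by positivity, fun s hs => ?_⟩
  have h1s : 0 < 1 + s := by linarith
  rw [le_div_iff₀ h1s]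
  rcases le_total s 1 with h | h
  · have h0 := hD s hs h
    have hX : 0 ≤ |ν| * C' + C := by positivity
    nlinarith [abs_nonneg (besselRemainder ν s)]
  · have h1 := hl s h
    have h2 := hl' s h
    have h3 : |besselRemainder ν s| ≤ (|ν| * C' + C) / s := by
      rw [besselRemainder]
      refine (abs_add_le _ _).trans ?_
      rw [abs_mul, abs_mul, abs_of_pos hs, abs_sub_comm, add_div, mul_div_assoc]
      refine add_le_add (by gcongr) ?_
      calc s * |besselEnergy ν s - 1 / Real.pi| ≤ s * (C / s ^ 2) := by gcongr
        _ = C / s := by field_simp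
    rw [le_div_iff₀ hs] at h3
    nlinarith [abs_nonneg (besselRemainder ν s)]

/-! ### Trace class operators that are integrals of rank one operators -/

section RankOneIntegral

variable {H : Type*} [NormedAddCommGroup H] [InnerProductSpace ℂ H] [CompleteSpace H]

/-- An approximate polar decomposition: the contraction `U = T (|T| + ε)⁻¹` satisfies
`U* T = |T| + O(ε)`. -/
lemma exists_contraction_inner_abs (T : H →L[ℂ] H) {ε : ℝ} (hε : 0 < ε) :
    ∃ U : H →L[ℂ] H, (∀ x, ‖U x‖ ≤ ‖x‖) ∧
      ∀ x, ‖⟪U x, T x⟫_ℂ - ⟪x, CFC.abs T x⟫_ℂ‖ ≤ ε * ‖x‖ ^ 2 := by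
  set S : H →L[ℂ] H := CFC.abs T with hS
  have hS0 : 0 ≤ S := CFC.abs_nonneg T
  have hpos : S.IsPositive := ContinuousLinearMap.nonneg_iff_isPositive S |>.1 hS0
  have hsymm : ∀ x y, ⟪S x, y⟫_ℂ = ⟪x, S y⟫_ℂ := fun x y => hpos.isSymmetric x y
  have hSS : ∀ x y, ⟪T x, T y⟫_ℂ = ⟪S x, S y⟫_ℂ := by
    intro x y
    have h := CFC.abs_mul_abs T
    rw [hsymm, ← mul_apply_eq_comp, hS, h, ContinuousLinearMap.star_eq_adjoint,
      mul_apply_eq_comp, ContinuousLinearMap.adjoint_inner_right]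
  have hunit : IsUnit (S + algebraMap ℝ (H →L[ℂ] H) ε) := by
    have h : (-ε) ∉ spectrum ℝ S := fun h => by
      have := spectrum_nonneg_of_nonneg hS0 h
      linarith
    rw [spectrum.notMem_iff] at h
    have h' := h.neg
    rwa [neg_sub, map_neg, sub_neg_eq_add] at h'
  obtain ⟨V, hV⟩ := hunit
  set R : H →L[ℂ] H := ↑V⁻¹
  have hR : ∀ x, S (R x) + (ε : ℂ) • R x = x := by
    intro x
    have h : (S + algebraMap ℝ (H →L[ℂ] H) ε) * R = 1 := by rw [← hV]; exact V.mul_inv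
    have h2 := congrArg (fun A : H →L[ℂ] H => A x) h
    simpa [Algebra.algebraMap_eq_smul_one, add_apply] using h2
  have hSR : ∀ x, ‖S (R x)‖ ≤ ‖x‖ := by
    intro x
    have h1 : ‖x‖ ^ 2 = ‖S (R x)‖ ^ 2 + 2 * (ε * RCLike.re ⟪S (R x), R x⟫_ℂ) +
        ‖(ε : ℂ) • R x‖ ^ 2 := by
      conv_lhs => rw [← hR x]
      rw [norm_add_sq (𝕜 := ℂ), inner_smul_right]
      simp
    have h2 : 0 ≤ RCLike.re ⟪S (R x), R x⟫_ℂ := hpos.re_inner_nonneg_left (R x)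
    have h3 : 0 ≤ ε * RCLike.re ⟪S (R x), R x⟫_ℂ := mul_nonneg hε.le h2
    refine le_of_sq_le_sq ?_ (norm_nonneg x)
    nlinarith [sq_nonneg ‖(ε : ℂ) • R x‖]
  refine ⟨T * R, fun x => ?_, fun x => ?_⟩
  · refine le_trans (le_of_eq ?_) (hSR x)
    have h := hSS (R x) (R x)
    rw [inner_self_eq_norm_sq_to_K, inner_self_eq_norm_sq_to_K] at h
    have h' : ‖T (R x)‖ ^ 2 = ‖S (R x)‖ ^ 2 := by exact_mod_cast h
    rw [mul_apply_eq_comp]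
    exact (sq_eq_sq₀ (norm_nonneg _) (norm_nonneg _)).1 h'
  · rw [mul_apply_eq_comp, hSS]
    have h1 : S (R x) = x - (ε : ℂ) • R x := eq_sub_of_add_eq (hR x)
    have h2 : ⟪S (R x), S x⟫_ℂ - ⟪x, S x⟫_ℂ = -((ε : ℂ) * ⟪S (R x), x⟫_ℂ) := by
      conv_lhs => rw [h1]
      rw [inner_sub_left, inner_smul_left, hsymm]
      simp
    rw [h2, norm_neg, norm_mul, Complex.norm_real, Real.norm_of_nonneg hε.le]
    gcongr
    calc ‖⟪S (R x), x⟫_ℂ‖ ≤ ‖S (R x)‖ * ‖x‖ := norm_inner_le_norm _ _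
      _ ≤ ‖x‖ * ‖x‖ := by gcongr; exact hSR x
      _ = _ := by ring

variable {S : Type*} [MeasurableSpace S]

/-- `T = ∫ β(t) ⟨Φ_t, ·⟩ Φ_t dλ(t)` in the weak sense. -/
def IsRankOneIntegral (lam : Measure S) (β : S → ℂ) (Φ : S → H) (T : H →L[ℂ] H) : Prop :=
  ∀ u v : H, Integrable (fun t => β t * (⟪u, Φ t⟫_ℂ * ⟪Φ t, v⟫_ℂ)) lam ∧
    ⟪u, T v⟫_ℂ = ∫ t, β t * (⟪u, Φ t⟫_ℂ * ⟪Φ t, v⟫_ℂ) ∂lam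

/-- Bessel's inequality for `U* x` and for `x`, combined by the arithmetic-geometric mean
inequality. -/
lemma sum_norm_inner_mul_inner_le {ι : Type*} {e : ι → H} (he : Orthonormal ℂ e) {U : H →L[ℂ] H}
    (hU : ∀ x, ‖U x‖ ≤ ‖x‖) (F : Finset ι) (x : H) :
    ∑ i ∈ F, ‖⟪U (e i), x⟫_ℂ * ⟪x, e i⟫_ℂ‖ ≤ ‖x‖ ^ 2 := by
  have hU' : ‖U.adjoint x‖ ≤ ‖x‖ := by
    have h1 : ‖U‖ ≤ 1 := U.opNorm_le_bound zero_le_one fun x => by simpa using hU x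
    have h2 : ‖U.adjoint‖ ≤ 1 := by rwa [LinearIsometryEquiv.norm_map]
    calc ‖U.adjoint x‖ ≤ ‖U.adjoint‖ * ‖x‖ := U.adjoint.le_opNorm x
      _ ≤ 1 * ‖x‖ := by gcongr
      _ = ‖x‖ := one_mul _
  have h1 := he.sum_inner_products_le (s := F) (U.adjoint x)
  have h2 := he.sum_inner_products_le (s := F) x
  have hsq : ‖U.adjoint x‖ ^ 2 ≤ ‖x‖ ^ 2 := by gcongr
  have h3 : ∀ i ∈ F, ‖⟪U (e i), x⟫_ℂ * ⟪x, e i⟫_ℂ‖ ≤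
      (‖⟪e i, U.adjoint x⟫_ℂ‖ ^ 2 + ‖⟪e i, x⟫_ℂ‖ ^ 2) / 2 := by
    intro i _
    rw [norm_mul, ContinuousLinearMap.adjoint_inner_right, norm_inner_symm x]
    nlinarith [sq_nonneg (‖⟪U (e i), x⟫_ℂ‖ - ‖⟪e i, x⟫_ℂ‖)]
  refine (Finset.sum_le_sum h3).trans ?_
  rw [← Finset.sum_div, Finset.sum_add_distrib]
  linarith

lemma IsRankOneIntegral.norm_sum_inner_le {lam : Measure S} {β : S → ℂ} {Φ : S → H}
    {T : H →L[ℂ] H} (hT : IsRankOneIntegral lam β Φ T)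
    (hint : Integrable (fun t => ‖β t‖ * ‖Φ t‖ ^ 2) lam)
    {ι : Type*} {e : ι → H} (he : Orthonormal ℂ e) {U : H →L[ℂ] H}
    (hU : ∀ x, ‖U x‖ ≤ ‖x‖) (F : Finset ι) :
    ‖∑ i ∈ F, ⟪U (e i), T (e i)⟫_ℂ‖ ≤ ∫ t, ‖β t‖ * ‖Φ t‖ ^ 2 ∂lam := by
  have h1 : ∑ i ∈ F, ⟪U (e i), T (e i)⟫_ℂ =
      ∫ t, ∑ i ∈ F, β t * (⟪U (e i), Φ t⟫_ℂ * ⟪Φ t, e i⟫_ℂ) ∂lam := by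
    rw [integral_finsetSum _ fun i _ => (hT (U (e i)) (e i)).1]
    exact Finset.sum_congr rfl fun i _ => (hT (U (e i)) (e i)).2
  rw [h1]
  refine norm_integral_le_of_norm_le hint (ae_of_all _ fun t => ?_)
  rw [← Finset.mul_sum, norm_mul]
  gcongr
  exact (norm_sum_le _ _).trans (sum_norm_inner_mul_inner_le he hU F (Φ t))

end RankOneIntegral

lemma Orthonormal.countable_of_separable {H : Type*} [NormedAddCommGroup H] [InnerProductSpace ℂ H]
    [TopologicalSpace.SeparableSpace H] {ι : Type*} {e : ι → H}
      (he : Orthonormal ℂ e) : Countable ι := by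
  have hdisj : Pairwise (Function.onFun Disjoint fun i => Metric.ball (e i) (1 / 2)) := by
    intro i j hij
    refine Metric.ball_disjoint_ball ?_
    have h0 : ‖e i - e j‖ ^ 2 = 2 := by
      rw [norm_sub_sq (𝕜 := ℂ), he.1 i, he.1 j, he.2 hij]
      norm_num
    rw [dist_eq_norm]
    nlinarith [norm_nonneg (e i - e j)]
  exact hdisj.countable_of_isOpen_disjoint (fun _ => Metric.isOpen_ball)
    (fun i => ⟨e i, Metric.mem_ball_self (by norm_num)⟩)

section TraceClass

universe u

variable {H : Type u} [NormedAddCommGroup H] [InnerProductSpace ℂ H] [CompleteSpace H]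
  {S : Type*} [MeasurableSpace S]

/-- An absolutely convergent integral of rank one operators is of trace class. The approximate polar
decomposition bounds each partial sum of `∑ ⟨eᵢ, |T| eᵢ⟩` by the one of `∑ ⟨U eᵢ, T eᵢ⟩`, up to an
arbitrarily small error. -/
lemma IsRankOneIntegral.isTraceClass {lam : Measure S} {β : S → ℂ} {Φ : S → H}
    {T : H →L[ℂ] H} (hT : IsRankOneIntegral lam β Φ T)
    (hint : Integrable (fun t => ‖β t‖ * ‖Φ t‖ ^ 2) lam) : IsTraceClass T := by
  intro ι e
  have he := e.orthonormal
  have hpos : (CFC.abs T).IsPositive :=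
    ContinuousLinearMap.nonneg_iff_isPositive _ |>.1 (CFC.abs_nonneg T)
  have hre : ∀ i, ⟪e i, CFC.abs T (e i)⟫_ℂ = ((RCLike.re ⟪e i, CFC.abs T (e i)⟫_ℂ : ℝ) : ℂ) := by
    intro i
    exact (hpos.isSymmetric.coe_re_inner_self_apply (e i)).symm
  have hsum : Summable fun i => RCLike.re ⟪e i, CFC.abs T (e i)⟫_ℂ := by
    refine summable_of_sum_le (c := ∫ t, ‖β t‖ * ‖Φ t‖ ^ 2 ∂lam)
      (fun i => hpos.re_inner_nonneg_right (e i)) fun F => ?_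
    refine le_of_forall_pos_le_add fun δ hδ => ?_
    set ε : ℝ := δ / (F.card + 1)
    have hε : 0 < ε := by positivity
    obtain ⟨U, hU, hUT⟩ := exists_contraction_inner_abs T hε
    have h1 := hT.norm_sum_inner_le hint he hU F
    have h2 : ∀ i ∈ F, RCLike.re ⟪e i, CFC.abs T (e i)⟫_ℂ ≤
        RCLike.re ⟪U (e i), T (e i)⟫_ℂ + ε := by
      intro i _
      have h3 := hUT (e i)
      rw [he.1 i, one_pow, mul_one] at h3
      have h4 := (RCLike.abs_re_le_norm (⟪U (e i), T (e i)⟫_ℂ - ⟪e i, CFC.abs T (e i)⟫_ℂ)).trans h3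
      rw [map_sub] at h4
      linarith [(abs_le.1 h4).1]
    have h5 := Finset.sum_le_sum h2
    rw [Finset.sum_add_distrib, Finset.sum_const, nsmul_eq_mul] at h5
    have h8 : ∑ i ∈ F, RCLike.re ⟪U (e i), T (e i)⟫_ℂ =
        RCLike.re (∑ i ∈ F, ⟪U (e i), T (e i)⟫_ℂ) := (map_sum RCLike.re _ _).symm
    have h6 : ε * (F.card + 1) = δ :=
      div_mul_cancel₀ δ (Nat.cast_add_one_pos (α := ℝ) F.card).ne'
    have h7 := RCLike.re_le_norm (∑ i ∈ F, ⟪U (e i), T (e i)⟫_ℂ)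
    linarith
  have h := (Complex.ofRealCLM.summable hsum)
  refine h.congr fun i => ?_
  rw [hre i]
  rfl

/-- The trace of an integral of rank one operators, by Parseval's identity under the integral.
Separability makes the basis countable, as dominated convergence requires. -/
lemma IsRankOneIntegral.operatorTrace_eq [TopologicalSpace.SeparableSpace H] {lam : Measure S}
    {β : S → ℂ} {Φ : S → H} {T : H →L[ℂ] H} (hT : IsRankOneIntegral lam β Φ T)
    (hint : Integrable (fun t => ‖β t‖ * ‖Φ t‖ ^ 2) lam) :
    operatorTrace T = ∫ t, β t * ((‖Φ t‖ ^ 2 : ℝ) : ℂ) ∂lam := by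
  set e := (exists_hilbertBasis ℂ H).choose_spec.choose
  have : Countable ((exists_hilbertBasis ℂ H).choose) :=
    Orthonormal.countable_of_separable e.orthonormal
  have hP : ∀ t, HasSum (fun i => ⟪e i, Φ t⟫_ℂ * ⟪Φ t, e i⟫_ℂ) ((‖Φ t‖ ^ 2 : ℝ) : ℂ) := by
    intro t
    have h := e.hasSum_inner_mul_inner (Φ t) (Φ t)
    rw [inner_self_eq_norm_sq_to_K] at h
    convert! h using 1
    · funext i; rw [mul_comm]
    · push_cast; rfl
  have hPn : ∀ t i, ‖⟪e i, Φ t⟫_ℂ * ⟪Φ t, e i⟫_ℂ‖ = RCLike.re (⟪e i, Φ t⟫_ℂ * ⟪Φ t, e i⟫_ℂ) := by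
    intro t i
    rw [← inner_conj_symm (Φ t) (e i), RCLike.mul_conj]
    norm_cast
    exact abs_of_nonneg (by positivity)
  have hPs : ∀ t, HasSum (fun i => ‖β t * (⟪e i, Φ t⟫_ℂ * ⟪Φ t, e i⟫_ℂ)‖) (‖β t‖ * ‖Φ t‖ ^ 2) := by
    intro t
    have h := (RCLike.reCLM (K := ℂ)).hasSum (hP t)
    simp only [norm_mul (β t), hPn]
    refine HasSum.mul_left _ ?_
    convert! h using 1
  have h := hasSum_integral_of_dominated_convergence (μ := lam)
    (F := fun i t => β t * (⟪e i, Φ t⟫_ℂ * ⟪Φ t, e i⟫_ℂ))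
    (f := fun t => β t * ((‖Φ t‖ ^ 2 : ℝ) : ℂ))
    (fun i t => ‖β t * (⟪e i, Φ t⟫_ℂ * ⟪Φ t, e i⟫_ℂ)‖)
    (fun i => (hT (e i) (e i)).1.aestronglyMeasurable)
    (fun i => ae_of_all _ fun t => le_rfl)
    (ae_of_all _ fun t => (hPs t).summable)
    (by simpa only [(hPs _).tsum_eq] using hint)
    (ae_of_all _ fun t => (hP t).mul_left _)
  rw [operatorTrace, ← h.tsum_eq]
  exact tsum_congr fun i => (hT (e i) (e i)).2

end TraceClass

/-! ### Integral operators with factorized kernels -/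

section FactorKernel

variable {X S : Type*} [MeasurableSpace X] [MeasurableSpace S] {μ : Measure X} {lam : Measure S}

/-- The kernel `∫ φ_t(x) φ_t(y) β(t) dλ(t)`. -/
noncomputable def factorKernel (lam : Measure S) (φ : S → X → ℝ) (β : S → ℂ) (x y : X) : ℂ :=
  ∫ t, ((φ t x * φ t y : ℝ) : ℂ) * β t ∂lam

/-- The standing assumptions on the functions `φ_t` and the weight `β`: joint measurability and a
product bound `|φ_t(x)| ≤ h(t) g(x)` with `g ∈ L²(μ)` and `|β| h² ∈ L¹(λ)`. -/
structure IsFactorization (μ : Measure X) (lam : Measure S) (φ : S → X → ℝ) (β : S → ℂ)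
    (g : X → ℝ) (h : S → ℝ) : Prop where
  measurable_phi : Measurable (Function.uncurry φ)
  measurable_beta : Measurable β
  nonneg : ∀ x, 0 ≤ g x
  memLp : MemLp g 2 μ
  abs_le : ∀ t x, |φ t x| ≤ h t * g x
  integrable : Integrable (fun t => ‖β t‖ * h t ^ 2) lam

namespace IsFactorization

variable {φ : S → X → ℝ} {β : S → ℂ} {g : X → ℝ} {h : S → ℝ}

lemma norm_integrand_le (H : IsFactorization μ lam φ β g h) (x y : X) (t : S) :
    ‖((φ t x * φ t y : ℝ) : ℂ) * β t‖ ≤ g x * g y * (‖β t‖ * h t ^ 2) := by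
  rw [norm_mul, Complex.norm_real, Real.norm_eq_abs, abs_mul]
  have h1 := H.abs_le t x
  have h2 := H.abs_le t y
  have h3 := (abs_nonneg _).trans h1
  calc |φ t x| * |φ t y| * ‖β t‖ ≤ (h t * g x) * (h t * g y) * ‖β t‖ := by gcongr
    _ = _ := by ring

lemma integrable_integrand (H : IsFactorization μ lam φ β g h) (x y : X) :
    Integrable (fun t => ((φ t x * φ t y : ℝ) : ℂ) * β t) lam := by
  refine Integrable.mono' (H.integrable.const_mul (g x * g y)) ?_
    (ae_of_all _ fun t => H.norm_integrand_le x y t)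
  have h1 : Measurable fun t => φ t x :=
    H.measurable_phi.comp (measurable_id.prodMk measurable_const)
  have h2 : Measurable fun t => φ t y :=
    H.measurable_phi.comp (measurable_id.prodMk measurable_const)
  exact ((Complex.measurable_ofReal.comp (h1.mul h2)).mul H.measurable_beta).aestronglyMeasurable

lemma norm_factorKernel_le (H : IsFactorization μ lam φ β g h) (x y : X) :
    ‖factorKernel lam φ β x y‖ ≤ g x * g y * ∫ t, ‖β t‖ * h t ^ 2 ∂lam := by
  rw [← integral_const_mul]
  exact norm_integral_le_of_norm_le (H.integrable.const_mul _)
    (ae_of_all _ fun t => H.norm_integrand_le x y t)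

lemma measurable_triple (H : IsFactorization μ lam φ β g h) :
    Measurable fun p : (X × X) × S => ((φ p.2 p.1.1 * φ p.2 p.1.2 : ℝ) : ℂ) * β p.2 := by
  have h1 : Measurable fun p : (X × X) × S => φ p.2 p.1.1 :=
    H.measurable_phi.comp (measurable_snd.prodMk (measurable_fst.comp measurable_fst))
  have h2 : Measurable fun p : (X × X) × S => φ p.2 p.1.2 :=
    H.measurable_phi.comp (measurable_snd.prodMk (measurable_snd.comp measurable_fst))
  exact (Complex.measurable_ofReal.comp (h1.mul h2)).mul (H.measurable_beta.comp measurable_snd)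

lemma stronglyMeasurable_factorKernel [SFinite lam] (H : IsFactorization μ lam φ β g h) :
    StronglyMeasurable (Function.uncurry (factorKernel lam φ β)) := by
  have h1 := H.measurable_triple.stronglyMeasurable.integral_prod_right' (ν := lam)
  exact h1

/-- The Cauchy–Schwarz inequality for `∫ g |f|`. -/
lemma integrable_mul_norm (hg : MemLp g 2 μ) (f : Lp ℂ 2 μ) :
    Integrable (fun y => g y * ‖f y‖) μ ∧
      ∫ y, g y * ‖f y‖ ∂μ ≤ ‖hg.toLp g‖ * ‖f‖ := by
  have hf := (Lp.memLp f).norm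
  have hi := L2.integrable_inner (𝕜 := ℝ) (hf.toLp _) (hg.toLp g)
  have hd := L2.inner_def (𝕜 := ℝ) (hf.toLp _) (hg.toLp g)
  have hae : (fun y => ⟪(hf.toLp _) y, (hg.toLp g) y⟫_ℝ) =ᵐ[μ] fun y => g y * ‖f y‖ := by
    filter_upwards [hf.coeFn_toLp, hg.coeFn_toLp] with y h1 h2
    rw [h1, h2]
    simp
  refine ⟨hi.congr hae, ?_⟩
  rw [← integral_congr_ae hae, ← hd]
  refine (le_abs_self _).trans ((abs_real_inner_le_norm _ _).trans_eq ?_)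
  rw [mul_comm]
  congr 1
  rw [Lp.norm_toLp, Lp.norm_def, eLpNorm_norm]

lemma integrable_factorKernel_mul [SFinite lam] (H : IsFactorization μ lam φ β g h) (f : Lp ℂ 2 μ)
    (x : X) : Integrable (fun y => factorKernel lam φ β x y * f y) μ := by
  refine Integrable.mono' ((integrable_mul_norm H.memLp f).1.const_mul
    (g x * ∫ t, ‖β t‖ * h t ^ 2 ∂lam)) ?_ (ae_of_all _ fun y => ?_)
  · have h1 : StronglyMeasurable fun y => factorKernel lam φ β x y :=
      H.stronglyMeasurable_factorKernel.comp_measurable (measurable_const.prodMk measurable_id)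
    exact h1.aestronglyMeasurable.mul (Lp.aestronglyMeasurable f)
  · rw [norm_mul]
    calc _ ≤ (g x * g y * ∫ t, ‖β t‖ * h t ^ 2 ∂lam) * ‖f y‖ := by
          gcongr; exact H.norm_factorKernel_le x y
      _ = _ := by ring

lemma norm_integral_factorKernel_mul_le [SFinite lam] (H : IsFactorization μ lam φ β g h)
    (f : Lp ℂ 2 μ) (x : X) :
    ‖∫ y, factorKernel lam φ β x y * f y ∂μ‖ ≤
      (∫ t, ‖β t‖ * h t ^ 2 ∂lam) * (∫ y, g y * ‖f y‖ ∂μ) * g x := by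
  have h1 : ∀ y, ‖factorKernel lam φ β x y * f y‖ ≤
      (g x * ∫ t, ‖β t‖ * h t ^ 2 ∂lam) * (g y * ‖f y‖) := fun y => by
    rw [norm_mul]
    calc _ ≤ (g x * g y * ∫ t, ‖β t‖ * h t ^ 2 ∂lam) * ‖f y‖ := by
          gcongr; exact H.norm_factorKernel_le x y
      _ = _ := by ring
  refine (norm_integral_le_of_norm_le ((integrable_mul_norm H.memLp f).1.const_mul _)
    (ae_of_all _ h1)).trans_eq ?_
  rw [integral_const_mul]
  ring

lemma memLp_integral [SFinite μ] [SFinite lam] (H : IsFactorization μ lam φ β g h)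
    (f : Lp ℂ 2 μ) : MemLp (fun x => ∫ y, factorKernel lam φ β x y * f y ∂μ) 2 μ := by
  refine MemLp.of_le_mul (c := (∫ t, ‖β t‖ * h t ^ 2 ∂lam) * (∫ y, g y * ‖f y‖ ∂μ)) H.memLp ?_
    (ae_of_all _ fun x => ?_)
  · have h1 : StronglyMeasurable (Function.uncurry fun x y => factorKernel lam φ β x y * f y) :=
      H.stronglyMeasurable_factorKernel.mul
        ((Lp.stronglyMeasurable f).comp_measurable measurable_snd)
    exact h1.integral_prod_right.aestronglyMeasurable
  · refine (H.norm_integral_factorKernel_mul_le f x).trans ?_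
    rw [Real.norm_of_nonneg (H.nonneg x)]

lemma exists_hasIntegralKernel [SFinite μ] [SFinite lam] (H : IsFactorization μ lam φ β g h) :
    ∃ T : Lp ℂ 2 μ →L[ℂ] Lp ℂ 2 μ, HasIntegralKernel μ (factorKernel lam φ β) T := by
  let A : Lp ℂ 2 μ →ₗ[ℂ] Lp ℂ 2 μ :=
    { toFun := fun f => (H.memLp_integral f).toLp _
      map_add' := fun f f' => by
        rw [← MemLp.toLp_add]
        refine MemLp.toLp_congr _ _ (ae_of_all _ fun x => ?_)
        rw [Pi.add_apply, ← integral_add (H.integrable_factorKernel_mul f x)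
          (H.integrable_factorKernel_mul f' x)]
        refine integral_congr_ae ?_
        filter_upwards [Lp.coeFn_add f f'] with y hy
        rw [hy, Pi.add_apply, mul_add]
      map_smul' := fun c f => by
        rw [RingHom.id_apply, ← MemLp.toLp_const_smul]
        refine MemLp.toLp_congr _ _ (ae_of_all _ fun x => ?_)
        rw [Pi.smul_apply, ← integral_smul]
        refine integral_congr_ae ?_
        filter_upwards [Lp.coeFn_smul c f] with y hy
        rw [hy, Pi.smul_apply, smul_eq_mul, smul_eq_mul]
        ring }
  have hM : 0 ≤ ∫ t, ‖β t‖ * h t ^ 2 ∂lam := integral_nonneg fun t => by positivity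
  refine ⟨A.mkContinuous ((∫ t, ‖β t‖ * h t ^ 2 ∂lam) * ‖H.memLp.toLp g‖ * ‖H.memLp.toLp g‖)
    fun f => ?_, fun f => ?_⟩
  · have h1 : ‖(H.memLp_integral f).toLp _‖ ≤
        ((∫ t, ‖β t‖ * h t ^ 2 ∂lam) * (∫ y, g y * ‖f y‖ ∂μ)) * ‖H.memLp.toLp g‖ := by
      refine Lp.norm_le_mul_norm_of_ae_le_mul ?_
      filter_upwards [(H.memLp_integral f).coeFn_toLp, H.memLp.coeFn_toLp] with x h1 h2
      rw [h1, h2, Real.norm_of_nonneg (H.nonneg x)]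
      exact H.norm_integral_factorKernel_mul_le f x
    refine h1.trans ?_
    calc _ ≤ ((∫ t, ‖β t‖ * h t ^ 2 ∂lam) * (‖H.memLp.toLp g‖ * ‖f‖)) * ‖H.memLp.toLp g‖ := by
          gcongr
          exact (integrable_mul_norm H.memLp f).2
      _ = _ := by ring
  · filter_upwards [(H.memLp_integral f).coeFn_toLp] with x hx
    exact ⟨H.integrable_factorKernel_mul f x, hx⟩

lemma memLp_phi (H : IsFactorization μ lam φ β g h) (t : S) :
    MemLp (fun x => (φ t x : ℂ)) 2 μ := by
  refine MemLp.of_le_mul (c := h t) H.memLp ?_ (ae_of_all _ fun x => ?_)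
  · have h1 : Measurable fun x => φ t x :=
      H.measurable_phi.comp (measurable_const.prodMk measurable_id)
    exact (Complex.measurable_ofReal.comp h1).aestronglyMeasurable
  · rw [Complex.norm_real, Real.norm_eq_abs, Real.norm_of_nonneg (H.nonneg x)]
    exact H.abs_le t x

lemma norm_toLp_phi_sq (H : IsFactorization μ lam φ β g h) (t : S) :
    ‖(H.memLp_phi t).toLp _‖ ^ 2 = ∫ x, φ t x ^ 2 ∂μ := by
  have h1 := inner_self_eq_norm_sq_to_K (𝕜 := ℂ) ((H.memLp_phi t).toLp _)
  rw [L2.inner_def] at h1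
  have h2 : ∫ x, ⟪((H.memLp_phi t).toLp _) x, ((H.memLp_phi t).toLp _) x⟫_ℂ ∂μ =
      ∫ x, ((φ t x ^ 2 : ℝ) : ℂ) ∂μ := by
    refine integral_congr_ae ?_
    filter_upwards [(H.memLp_phi t).coeFn_toLp] with x hx
    rw [hx, RCLike.inner_apply, Complex.conj_ofReal]
    push_cast
    ring
  rw [h2, integral_complex_ofReal] at h1
  refine Complex.ofReal_injective ?_
  push_cast
  exact h1.symm

lemma integrable_norm_sq [SFinite μ] (H : IsFactorization μ lam φ β g h) :
    Integrable (fun t => ‖β t‖ * ‖(H.memLp_phi t).toLp _‖ ^ 2) lam := by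
  refine Integrable.mono' (H.integrable.mul_const (‖H.memLp.toLp g‖ ^ 2)) ?_
    (ae_of_all _ fun t => ?_)
  · simp only [H.norm_toLp_phi_sq]
    have h1 : StronglyMeasurable (Function.uncurry fun t x => φ t x ^ 2) :=
      (H.measurable_phi.pow_const 2).stronglyMeasurable
    exact (H.measurable_beta.norm.aestronglyMeasurable).mul
      h1.integral_prod_right.aestronglyMeasurable
  · have h1 : ‖(H.memLp_phi t).toLp _‖ ≤ h t * ‖H.memLp.toLp g‖ := by
      refine Lp.norm_le_mul_norm_of_ae_le_mul ?_
      filter_upwards [(H.memLp_phi t).coeFn_toLp, H.memLp.coeFn_toLp] with x h1 h2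
      rw [h1, h2, Real.norm_of_nonneg (H.nonneg x), Complex.norm_real]
      exact H.abs_le t x
    rw [Real.norm_of_nonneg (by positivity)]
    calc ‖β t‖ * ‖(H.memLp_phi t).toLp _‖ ^ 2 ≤ ‖β t‖ * (h t * ‖H.memLp.toLp g‖) ^ 2 := by gcongr
      _ = _ := by ring

/-- An integral operator with a factorized kernel is an integral of rank one operators; this is
Fubini's theorem for `∫∫∫ conj(u(x)) φ_t(x) φ_t(y) v(y) β(t)`. -/
lemma isRankOneIntegral [SFinite μ] [SFinite lam] (H : IsFactorization μ lam φ β g h)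
    {T : Lp ℂ 2 μ →L[ℂ] Lp ℂ 2 μ} (hT : HasIntegralKernel μ (factorKernel lam φ β) T) :
    IsRankOneIntegral lam β (fun t => (H.memLp_phi t).toLp _) T := by
  intro u v
  set F : (X × X) × S → ℂ := fun p =>
    ((φ p.2 p.1.1 * φ p.2 p.1.2 : ℝ) : ℂ) * β p.2 * (starRingEnd ℂ (u p.1.1) * v p.1.2) with hF
  have hFint : Integrable F ((μ.prod μ).prod lam) := by
    have hb := ((integrable_mul_norm H.memLp u).1.mul_prod
      (integrable_mul_norm H.memLp v).1).mul_prod H.integrable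
    refine Integrable.mono' hb ?_ (ae_of_all _ fun p => ?_)
    · have hu : Measurable fun p : (X × X) × S => starRingEnd ℂ (u p.1.1) :=
        Complex.continuous_conj.measurable.comp ((Lp.stronglyMeasurable u).measurable.comp
          (measurable_fst.comp measurable_fst))
      have hv : Measurable fun p : (X × X) × S => v p.1.2 :=
        (Lp.stronglyMeasurable v).measurable.comp (measurable_snd.comp measurable_fst)
      exact (H.measurable_triple.mul (hu.mul hv)).aestronglyMeasurable
    · simp only [hF]
      rw [norm_mul, norm_mul (starRingEnd ℂ _), RCLike.norm_conj]
      calc _ ≤ (g p.1.1 * g p.1.2 * (‖β p.2‖ * h p.2 ^ 2)) * (‖u p.1.1‖ * ‖v p.1.2‖) := by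
            gcongr; exact H.norm_integrand_le _ _ _
        _ = _ := by ring
  have hinner : ∀ t, ∫ q, F (q, t) ∂(μ.prod μ) =
      β t * (⟪u, (H.memLp_phi t).toLp _⟫_ℂ * ⟪(H.memLp_phi t).toLp _, v⟫_ℂ) := by
    intro t
    have e1 : ⟪u, (H.memLp_phi t).toLp _⟫_ℂ = ∫ x, (φ t x : ℂ) * starRingEnd ℂ (u x) ∂μ := by
      rw [L2.inner_def]
      refine integral_congr_ae ?_
      filter_upwards [(H.memLp_phi t).coeFn_toLp] with x hx
      rw [hx, RCLike.inner_apply]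
    have e2 : ⟪(H.memLp_phi t).toLp _, v⟫_ℂ = ∫ x, v x * (φ t x : ℂ) ∂μ := by
      rw [L2.inner_def]
      refine integral_congr_ae ?_
      filter_upwards [(H.memLp_phi t).coeFn_toLp] with x hx
      rw [hx, RCLike.inner_apply, Complex.conj_ofReal]
    rw [e1, e2, ← integral_prod_mul, ← integral_const_mul]
    refine integral_congr_ae (ae_of_all _ fun q => ?_)
    simp only [hF]
    push_cast
    ring
  refine ⟨hFint.integral_prod_right.congr (ae_of_all _ hinner), ?_⟩
  rw [← integral_congr_ae (ae_of_all _ hinner), integral_integral_swap (f := fun t q => F (q, t))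
    hFint.swap, integral_prod _ hFint.integral_prod_left, L2.inner_def]
  refine integral_congr_ae ?_
  filter_upwards [hT v] with x hx
  rw [hx.2, RCLike.inner_apply, ← integral_mul_const]
  refine integral_congr_ae (ae_of_all _ fun y => ?_)
  simp only [hF]
  rw [integral_mul_const, factorKernel]
  ring

end IsFactorization

end FactorKernel

/-! ### The truncated Bessel operator -/

/-- `√s J_ν(s)` is bounded up to a singularity at the origin that is locally square integrable. -/
lemma exists_abs_sqrtBessel_le {ν : ℝ} (hν : -1 < ν) :
    ∃ α C : ℝ, 0 ≤ α ∧ α < 1 / 2 ∧ 0 ≤ C ∧ ∀ s, 0 < s → |sqrtBessel ν s| ≤ C * (1 + s ^ (-α)) := by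
  obtain ⟨A, hA, ha⟩ := exists_abs_sqrtBessel_le_rpow hν
  obtain ⟨B, hB, hb⟩ := exists_sqrtBessel_sq_le_of_one_le hν
  refine ⟨max 0 (-(ν + 1 / 2)), A + √B, le_max_left _ _, max_lt (by norm_num) (by linarith),
    by positivity, fun s hs => ?_⟩
  have hp : 0 < s ^ (-max 0 (-(ν + 1 / 2))) := Real.rpow_pos_of_pos hs _
  have hB' := Real.sqrt_nonneg B
  rcases le_total s 1 with h | h
  · have h1 : s ^ (ν + 1 / 2) ≤ s ^ (-max 0 (-(ν + 1 / 2))) :=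
      Real.rpow_le_rpow_of_exponent_ge hs h (by linarith [le_max_right 0 (-(ν + 1 / 2))])
    calc |sqrtBessel ν s| ≤ A * s ^ (ν + 1 / 2) := ha s hs h
      _ ≤ (A + √B) * (1 + s ^ (-max 0 (-(ν + 1 / 2)))) := by
        gcongr
        · linarith
        · linarith
  · have h1 : |sqrtBessel ν s| ≤ √B := Real.abs_le_sqrt (hb s h).1
    nlinarith [mul_nonneg hA hp.le, mul_nonneg hB' hp.le]

lemma integrableOn_one_add_rpow_sq {α τ : ℝ} (hα : α < 1 / 2) (hτ : 0 ≤ τ) :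
    IntegrableOn (fun x : ℝ => (1 + |x| ^ (-α)) ^ 2) (Ioc 0 τ) := by
  have i1 : IntegrableOn (fun x : ℝ => x ^ (-α)) (Ioc 0 τ) :=
    (intervalIntegrable_iff_integrableOn_Ioc_of_le hτ).1
      (intervalIntegral.intervalIntegrable_rpow' (by linarith))
  have i2 : IntegrableOn (fun x : ℝ => x ^ (-(2 * α))) (Ioc 0 τ) :=
    (intervalIntegrable_iff_integrableOn_Ioc_of_le hτ).1
      (intervalIntegral.intervalIntegrable_rpow' (by linarith))
  have i0 : IntegrableOn (fun _ : ℝ => (1 : ℝ)) (Ioc 0 τ) :=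
    integrableOn_const measure_Ioc_lt_top.ne
  refine ((i0.add (i1.const_mul 2)).add i2).congr_fun (fun x hx => ?_) measurableSet_Ioc
  have hx0 : 0 < x := hx.1
  simp only [Pi.add_apply]
  rw [abs_of_pos hx0, show -(2 * α) = -α + -α by ring, Real.rpow_add hx0]
  ring

/-- By continuity the essential bound of `b` holds everywhere on `(0,∞)`. -/
lemma exists_norm_le_of_memLp_top {b : ℝ → ℂ} (hb_top : MemLp b ∞ (volume.restrict (Ioi 0)))
    (hb_cont : ContinuousOn b (Ici 0)) : ∃ M, 0 ≤ M ∧ ∀ t, 0 < t → ‖b t‖ ≤ M := by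
  refine ⟨(eLpNorm b ∞ (volume.restrict (Ioi 0))).toReal, ENNReal.toReal_nonneg, fun t ht => ?_⟩
  set M := (eLpNorm b ∞ (volume.restrict (Ioi 0))).toReal
  have hae : ∀ᵐ s, s ∈ Ioi (0 : ℝ) → ‖b s‖ ≤ M := by
    rw [← ae_restrict_iff' measurableSet_Ioi]
    filter_upwards [ae_le_eLpNormEssSup (f := b) (μ := volume.restrict (Ioi 0))] with s hs
    rw [← eLpNorm_exponent_top] at hs
    have := ENNReal.toReal_mono hb_top.eLpNorm_lt_top.ne hs
    rwa [toReal_enorm] at this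
  by_contra hlt
  rw [not_le] at hlt
  have hcont : ContinuousAt b t := hb_cont.continuousAt (Ici_mem_nhds ht)
  have hU : {s | s ∈ Ioi (0 : ℝ) ∧ M < ‖b s‖} ∈ 𝓝 t :=
    by
    filter_upwards [Ioi_mem_nhds ht, hcont.norm.eventually (lt_mem_nhds hlt)] with s h1 h2
    exact ⟨h1, h2⟩
  have hpos := Measure.measure_pos_of_mem_nhds volume hU
  refine hpos.ne' (measure_mono_null (fun s hs => ?_) (ae_iff.1 hae))
  simp only [mem_ofPred_eq, not_forall, not_le] at hs ⊢
  exact ⟨hs.1, hs.2⟩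

/-- The Bessel kernel is a factorized kernel with `φ_t(x) = √(xt) J_ν(xt)`. -/
lemma exists_isFactorization {ν : ℝ} (hν : -1 < ν) {b : ℝ → ℂ}
    (hb_top : MemLp b ∞ (volume.restrict (Ioi 0)))
    (hb_one : MemLp b 1 (volume.restrict (Ioi 0)))
    (hb_cont : ContinuousOn b (Ici 0)) :
    ∃ g h : ℝ → ℝ, ∀ τ > 0, IsFactorization (volume.restrict (Icc 0 τ)) (volume.restrict (Ioi 0))
      (fun t x => sqrtBessel ν (x * t)) ((Ioi 0).indicator b) g h := by
  obtain ⟨α, C, hα0, hα, hC, hbd⟩ := exists_abs_sqrtBessel_le hν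
  obtain ⟨M, hM0, hM⟩ := exists_norm_le_of_memLp_top hb_top hb_cont
  have hβ : Measurable ((Ioi (0 : ℝ)).indicator b) := by
    classical
    rw [← piecewise_eq_indicator]
    exact (hb_cont.mono Ioi_subset_Ici_self).measurable_piecewise continuousOn_const
      measurableSet_Ioi
  have hgm : Measurable fun x : ℝ => 1 + |x| ^ (-α) := by fun_prop
  refine ⟨fun x => 1 + |x| ^ (-α), fun t => C * (1 + |t| ^ (-α)),
    fun τ hτ => ⟨?_, hβ, ?_, ?_, ?_, ?_⟩⟩
  · exact (measurable_sqrtBessel hν).comp (measurable_snd.mul measurable_fst)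
  · intro x
    positivity
  · rw [memLp_two_iff_integrable_sq hgm.aestronglyMeasurable, ← IntegrableOn,
      integrableOn_Icc_iff_integrableOn_Ioc]
    exact integrableOn_one_add_rpow_sq hα hτ.le
  · intro t x
    by_cases hxt : 0 < x * t
    · have h1 := hbd (x * t) hxt
      have h2 : (x * t) ^ (-α) = |x| ^ (-α) * |t| ^ (-α) := by
        rw [← abs_of_pos hxt, abs_mul, Real.mul_rpow (abs_nonneg _) (abs_nonneg _)]
      have h3 : 0 ≤ |x| ^ (-α) := by positivity
      have h4 : 0 ≤ |t| ^ (-α) := by positivity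
      rw [h2] at h1
      rw [mul_assoc]
      refine h1.trans (mul_le_mul_of_nonneg_left ?_ hC)
      nlinarith
    · rw [sqrtBessel, if_neg hxt, abs_zero]
      positivity
  · have hmeas : Measurable fun t : ℝ =>
      ‖(Ioi (0 : ℝ)).indicator b t‖ * (C * (1 + |t| ^ (-α))) ^ 2 :=
      hβ.norm.mul ((hgm.const_mul C).pow_const 2)
    have hb1 : IntegrableOn b (Ioi 0) := memLp_one_iff_integrable.1 hb_one
    refine IntegrableOn.mono_set (IntegrableOn.union ?_ ?_)
      (Ioc_union_Ioi_eq_Ioi (zero_le_one (α := ℝ))).symm.subset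
    · refine Integrable.mono' ((integrableOn_one_add_rpow_sq hα zero_le_one).const_mul (M * C ^ 2))
        hmeas.aestronglyMeasurable ?_
      refine (ae_restrict_iff' measurableSet_Ioc).2 (ae_of_all _ fun t ht => ?_)
      have h1 := hM t ht.1
      rw [indicator_of_mem (show t ∈ Ioi (0 : ℝ) from ht.1), Real.norm_of_nonneg (by positivity),
        mul_pow, mul_assoc M]
      gcongr
    · refine Integrable.mono' ((hb1.mono_set (Ioi_subset_Ioi zero_le_one)).norm.const_mul
        (C ^ 2 * 2 ^ 2)) hmeas.aestronglyMeasurable ?_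
      refine (ae_restrict_iff' measurableSet_Ioi).2 (ae_of_all _ fun t ht => ?_)
      have ht1 : 1 < t := ht
      have ht0 : 0 < t := by linarith
      have h1 : t ^ (-α) ≤ 1 := Real.rpow_le_one_of_one_le_of_nonpos ht1.le (by linarith)
      have h2 : 0 ≤ t ^ (-α) := by positivity
      rw [indicator_of_mem (show t ∈ Ioi (0 : ℝ) from ht0), Real.norm_of_nonneg (by positivity),
        abs_of_pos ht0, mul_pow, mul_comm]
      gcongr
      linarith

lemma sqrtBessel_mul_sqrtBessel {ν x y t : ℝ} (hx : 0 ≤ x) (hy : 0 ≤ y) (ht : 0 < t) :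
    t * √(x * y) * besselJ ν (x * t) * besselJ ν (y * t) =
      sqrtBessel ν (x * t) * sqrtBessel ν (y * t) := by
  rcases hx.eq_or_lt with rfl | hx
  · simp [sqrtBessel_zero]
  rcases hy.eq_or_lt with rfl | hy
  · simp [sqrtBessel_zero]
  rw [sqrtBessel_of_pos (mul_pos hx ht), sqrtBessel_of_pos (mul_pos hy ht),
    Real.sqrt_mul hx.le, Real.sqrt_mul hx.le, Real.sqrt_mul hy.le]
  have h : √t * √t = t := Real.mul_self_sqrt ht.le
  linear_combination (-(√x * √y * besselJ ν (x * t) * besselJ ν (y * t))) * h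

lemma besselIntegrand_eq {ν x y t : ℝ} (b : ℝ → ℂ) (hx : 0 ≤ x) (hy : 0 ≤ y) (ht : 0 < t) :
    besselIntegrand ν b x y t =
      ((sqrtBessel ν (x * t) * sqrtBessel ν (y * t) : ℝ) : ℂ) * (Ioi 0).indicator b t := by
  rw [besselIntegrand, sqrtBessel_mul_sqrtBessel hx hy ht,
    indicator_of_mem (show t ∈ Ioi (0 : ℝ) from ht)]

lemma besselKernel_eq {ν x y : ℝ} (b : ℝ → ℂ) (hx : 0 ≤ x) (hy : 0 ≤ y) :
    besselKernel ν b x y = factorKernel (volume.restrict (Ioi 0))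
      (fun t x => sqrtBessel ν (x * t)) ((Ioi 0).indicator b) x y :=
  setIntegral_congr_fun measurableSet_Ioi fun _ ht => besselIntegrand_eq b hx hy ht

lemma HasIntegralKernel.congr {X : Type*} [MeasurableSpace X] {μ : Measure X} {K K' : X → X → ℂ}
    {T : Lp ℂ 2 μ →L[ℂ] Lp ℂ 2 μ} (hT : HasIntegralKernel μ K T)
    (h : ∀ᵐ x ∂μ, ∀ᵐ y ∂μ, K x y = K' x y) : HasIntegralKernel μ K' T := by
  intro f
  filter_upwards [hT f, h] with x h1 h2
  have h3 : (fun y => K x y * f y) =ᵐ[μ] fun y => K' x y * f y := by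
    filter_upwards [h2] with y hy
    rw [hy]
  exact ⟨h1.1.congr h3, h1.2.trans (integral_congr_ae h3)⟩

lemma ae_ae_besselKernel_eq (ν : ℝ) (b : ℝ → ℂ) (τ : ℝ) :
    ∀ᵐ x ∂volume.restrict (Icc 0 τ), ∀ᵐ y ∂volume.restrict (Icc 0 τ),
      factorKernel (volume.restrict (Ioi 0)) (fun t x => sqrtBessel ν (x * t))
        ((Ioi 0).indicator b) x y = besselKernel ν b x y := by
  refine (ae_restrict_iff' measurableSet_Icc).2 (ae_of_all _ fun x hx => ?_)
  refine (ae_restrict_iff' measurableSet_Icc).2 (ae_of_all _ fun y hy => ?_)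
  exact (besselKernel_eq b hx.1 hy.1).symm

lemma hasIntegralKernel_truncatedBessel {ν : ℝ} {b : ℝ → ℂ} {τ : ℝ} {g h : ℝ → ℝ}
    (H : IsFactorization (volume.restrict (Icc 0 τ)) (volume.restrict (Ioi 0))
      (fun t x => sqrtBessel ν (x * t)) ((Ioi 0).indicator b) g h) :
    HasIntegralKernel (volume.restrict (Icc 0 τ)) (besselKernel ν b) (truncatedBessel ν b τ) := by
  obtain ⟨T, hT⟩ := H.exists_hasIntegralKernel
  have hT' := hT.congr (ae_ae_besselKernel_eq ν b τ)
  rw [truncatedBessel, hT'.integralOperator_eq]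
  exact hT'

lemma isRankOneIntegral_truncatedBessel {ν : ℝ} {b : ℝ → ℂ} {τ : ℝ} {g h : ℝ → ℝ}
    (H : IsFactorization (volume.restrict (Icc 0 τ)) (volume.restrict (Ioi 0))
      (fun t x => sqrtBessel ν (x * t)) ((Ioi 0).indicator b) g h) :
    IsRankOneIntegral (volume.restrict (Ioi 0)) ((Ioi 0).indicator b)
      (fun t => (H.memLp_phi t).toLp _) (truncatedBessel ν b τ) := by
  refine H.isRankOneIntegral ((hasIntegralKernel_truncatedBessel H).congr ?_)
  filter_upwards [ae_ae_besselKernel_eq ν b τ] with x hx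
  filter_upwards [hx] with y hy using hy.symm

lemma integral_sqrtBessel_mul_sq {ν t τ : ℝ} (hν : -1 < ν) (ht : 0 < t) (hτ : 0 < τ) :
    ∫ x in Icc 0 τ, sqrtBessel ν (x * t) ^ 2 = τ * besselMean ν (τ * t) := by
  rw [integral_Icc_eq_integral_Ioc, ← intervalIntegral.integral_of_le hτ.le,
    intervalIntegral.integral_comp_mul_right (fun s => sqrtBessel ν s ^ 2) ht.ne', zero_mul,
    integral_sqrtBessel_sq hν (mul_pos hτ ht), smul_eq_mul]
  field_simp

/-- The trace as an integral of the symbol against the mean value of `u J_ν(u)²`. -/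
lemma operatorTrace_truncatedBessel {ν : ℝ} (hν : -1 < ν) {b : ℝ → ℂ} {τ : ℝ} (hτ : 0 < τ)
    {g h : ℝ → ℝ}
    (H : IsFactorization (volume.restrict (Icc 0 τ)) (volume.restrict (Ioi 0))
      (fun t x => sqrtBessel ν (x * t)) ((Ioi 0).indicator b) g h) :
    IntegrableOn (fun t => b t * ((τ * besselMean ν (τ * t) : ℝ) : ℂ)) (Ioi 0) ∧
    operatorTrace (truncatedBessel ν b τ) =
      ∫ t in Ioi (0 : ℝ), b t * ((τ * besselMean ν (τ * t) : ℝ) : ℂ) := by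
  have : Fact ((2 : ℝ≥0∞) ≠ ∞) := ⟨by simp⟩
  have heq : ∀ t ∈ Ioi (0 : ℝ), (Ioi 0).indicator b t * ((‖(H.memLp_phi t).toLp _‖ ^ 2 : ℝ) : ℂ) =
      b t * ((τ * besselMean ν (τ * t) : ℝ) : ℂ) := by
    intro t ht
    rw [indicator_of_mem ht, H.norm_toLp_phi_sq t, integral_sqrtBessel_mul_sq hν ht hτ]
  have hnorm := H.integrable_norm_sq
  constructor
  · have hmeas : AEStronglyMeasurable (fun t => b t * ((τ * besselMean ν (τ * t) : ℝ) : ℂ))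
        (volume.restrict (Ioi 0)) := by
      have hm : Measurable fun t => besselMean ν (τ * t) := by
        have h0 : Measurable (besselMean ν) := by
          have h1 := measurable_sqrtBessel hν
          have h2 := measurable_sqrtBessel (show -1 < ν + 1 by linarith)
          unfold besselMean
          fun_prop
        exact h0.comp (measurable_const_mul τ)
      have hb : AEStronglyMeasurable b (volume.restrict (Ioi 0)) :=
        (H.measurable_beta.aestronglyMeasurable).congr
          ((ae_restrict_iff' measurableSet_Ioi).2 (ae_of_all _ fun t ht => indicator_of_mem ht b))
      exact hb.mul (Complex.measurable_ofReal.comp (hm.const_mul τ)).aestronglyMeasurable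
    refine Integrable.mono' hnorm hmeas
      ((ae_restrict_iff' measurableSet_Ioi).2 (ae_of_all _ fun t ht => ?_))
    rw [← heq t ht, norm_mul, Complex.norm_real, Real.norm_of_nonneg (by positivity)]
  · rw [(isRankOneIntegral_truncatedBessel H).operatorTrace_eq hnorm]
    exact setIntegral_congr_fun measurableSet_Ioi heq

/-! ### Integration by parts against the symbol -/

/-- A piecewise `C¹` function is differentiable off its finitely many nodes. At a node where the
one-sided derivatives differ `deriv` takes the value `0`, which no integral sees. -/
lemma PiecewiseC1.exists_differentiableAt {f : ℝ → ℂ} (hf : PiecewiseC1 f) :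
    ∃ s : Set ℝ, s.Countable ∧ ∀ x, 0 < x → x ∉ s → DifferentiableAt ℝ f x := by
  obtain ⟨N, t, ht0, -, hIcc, hIci⟩ := hf
  refine ⟨range t, countable_range t, fun x hx hxs => ?_⟩
  have hne : ∀ i, t i ≠ x := fun i h => hxs ⟨i, h⟩
  have key : ∀ k : Fin (N + 1), x < t k → DifferentiableAt ℝ f x := by
    intro k
    induction k using Fin.induction with
    | zero => intro h; rw [ht0] at h; exact absurd h (not_lt.2 hx.le)
    | succ i ih =>
      intro h
      rcases lt_or_gt_of_ne (hne i.castSucc) with h' | h'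
      · exact ((hIcc i).differentiableOn one_ne_zero x ⟨h'.le, h.le⟩).differentiableAt
          (Icc_mem_nhds h' h)
      · exact ih h'
  rcases lt_or_gt_of_ne (hne (Fin.last N)) with h | h
  · exact (hIci.differentiableOn one_ne_zero x h.le).differentiableAt (Ici_mem_nhds h)
  · exact key _ h

lemma norm_deriv_mul_besselRemainder_le {ν C τ t : ℝ} {b : ℝ → ℂ} (hC0 : 0 ≤ C)
    (hC : ∀ s, 0 < s → |besselRemainder ν s| ≤ C / (1 + s)) (hτ : 1 ≤ τ) (ht : 0 < t) :
    ‖deriv b t * (besselRemainder ν (τ * t) : ℂ)‖ ≤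
      C * ‖(((1 + t)⁻¹ : ℝ) : ℂ) * deriv b t‖ := by
  have h1 := hC (τ * t) (by positivity)
  have h2 : C / (1 + τ * t) ≤ C / (1 + t) := by
    gcongr
    nlinarith
  rw [norm_mul, norm_mul, Complex.norm_real, Complex.norm_real, Real.norm_eq_abs,
    Real.norm_of_nonneg (by positivity : 0 ≤ (1 + t)⁻¹)]
  calc ‖deriv b t‖ * |besselRemainder ν (τ * t)| ≤ ‖deriv b t‖ * (C / (1 + t)) := by
        gcongr; exact h1.trans h2
    _ = _ := by ring

lemma aestronglyMeasurable_besselRemainder_comp {ν τ : ℝ} (hν : -1 < ν) (hτ : 0 < τ) :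
    AEStronglyMeasurable (fun t => (besselRemainder ν (τ * t) : ℂ)) (volume.restrict (Ioi 0)) := by
  refine ContinuousOn.aestronglyMeasurable (fun t ht => ?_) measurableSet_Ioi
  have hp : 0 < τ * t := mul_pos hτ ht
  have h1 : ContinuousAt (fun t => besselRemainder ν (τ * t)) t :=
    (hasDerivAt_besselRemainder hν hp).continuousAt.comp (f := fun t => τ * t) (by fun_prop)
  exact (Complex.continuous_ofReal.continuousAt.comp h1).continuousWithinAt

/-- Integration by parts: the error term of the trace formula is `-∫ b'(t) R(τt) dt`, where `R` is
the remainder `besselRemainder ν`. -/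
lemma integral_mul_besselMean_sub {ν : ℝ} (hν : -1 < ν) {b : ℝ → ℂ} {M : ℝ}
    (hM : ∀ t, 0 < t → ‖b t‖ ≤ M)
    (hb_int : IntegrableOn b (Ioi 0))
    (hb_cont : ContinuousOn b (Ici 0))
    (hb_pw : PiecewiseC1 b)
    (hb_deriv : IntegrableOn (fun t : ℝ => (((1 + t)⁻¹ : ℝ) : ℂ) * deriv b t) (Ioi 0))
    {τ : ℝ} (hτ : 1 ≤ τ)
    (hint : IntegrableOn (fun t => b t * ((τ * besselMean ν (τ * t) : ℝ) : ℂ)) (Ioi 0)) :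
    (∫ t in Ioi (0 : ℝ), b t * ((τ * besselMean ν (τ * t) : ℝ) : ℂ)) -
      ((τ / Real.pi : ℝ) * (∫ t in Ioi (0 : ℝ), b t) - (ν / 2 : ℝ) * b 0) =
    -∫ t in Ioi (0 : ℝ), deriv b t * (besselRemainder ν (τ * t) : ℂ) := by
  have hτ0 : 0 < τ := by linarith
  obtain ⟨C, hC0, hC⟩ := exists_abs_besselRemainder_le hν
  obtain ⟨s, hs, hdiff⟩ := hb_pw.exists_differentiableAt
  have hM0 : 0 ≤ M := (norm_nonneg _).trans (hM 1 one_pos)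
  have i1 : IntegrableOn (fun t => deriv b t * (besselRemainder ν (τ * t) : ℂ)) (Ioi 0) := by
    refine Integrable.mono' (hb_deriv.norm.const_mul C)
      ((measurable_deriv b).aestronglyMeasurable.mul
        (aestronglyMeasurable_besselRemainder_comp hν hτ0))
      ((ae_restrict_iff' measurableSet_Ioi).2 (ae_of_all _ fun t ht =>
        norm_deriv_mul_besselRemainder_le hC0 hC hτ ht))
  have i2 : IntegrableOn (fun t => b t * ((τ * (besselMean ν (τ * t) - 1 / Real.pi) : ℝ) : ℂ))
      (Ioi 0) := by
    refine (hint.sub (hb_int.const_mul ((τ / Real.pi : ℝ) : ℂ))).congr (ae_of_all _ fun t => ?_)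
    simp only [Pi.sub_apply]
    push_cast
    ring
  have i12 := i1.add i2
  have hcont : ContinuousOn (fun t => b t * (besselRemainder ν (τ * t) : ℂ)) (Ici 0) := by
    refine hb_cont.mul (Complex.continuous_ofReal.comp_continuousOn
      ((continuousOn_besselRemainder hν).comp (by fun_prop) fun t ht => ?_))
    exact mul_nonneg hτ0.le ht
  have hder : ∀ t, 0 < t → t ∉ s → HasDerivAt (fun t => b t * (besselRemainder ν (τ * t) : ℂ))
      (deriv b t * (besselRemainder ν (τ * t) : ℂ) +
        b t * ((τ * (besselMean ν (τ * t) - 1 / Real.pi) : ℝ) : ℂ)) t := by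
    intro t ht hts
    have h1 := (hdiff t ht hts).hasDerivAt
    have h2 : HasDerivAt (fun t => besselRemainder ν (τ * t))
        (τ * (besselMean ν (τ * t) - 1 / Real.pi)) t := by
      have h3 : HasDerivAt (fun t => τ * t) τ t := by
        simpa using (hasDerivAt_id t).const_mul τ
      have h4 := (hasDerivAt_besselRemainder hν (mul_pos hτ0 ht)).comp t h3
      rwa [mul_comm] at h4
    exact h1.mul h2.ofReal_comp
  have hftc : ∀ R, 0 < R → ∫ t in (0 : ℝ)..R, (deriv b t * (besselRemainder ν (τ * t) : ℂ) +
        b t * ((τ * (besselMean ν (τ * t) - 1 / Real.pi) : ℝ) : ℂ)) =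
      b R * (besselRemainder ν (τ * R) : ℂ) - b 0 * ((ν / 2 : ℝ) : ℂ) := by
    intro R hR
    have h := integral_eq_of_hasDerivAt_off_countable_of_le
      (fun t => b t * (besselRemainder ν (τ * t) : ℂ)) _ hR.le hs
      (hcont.mono Icc_subset_Ici_self) (fun t ht => hder t ht.1.1 ht.2)
      ((intervalIntegrable_iff_integrableOn_Ioc_of_le hR.le).2 (i12.mono_set Ioc_subset_Ioi_self))
    rw [h, mul_zero, besselRemainder_zero]
  have hlim1 : Tendsto (fun R => b R * (besselRemainder ν (τ * R) : ℂ) - b 0 * ((ν / 2 : ℝ) : ℂ))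
      atTop (𝓝 (0 - b 0 * ((ν / 2 : ℝ) : ℂ))) := by
    refine Tendsto.sub_const ?_ _
    have h0 : Tendsto (fun R : ℝ => M * (C / R)) atTop (𝓝 0) := by
      have := (tendsto_const_nhds (x := C)).div_atTop (tendsto_id (α := ℝ))
      simpa using this.const_mul M
    refine squeeze_zero_norm' ?_ h0
    filter_upwards [eventually_gt_atTop 0] with R hR
    rw [norm_mul, Complex.norm_real, Real.norm_eq_abs]
    have h1 := hC (τ * R) (by positivity)
    have h2 : C / (1 + τ * R) ≤ C / R := by
      gcongr
      nlinarith
    exact mul_le_mul (hM R hR) (h1.trans h2) (abs_nonneg _) hM0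
  have hlim2 := intervalIntegral_tendsto_integral_Ioi 0 i12 tendsto_id
  have huniq := tendsto_nhds_unique (hlim2.congr' (by
    filter_upwards [eventually_gt_atTop 0] with R hR using hftc R hR)) hlim1
  have hsplit : ∫ t in Ioi (0 : ℝ), b t * ((τ * (besselMean ν (τ * t) - 1 / Real.pi) : ℝ) : ℂ) =
      (∫ t in Ioi (0 : ℝ), b t * ((τ * besselMean ν (τ * t) : ℝ) : ℂ)) -
        (τ / Real.pi : ℝ) * (∫ t in Ioi (0 : ℝ), b t) := by
    rw [← integral_const_mul, ← integral_sub hint (hb_int.const_mul _)]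
    refine integral_congr_ae (ae_of_all _ fun t => ?_)
    push_cast
    ring
  have hadd := integral_add i1 i2
  simp only [Pi.add_apply] at huniq
  rw [hadd, hsplit] at huniq
  linear_combination huniq

lemma tendsto_integral_deriv_mul_besselRemainder {ν : ℝ} (hν : -1 < ν) {b : ℝ → ℂ}
    (hb_deriv : IntegrableOn (fun t : ℝ => (((1 + t)⁻¹ : ℝ) : ℂ) * deriv b t) (Ioi 0)) :
    Tendsto (fun τ : ℝ => ∫ t in Ioi (0 : ℝ), deriv b t * (besselRemainder ν (τ * t) : ℂ)) atTop
      (𝓝 0) := by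
  obtain ⟨C, hC0, hC⟩ := exists_abs_besselRemainder_le hν
  rw [← integral_zero ℝ ℂ (μ := volume.restrict (Ioi 0))]
  refine tendsto_integral_filter_of_dominated_convergence
    (fun t => C * ‖(((1 + t)⁻¹ : ℝ) : ℂ) * deriv b t‖) ?_ ?_ (hb_deriv.norm.const_mul C) ?_
  · filter_upwards [eventually_gt_atTop 0] with τ hτ
    exact (measurable_deriv b).aestronglyMeasurable.mul
      (aestronglyMeasurable_besselRemainder_comp hν hτ)
  · filter_upwards [eventually_ge_atTop 1] with τ hτ
    exact (ae_restrict_iff' measurableSet_Ioi).2 (ae_of_all _ fun t ht =>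
        norm_deriv_mul_besselRemainder_le hC0 hC hτ ht)
  · refine (ae_restrict_iff' measurableSet_Ioi).2 (ae_of_all _ fun t ht => ?_)
    have ht : 0 < t := ht
    have h1 : Tendsto (fun τ : ℝ => besselRemainder ν (τ * t)) atTop (𝓝 0) := by
      have h0 : Tendsto (fun τ : ℝ => C / (1 + τ * t)) atTop (𝓝 0) :=
        tendsto_const_nhds.div_atTop
          (tendsto_atTop_add_const_left _ _ (tendsto_id.atTop_mul_const ht))
      refine squeeze_zero_norm' ?_ h0
      filter_upwards [eventually_gt_atTop 0] with τ hτ using hC _ (mul_pos hτ ht)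
    have h2 := ((Complex.continuous_ofReal.tendsto 0).comp h1).const_mul (deriv b t)
    simpa using h2

theorem proposition5p1 (ν : ℝ) (hν : -1 < ν) (b : ℝ → ℂ)
    (hb_top : MemLp b ∞ (volume.restrict (Ioi 0)))
    (hb_one : MemLp b 1 (volume.restrict (Ioi 0)))
    (hb_cont : ContinuousOn b (Ici 0))
    (hb_pw : PiecewiseC1 b)
    (hb_deriv : IntegrableOn (fun t : ℝ => (((1 + t)⁻¹ : ℝ) : ℂ) * deriv b t) (Ioi 0)) :
    -- the kernel, the operator and its trace are well defined
    (∀ x > 0, ∀ y > 0, IntegrableOn (besselIntegrand ν b x y) (Ioi 0)) ∧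
    (∀ τ > 0, HasIntegralKernel (volume.restrict (Icc 0 τ)) (besselKernel ν b)
        (truncatedBessel ν b τ) ∧
      IsTraceClass (truncatedBessel ν b τ)) ∧
    -- the asymptotics of the trace
    (fun τ : ℝ => operatorTrace (truncatedBessel ν b τ) -
        ((τ / Real.pi : ℝ) * (∫ t in Ioi (0 : ℝ), b t) - (ν / 2 : ℝ) * b 0))
      =o[atTop] (fun _ => (1 : ℝ)) := by
  obtain ⟨g, h, H⟩ := exists_isFactorization hν hb_top hb_one hb_cont
  obtain ⟨M, -, hM⟩ := exists_norm_le_of_memLp_top hb_top hb_cont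
  refine ⟨fun x hx y hy => ?_, fun τ hτ => ⟨hasIntegralKernel_truncatedBessel (H τ hτ), ?_⟩, ?_⟩
  · exact ((H 1 one_pos).integrable_integrand x y).congr
      ((ae_restrict_iff' measurableSet_Ioi).2 (ae_of_all _ fun t ht =>
        (besselIntegrand_eq b (le_of_lt hx) (le_of_lt hy) ht).symm))
  · exact (isRankOneIntegral_truncatedBessel (H τ hτ)).isTraceClass (H τ hτ).integrable_norm_sq
  · rw [isLittleO_one_iff]
    have hlim := (tendsto_integral_deriv_mul_besselRemainder hν hb_deriv).neg
    rw [neg_zero] at hlim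
    refine hlim.congr' ?_
    filter_upwards [eventually_ge_atTop 1] with τ hτ
    have hτ0 : 0 < τ := by linarith
    obtain ⟨hint, htr⟩ := operatorTrace_truncatedBessel hν hτ0 (H τ hτ0)
    rw [htr, integral_mul_besselMean_sub hν hM (memLp_one_iff_integrable.1 hb_one) hb_cont hb_pw
      hb_deriv hτ hint]
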